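/- Let $d\ge 0$, let $F:\mathbb R\to\mathbb R$ and $G_j:\mathbb R\to\mathbb R$ ($j\in\mathbb Z^d\setminus\{0\}$) be functions with $G_{-j}(-x)=G_j(x)$ for all $x$ and all $j\neq 0$, and suppose: (A) $F\in C^2(\mathbb R)$, $F(0)=0$, $F''(x)\ge\varepsilon$ for all $x$ with some $\varepsilon>0$, and $|F(x)|\le c\,e^{b|x|}$ for all $x$ with some constants $c,b$; (B) $G_j\in C^2(\mathbb R)$, $G_j(0)=0$, $G_j''\ge 0$ for all $j\ne0$, and for some $r_0$ one has $G_j\equiv0$ whenever $|j|>r_0$; (C) $c_k:=\sup_{x,y\in\mathbb R}\dfrac{|G_k''(x-y)|}{\sqrt{F''(x)}\sqrt{F''(y)}}<\infty$ for all $k\neq 0$ with $|k|\le r_0$. For $\lambda\ge 0$ let $\mathcal G$ be the set of Gibbs measures, i.e. of the probability measures $\mu$ on the product $\sigma$-algebra of $\mathbb R^{\mathbb Z^d}$ such that $\int\mu_\Lambda(f)\,d\mu=\int f\,d\mu$ for every finite $\Lambda\subset\mathbb Z^d$ and every bounded continuous function $f$ of finitely many coordinates, where $\mu_\Lambda(f)$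 is the integral of $f$ over $(x_k)_{k\in\Lambda}$, the coordinates outside $\Lambda$ being kept fixed, against the probability measure $$d\mu_\Lambda=\frac1{Z_\Lambda}\exp\Big\{-\lambda\sum_{\{k,j\}\cap\Lambda\ne\emptyset}G_{k-j}(x_k-x_j)\Big\}\prod_{k\in\Lambda}e^{-F(x_k)}\,dx_k ,$$ the sum being over unordered pairs $\{k,j\}$ of distinct sites. Put $\rho(x,y)=\int_x^y\sqrt{F''(s)}\,ds$ and $m_\mu=\sup_{k\in\mathbb Z^d}\int\rho^2(x_k,0)\,d\mu$. 1. For every $\lambda\ge0$ there is a $\mu\in\mathcal G$ with $m_\mu<\infty$. 2. Let $\delta$ be a translation invariant semimetric on $\mathbb Z^d$ (nonnegative, symmetric, zero on the diagonal, satisfying the triangle inequality), let $\gamma_\delta=\sum_{k\ne0}e^{\delta(k,0)}c_k$ and let $0\le\lambda<1/\gamma_\delta$ (where $1/0=\infty$). Then there is exactly one $\tilde\mu\in\mathcal G$ with $m_{\tilde\mu}<\infty$. If, in addition, $F$ and all $G_j$ are even functions, then $$\sup_{k\in\mathbb Z^d}\int\exp(a x_k^2)\,d\tilde\mu\le\exp\Big(\frac{a}{\varepsilon-2a}\Big)\qquad\text{for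 all }a\in[0,\varepsilon/2).$$ -/

import Mathlib

open MeasureTheory
open scoped ENNReal

noncomputable section

namespace LatticeGibbs

/-- The lattice `ℤ^d`. It carries the sup norm; all conditions below only ask for *some*
interaction radius, so the choice of norm is immaterial. -/
abbrev Lattice (d : ℕ) : Type := Fin d → ℤ

/-- Spin configurations `x = (x_k)`, with the product topology and product sigma-algebra. -/
abbrev Config (d : ℕ) : Type := Lattice d → ℝ

/-- Condition A on the self-action potential, with convexity constant `ε`. -/
structure ConditionA (F : ℝ → ℝ) (ε : ℝ) : Prop where
  contDiff : ContDiff ℝ 2 F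
  zero : F 0 = 0
  eps_pos : 0 < ε
  convex : ∀ x, ε ≤ deriv (deriv F) x
  growth : ∃ c a : ℝ, ∀ x, |F x| ≤ c * Real.exp (a * |x|)

/-- Condition B on the pair potentials `G j`, `j ≠ 0` (the value `G 0` is never used),
with interaction radius `r₀`. -/
structure ConditionB {d : ℕ} (G : Lattice d → ℝ → ℝ) (r₀ : ℝ) : Prop where
  contDiff : ∀ j, j ≠ 0 → ContDiff ℝ 2 (G j)
  zero : ∀ j, j ≠ 0 → G j 0 = 0
  convex : ∀ j, j ≠ 0 → ∀ x, 0 ≤ deriv (deriv (G j)) x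
  finiteRange : ∀ j, j ≠ 0 → r₀ < ‖j‖ → ∀ x, G j x = 0

/-- `G_{k-j}(x_k - x_j)` is a function of the unordered pair `{k, j}`. -/
def PairSymmetric {d : ℕ} (G : Lattice d → ℝ → ℝ) : Prop :=
  ∀ j, j ≠ 0 → ∀ x, G (-j) (-x) = G j x

/-- `sup_{x,y} |G_k''(x - y)| / (√F''(x) √F''(y))`, as an extended number. -/
def coupling {d : ℕ} (F : ℝ → ℝ) (G : Lattice d → ℝ → ℝ) (k : Lattice d) : ℝ≥0∞ :=
  ⨆ (x : ℝ) (y : ℝ), ENNReal.ofReal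
    (|deriv (deriv (G k)) (x - y)| / (√(deriv (deriv F) x) * √(deriv (deriv F) y)))

/-- Condition C: domination of the interaction by the self-action. -/
def ConditionC {d : ℕ} (F : ℝ → ℝ) (G : Lattice d → ℝ → ℝ) (r₀ : ℝ) : Prop :=
  ∀ k, k ≠ 0 → ‖k‖ ≤ r₀ → coupling F G k < ∞

/-- The configuration equal to `x` on `Λ` and to the boundary condition `y` off `Λ`. -/
def glue {d : ℕ} (Λ : Finset (Lattice d)) (y : Config d) (x : Λ → ℝ) : Config d :=
  fun k => if h : k ∈ Λ then x ⟨k, h⟩ else y k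

/-- The interaction energy `∑ G_{k-j}(x_k - x_j)` over all unordered pairs `{k, j}`, `k ≠ j`,
that meet `Λ`: pairs inside `Λ` are listed twice in the first double sum, hence the `1/2`. The
second inner sum has finitely many nonzero terms under a finite range assumption. -/
def interaction {d : ℕ} (G : Lattice d → ℝ → ℝ) (Λ : Finset (Lattice d)) (x : Config d) : ℝ :=
  (1 / 2 : ℝ) * ∑ k ∈ Λ, ∑ j ∈ Λ.erase k, G (k - j) (x k - x j)
    + ∑ k ∈ Λ, ∑ᶠ j ∈ (Λ : Set (Lattice d))ᶜ, G (k - j) (x k - x j)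

/-- The unnormalized density of the finite volume conditional measure. -/
def weight {d : ℕ} (F : ℝ → ℝ) (G : Lattice d → ℝ → ℝ) (lam : ℝ)
    (Λ : Finset (Lattice d)) (x : Config d) : ℝ :=
  Real.exp (-(lam * interaction G Λ x)) * ∏ k ∈ Λ, Real.exp (-F (x k))

/-- The normalization factor `Z_Λ`, as a function of the boundary condition `y`. -/
def partitionFn {d : ℕ} (F : ℝ → ℝ) (G : Lattice d → ℝ → ℝ) (lam : ℝ)
    (Λ : Finset (Lattice d)) (y : Config d) : ℝ :=
  ∫ x : Λ → ℝ, weight F G lam Λ (glue Λ y x)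

/-- The conditional expectation `μ_Λ(f)` of `f` given the configuration `y` off `Λ`. -/
def condMean {d : ℕ} (F : ℝ → ℝ) (G : Lattice d → ℝ → ℝ) (lam : ℝ)
    (Λ : Finset (Lattice d)) (f : Config d → ℝ) (y : Config d) : ℝ :=
  (partitionFn F G lam Λ y)⁻¹ *
    ∫ x : Λ → ℝ, f (glue Λ y x) * weight F G lam Λ (glue Λ y x)

/-- Bounded continuous functions of finitely many coordinates. -/
structure IsBddCylinder {d : ℕ} (f : Config d → ℝ) : Prop where
  continuous : Continuous f
  bounded : ∃ C : ℝ, ∀ x, |f x| ≤ C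
  cylinder : ∃ Δ : Finset (Lattice d), DependsOn f (Δ : Set (Lattice d))

/-- Gibbs measures: `μ(μ_Λ(f)) = μ(f)` for all finite `Λ` and all bounded cylinder `f`. -/
structure IsGibbs {d : ℕ} (F : ℝ → ℝ) (G : Lattice d → ℝ → ℝ) (lam : ℝ)
    (μ : Measure (Config d)) : Prop where
  isProbabilityMeasure : IsProbabilityMeasure μ
  dlr : ∀ (Λ : Finset (Lattice d)) (f : Config d → ℝ), IsBddCylinder f →
    ∫ y, condMean F G lam Λ f y ∂μ = ∫ y, f y ∂μ

/-- `ρ(x, y) = ∫_x^y √F''(s) ds`. -/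
def rho (F : ℝ → ℝ) (x y : ℝ) : ℝ := ∫ s in x..y, √(deriv (deriv F) s)

/-- `m_μ = sup_k ∫ ρ²(x_k, 0) dμ`, as an extended number. -/
def secondMoment {d : ℕ} (F : ℝ → ℝ) (μ : Measure (Config d)) : ℝ≥0∞ :=
  ⨆ k : Lattice d, ∫⁻ x, ENNReal.ofReal (rho F (x k) 0 ^ 2) ∂μ

/-- The Gibbs measures with `m_μ < ∞`. -/
def temperedGibbs {d : ℕ} (F : ℝ → ℝ) (G : Lattice d → ℝ → ℝ) (lam : ℝ) :
    Set (Measure (Config d)) :=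
  {μ | IsGibbs F G lam μ ∧ secondMoment F μ < ∞}

/-- Translation invariant semimetrics on the lattice (distinct points may be at distance `0`). -/
structure IsInvariantSemimetric {d : ℕ} (δ : Lattice d → Lattice d → ℝ) : Prop where
  nonneg : ∀ k j, 0 ≤ δ k j
  self : ∀ k, δ k k = 0
  symm : ∀ k j, δ k j = δ j k
  triangle : ∀ k j l, δ k l ≤ δ k j + δ j l
  translate : ∀ k j l, δ (k + l) (j + l) = δ k j

/-- `γ_δ = ∑_{k ≠ 0} e^{δ(k,0)} sup_{x,y} |G_k''(x - y)| / (√F''(x) √F''(y))`. -/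
def gammaConst {d : ℕ} (F : ℝ → ℝ) (G : Lattice d → ℝ → ℝ)
    (δ : Lattice d → Lattice d → ℝ) : ℝ≥0∞ :=
  ∑' k : {k : Lattice d // k ≠ 0}, ENNReal.ofReal (Real.exp (δ k 0)) * coupling F G k

end LatticeGibbs

end

/-!
Linear parts of the pair potentials cancel. Pair symmetry makes `j ↦ G_j'(0)` odd, so in the
interaction energy the spins of `Λ` enter the linear parts with total coefficient zero, and what
remains depends on the boundary condition only. Replacing `G_j u` by `G_j u - G_j'(0) u` therefore
changes no conditional expectation (`temperedGibbs_normalized`), and each `G_j` may be assumed to be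
convex with minimum `0` at the origin. This is the setting of the structure `Model`.

*Existence.* Take the finite volume measures in cubes whose boundary condition is the minimizer `p`
of `F`. The constant configuration `p` then minimizes the energy `H`, and differentiating the
scaling identity `∫ exp (-H (p + s (x - p))) dx = s⁻ⁿ ∫ exp (-H)` at `s = 1` bounds the mean of the
radial derivative of `H` by the number of sites (`lintegral_radial_deriv_le`). By Cauchy–Schwarz the
contribution of `F` to this derivative at a site dominates `ρ(x_k, p) ^ 2`, and the pair potentials
only add to it, so the sum over the sites of `∫ ρ(x_k, p) ^ 2` is at most the volume
(`Model.lintegral_sum_psi_sub_sq_le`). A bound for each single site results from averaging the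
measure over the translations in the cube. The averages are tight, they satisfy the equilibrium
equations up to a boundary error that vanishes because cubes are Følner sets, and any limit is a
tempered Gibbs measure (`Model.exists_isGibbs`).

*Uniqueness.* This is Dobrushin's argument in the metric `ρ`. The same scaling inequality in
dimension one shows that the conditional distribution of one spin has second moment at most `1` in
the metric `ρ` about its mode, so the covariance of two Lipschitz functions is at most the product
of their Lipschitz constants. Interpolating between two boundary conditions that differ at one site,
the constant `λ c_k` bounds the influence of that site (`abs_gibbsMean_sub_le`,
`Model.hasOscillation_condMean_singleton`). As `λ ∑ c_k ≤ λ γ_δ < 1`, repeated averaging over single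
spins makes the total oscillation of a local observable decay geometrically, while the finite second
moments bound the difference of its two means by a multiple of the total oscillation
(`Model.eq_of_mem_temperedGibbs`).

*Gaussian moments.* For even potentials `p = 0`. The Prékopa–Leindler inequality, applied to the
density tilted by `exp (s x_k)` and its reflection, gives `∫ exp (s x_k) ≤ exp (s ^ 2 / (2 ε))` in
every finite volume (`Model.lintegral_exp_mul_finiteVolume_le`). Averaging over a Gaussian `s` turns
this into the bound on `∫ exp (a x_k ^ 2)` (`lintegral_exp_mul_sq_le`), which passes to the limit.
-/

/-! ### Interaction energies as sums over pairs -/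

namespace LatticeGibbs

open Finset Function

variable {d : ℕ}

/-- The lattice points of norm at most `r₀`. -/
noncomputable def latticeBall (d : ℕ) (r₀ : ℝ) : Finset (Lattice d) :=
  ((isCompact_closedBall (0 : Lattice d) r₀).finite_of_discrete).toFinset

lemma mem_latticeBall {r₀ : ℝ} {j : Lattice d} : j ∈ latticeBall d r₀ ↔ ‖j‖ ≤ r₀ := by
  simp [latticeBall]

/-- The set `Λ` enlarged by all points at distance at most `r₀`. -/
noncomputable def collar (r₀ : ℝ) (Λ : Finset (Lattice d)) : Finset (Lattice d) :=
  Λ ∪ Λ.biUnion fun k => (latticeBall d r₀).image fun i => k - i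

lemma subset_collar (r₀ : ℝ) (Λ : Finset (Lattice d)) : Λ ⊆ collar r₀ Λ := subset_union_left

lemma mem_collar_of_norm_le {r₀ : ℝ} {Λ : Finset (Lattice d)} {k j : Lattice d} (hk : k ∈ Λ)
    (h : ‖k - j‖ ≤ r₀) : j ∈ collar r₀ Λ := by
  refine mem_union_right _ (mem_biUnion.2 ⟨k, hk, mem_image.2 ⟨k - j, ?_, by simp⟩⟩)
  exact mem_latticeBall.2 h

/-- The energy of the ordered pair `(k, j)` if it is a pair of distinct sites meeting `Λ`, and `0`
otherwise. -/
noncomputable def pairTerm (G : Lattice d → ℝ → ℝ) (Λ : Finset (Lattice d)) (x : Config d)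
    (k j : Lattice d) : ℝ :=
  if k ≠ j ∧ (k ∈ Λ ∨ j ∈ Λ) then G (k - j) (x k - x j) else 0

lemma pairTerm_symm {G : Lattice d → ℝ → ℝ} (hsymm : PairSymmetric G) (Λ : Finset (Lattice d))
    (x : Config d) (k j : Lattice d) : pairTerm G Λ x k j = pairTerm G Λ x j k := by
  unfold pairTerm
  by_cases h : k = j
  · simp [h]
  · have := hsymm (k - j) (sub_ne_zero.2 h) (x k - x j)
    rw [neg_sub, neg_sub] at this
    simp only [ne_eq, h, not_false_eq_true, true_and, Ne.symm (h : k ≠ j), this, or_comm]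

/-- The interaction energy is half the sum of the energies of the ordered pairs meeting `Λ`, and
the sum can be taken over any finite box containing the interaction range of `Λ`. -/
lemma interaction_eq_sum {G : Lattice d → ℝ → ℝ} {r₀ : ℝ} (hsymm : PairSymmetric G)
    (hG : ∀ j, j ≠ 0 → r₀ < ‖j‖ → ∀ x, G j x = 0) {Λ B : Finset (Lattice d)}
    (hB : collar r₀ Λ ⊆ B) (x : Config d) :
    interaction G Λ x = (1 / 2 : ℝ) * ∑ k ∈ B, ∑ j ∈ B, pairTerm G Λ x k j := by
  have hΛ : Λ ⊆ B := (subset_collar r₀ Λ).trans hB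
  have h1 : ∀ k ∈ Λ, ∑ᶠ j ∈ (Λ : Set (Lattice d))ᶜ, G (k - j) (x k - x j)
      = ∑ j ∈ B \ Λ, pairTerm G Λ x k j := by
    intro k hk
    rw [finsum_mem_eq_sum_of_inter_support_eq (t := B \ Λ)]
    · refine sum_congr rfl fun j hj => ?_
      have : k ≠ j := by rintro rfl; simp_all
      simp [pairTerm, this, hk]
    · ext j
      simp only [Set.mem_inter_iff, Set.mem_compl_iff, mem_coe, mem_support, mem_sdiff]
      refine ⟨fun ⟨a, b⟩ => ⟨⟨?_, a⟩, b⟩, fun ⟨a, b⟩ => ⟨a.2, b⟩⟩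
      by_contra hj
      refine b (hG _ (sub_ne_zero.2 (by rintro rfl; exact a hk)) ?_ _)
      by_contra hle
      exact hj (hB (mem_collar_of_norm_le hk (not_lt.1 hle)))
  have h2 : ∀ k ∈ Λ, ∑ j ∈ Λ.erase k, G (k - j) (x k - x j) = ∑ j ∈ Λ, pairTerm G Λ x k j := by
    intro k hk
    rw [← sum_erase Λ (a := k) (f := fun j => pairTerm G Λ x k j) (by simp [pairTerm])]
    refine sum_congr rfl fun j hj => ?_
    simp [pairTerm, (ne_of_mem_erase hj).symm, hk]
  have h3 : ∀ f : Lattice d → ℝ, ∑ k ∈ B, f k = ∑ k ∈ B \ Λ, f k + ∑ k ∈ Λ, f k :=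
    fun f => (sum_sdiff hΛ).symm
  have h4 : ∑ k ∈ B \ Λ, ∑ j ∈ B \ Λ, pairTerm G Λ x k j = 0 :=
    sum_eq_zero fun k hk => sum_eq_zero fun j hj => by
      simp [pairTerm, (mem_sdiff.1 hk).2, (mem_sdiff.1 hj).2]
  have h5 : ∑ k ∈ B \ Λ, ∑ j ∈ Λ, pairTerm G Λ x k j
      = ∑ k ∈ Λ, ∑ j ∈ B \ Λ, pairTerm G Λ x k j := by
    rw [sum_comm]
    exact sum_congr rfl fun k _ => sum_congr rfl fun j _ => pairTerm_symm hsymm ..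
  rw [interaction, sum_congr rfl h1, sum_congr rfl h2, h3]
  simp only [h3 (pairTerm G Λ x _), sum_add_distrib, h4, h5]
  ring

/-- The energy of the configuration `x` in the volume `Λ`, so that `weight = exp (-energy)`. -/
noncomputable def energy (F : ℝ → ℝ) (G : Lattice d → ℝ → ℝ) (lam : ℝ) (Λ : Finset (Lattice d))
    (x : Config d) : ℝ := lam * interaction G Λ x + ∑ k ∈ Λ, F (x k)

lemma weight_eq_exp (F : ℝ → ℝ) (G : Lattice d → ℝ → ℝ) (lam : ℝ) (Λ : Finset (Lattice d))
    (x : Config d) : weight F G lam Λ x = Real.exp (-energy F G lam Λ x) := by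
  rw [weight, energy, neg_add, Real.exp_add, ← Finset.sum_neg_distrib, Real.exp_sum]

/-- The standing assumptions on the potentials, normalized so that every `G j` is minimal at the
origin. -/
structure Model (F : ℝ → ℝ) (G : Lattice d → ℝ → ℝ) (ε r₀ lam : ℝ) : Prop where
  condA : ConditionA F ε
  condB : ConditionB G r₀
  symm : PairSymmetric G
  lam_nonneg : 0 ≤ lam
  nonneg : ∀ j, j ≠ 0 → ∀ u, 0 ≤ G j u

namespace Model

variable {F : ℝ → ℝ} {G : Lattice d → ℝ → ℝ} {ε r₀ lam : ℝ}

lemma interaction_eq (M : Model F G ε r₀ lam) {Λ B : Finset (Lattice d)}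
    (hB : collar r₀ Λ ⊆ B) (x : Config d) :
    interaction G Λ x = (1 / 2 : ℝ) * ∑ k ∈ B, ∑ j ∈ B, pairTerm G Λ x k j :=
  interaction_eq_sum M.symm M.condB.finiteRange hB x

lemma continuous_F (M : Model F G ε r₀ lam) : Continuous F := M.condA.contDiff.continuous

lemma continuous_pairTerm (M : Model F G ε r₀ lam) (Λ : Finset (Lattice d)) (k j : Lattice d) :
    Continuous fun x : Config d => pairTerm G Λ x k j := by
  unfold pairTerm
  split_ifs with h
  · exact (M.condB.contDiff _ (sub_ne_zero.2 h.1)).continuous.comp (by fun_prop)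
  · exact continuous_const

lemma continuous_interaction (M : Model F G ε r₀ lam) (Λ : Finset (Lattice d)) :
    Continuous fun x : Config d => interaction G Λ x := by
  simp_rw [M.interaction_eq Subset.rfl]
  exact continuous_const.mul (continuous_finsetSum _ fun k _ => continuous_finsetSum _ fun j _ =>
    M.continuous_pairTerm Λ k j)

lemma continuous_energy (M : Model F G ε r₀ lam) (Λ : Finset (Lattice d)) :
    Continuous (energy F G lam Λ) := by
  have := M.continuous_interaction Λ
  have hF := M.continuous_F
  unfold energy
  fun_prop

lemma continuous_weight (M : Model F G ε r₀ lam) (Λ : Finset (Lattice d)) :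
    Continuous (weight F G lam Λ) := by
  simp_rw [funext (weight_eq_exp F G lam Λ)]
  exact Real.continuous_exp.comp (M.continuous_energy Λ).neg

lemma pairTerm_nonneg (M : Model F G ε r₀ lam) (Λ : Finset (Lattice d)) (x : Config d)
    (k j : Lattice d) : 0 ≤ pairTerm G Λ x k j := by
  unfold pairTerm
  split_ifs with h
  · exact M.nonneg _ (sub_ne_zero.2 h.1) _
  · exact le_rfl

lemma interaction_nonneg (M : Model F G ε r₀ lam) (Λ : Finset (Lattice d)) (x : Config d) :
    0 ≤ interaction G Λ x := by
  rw [M.interaction_eq Subset.rfl]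
  exact mul_nonneg (by norm_num) (sum_nonneg fun k _ => sum_nonneg fun j _ =>
    M.pairTerm_nonneg Λ x k j)

lemma convexOn_G (M : Model F G ε r₀ lam) {j : Lattice d} (hj : j ≠ 0) :
    ConvexOn ℝ Set.univ (G j) := by
  have h := M.condB.contDiff j hj
  refine convexOn_univ_of_deriv2_nonneg (h.differentiable (by norm_num)) ?_ ?_
  · exact ((contDiff_succ_iff_deriv (n := 1)).1 h).2.2.differentiable (by norm_num)
  · simpa using M.condB.convex j hj

/-- For `Λ ⊆ Λ'` the energies in `Λ` and `Λ'` differ by the energy of the pairs that meet `Λ'` but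
not `Λ`, so they differ by the same amount at any two configurations which agree off `Λ`. -/
lemma energy_sub_energy (M : Model F G ε r₀ lam) {Λ Λ' : Finset (Lattice d)} (h : Λ ⊆ Λ')
    {x y : Config d} (hxy : ∀ k ∉ Λ, x k = y k) :
    energy F G lam Λ' x - energy F G lam Λ x = energy F G lam Λ' y - energy F G lam Λ y := by
  have key : ∀ z : Config d, energy F G lam Λ' z - energy F G lam Λ z
      = lam * ((1 / 2 : ℝ) * ∑ k ∈ collar r₀ Λ' ∪ collar r₀ Λ, ∑ j ∈ collar r₀ Λ' ∪ collar r₀ Λ,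
        (pairTerm G Λ' z k j - pairTerm G Λ z k j)) + ∑ k ∈ Λ' \ Λ, F (z k) := by
    intro z
    rw [energy, energy, M.interaction_eq (subset_union_left (s₂ := collar r₀ Λ)),
      M.interaction_eq (subset_union_right (s₁ := collar r₀ Λ')), ← sum_sdiff h]
    simp only [sum_sub_distrib]
    ring
  rw [key, key]
  congr 1
  · congr 2
    refine sum_congr rfl fun k _ => sum_congr rfl fun j _ => ?_
    by_cases hk : k ∈ Λ
    · simp [pairTerm, hk, h hk]
    by_cases hj : j ∈ Λ
    · simp [pairTerm, hj, h hj]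
    simp [pairTerm, hk, hj, hxy k hk, hxy j hj]
  · exact sum_congr rfl fun k hk => by rw [hxy k (mem_sdiff.1 hk).2]

/-- The energy in `Λ` only depends on the coordinates within the interaction range of `Λ`. -/
lemma dependsOn_energy (M : Model F G ε r₀ lam) (Λ : Finset (Lattice d)) :
    DependsOn (energy F G lam Λ) (collar r₀ Λ : Set (Lattice d)) := by
  intro x y hxy
  rw [energy, energy, M.interaction_eq Subset.rfl, M.interaction_eq Subset.rfl]
  congr 1
  · congr 2
    refine sum_congr rfl fun k hk => sum_congr rfl fun j hj => ?_
    rw [pairTerm, pairTerm, hxy k hk, hxy j hj]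
  · exact sum_congr rfl fun k hk => by rw [hxy k (subset_collar r₀ Λ hk)]

/-- Translation covariance of the energy. -/
lemma energy_translate (M : Model F G ε r₀ lam) (Λ : Finset (Lattice d)) (a : Lattice d)
    (x : Config d) :
    energy F G lam (Λ.image (· + a)) x = energy F G lam Λ (fun k => x (k + a)) := by
  classical
  have hinj : Injective (fun k : Lattice d => k + a) := add_left_injective a
  set B := collar r₀ Λ ∪ (collar r₀ (Λ.image (· + a))).image (· - a)
  have h1 : collar r₀ (Λ.image (· + a)) ⊆ B.image (· + a) := by
    intro k hk
    refine mem_image.2 ⟨k - a, mem_union_right _ (mem_image_of_mem _ hk), by simp⟩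
  rw [energy, energy, M.interaction_eq h1, M.interaction_eq (subset_union_left : _ ⊆ B)]
  rw [sum_image hinj.injOn, sum_image hinj.injOn]
  simp_rw [sum_image hinj.injOn]
  congr 3
  refine sum_congr rfl fun k _ => sum_congr rfl fun j _ => ?_
  simp [pairTerm]

end Model

end LatticeGibbs

/-! ### Uniformly convex potentials and finite volume measures -/

namespace LatticeGibbs

open Function

/-- A uniformly convex potential on the line: twice continuously differentiable, with second
derivative at least `ε > 0`. -/
structure UniformlyConvex (V : ℝ → ℝ) (ε : ℝ) : Prop where
  contDiff : ContDiff ℝ 2 V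
  eps_pos : 0 < ε
  convex : ∀ x, ε ≤ deriv (deriv V) x

lemma ConditionA.uniformlyConvex {F : ℝ → ℝ} {ε : ℝ} (h : ConditionA F ε) :
    UniformlyConvex F ε := ⟨h.contDiff, h.eps_pos, h.convex⟩

lemma differentiable_of_contDiff_two {V : ℝ → ℝ} (h : ContDiff ℝ 2 V) : Differentiable ℝ V :=
  h.differentiable (by norm_num)

lemma contDiff_one_deriv {V : ℝ → ℝ} (h : ContDiff ℝ 2 V) : ContDiff ℝ 1 (deriv V) :=
  ((contDiff_succ_iff_deriv (n := 1)).1 h).2.2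

lemma differentiable_deriv {V : ℝ → ℝ} (h : ContDiff ℝ 2 V) : Differentiable ℝ (deriv V) :=
  (contDiff_one_deriv h).differentiable (by norm_num)

lemma continuous_deriv_deriv {V : ℝ → ℝ} (h : ContDiff ℝ 2 V) : Continuous (deriv (deriv V)) :=
  (contDiff_one_deriv h).continuous_deriv (by norm_num)

namespace UniformlyConvex

variable {V : ℝ → ℝ} {ε : ℝ}

lemma mul_sub_le_deriv_sub (h : UniformlyConvex V ε) {x y : ℝ} (hxy : x ≤ y) :
    ε * (y - x) ≤ deriv V y - deriv V x :=
  mul_sub_le_image_sub_of_le_deriv (differentiable_deriv h.contDiff) h.convex hxy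

lemma exists_deriv_eq_zero (h : UniformlyConvex V ε) : ∃ m, deriv V m = 0 := by
  have hε := h.eps_pos
  set r := |deriv V 0| / ε
  have hr : 0 ≤ r := by positivity
  have hr' : ε * r = |deriv V 0| := by simp only [r]; field_simp
  have h1 := h.mul_sub_le_deriv_sub hr
  have h2 := h.mul_sub_le_deriv_sub (neg_nonpos.2 hr)
  have h3 := neg_abs_le (deriv V 0)
  have h4 := le_abs_self (deriv V 0)
  exact mem_range_of_exists_le_of_exists_ge (contDiff_one_deriv h.contDiff).continuous
    ⟨-r, by linarith⟩ ⟨r, by linarith⟩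

/-- A uniformly convex function lies above the parabola `ε / 2 * (x - m) ^ 2` at its critical
point `m`. -/
lemma parabola_le (h : UniformlyConvex V ε) {m : ℝ} (hm : deriv V m = 0) (x : ℝ) :
    V m + ε / 2 * (x - m) ^ 2 ≤ V x := by
  set W : ℝ → ℝ := fun x => V x - ε / 2 * (x - m) ^ 2
  have hW : ∀ x, HasDerivAt W (deriv V x - ε * (x - m)) x := by
    intro x
    have h1 := (differentiable_of_contDiff_two h.contDiff x).hasDerivAt
    have h2 := ((((hasDerivAt_id x).sub_const m).pow 2).const_mul (ε / 2))
    convert! h1.sub h2 using 1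
    simp; ring
  have hdW : Differentiable ℝ W := fun x => (hW x).differentiableAt
  suffices W m ≤ W x by simp only [W] at this; simp at this; linarith
  rcases le_total m x with hx | hx
  · refine monotoneOn_of_deriv_nonneg (convex_Ici m) hdW.continuous.continuousOn
      hdW.differentiableOn (fun z hz => ?_) Set.self_mem_Ici hx hx
    rw [(hW z).deriv]
    have := h.mul_sub_le_deriv_sub (show m ≤ z from interior_subset (s := Set.Ici m) hz)
    linarith
  · refine antitoneOn_of_deriv_nonpos (convex_Iic m) hdW.continuous.continuousOn
      hdW.differentiableOn (fun z hz => ?_) hx Set.self_mem_Iic hx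
    rw [(hW z).deriv]
    have := h.mul_sub_le_deriv_sub (show z ≤ m from interior_subset (s := Set.Iic m) hz)
    linarith

lemma convexOn (h : UniformlyConvex V ε) : ConvexOn ℝ Set.univ V := by
  refine convexOn_univ_of_deriv2_nonneg (differentiable_of_contDiff_two h.contDiff)
    (differentiable_deriv h.contDiff) fun x => ?_
  simpa using h.eps_pos.le.trans (h.convex x)

lemma integrable_exp_neg (h : UniformlyConvex V ε) : Integrable fun x => Real.exp (-V x) := by
  obtain ⟨m, hm⟩ := h.exists_deriv_eq_zero
  have h1 : Integrable fun x : ℝ => Real.exp (-V m) * Real.exp (-(ε / 2) * (x - m) ^ 2) :=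
    ((integrable_exp_neg_mul_sq (half_pos h.eps_pos)).comp_sub_right m).const_mul _
  refine h1.mono' (by
    have := h.contDiff.continuous
    exact (Real.continuous_exp.comp this.neg).aestronglyMeasurable) (Filter.Eventually.of_forall
    fun x => ?_)
  rw [Real.norm_of_nonneg (Real.exp_pos _).le, ← Real.exp_add]
  refine Real.exp_le_exp.2 ?_
  have := h.parabola_le hm x
  linarith

end UniformlyConvex

variable {d : ℕ}

lemma continuous_glue (Λ : Finset (Lattice d)) :
    Continuous fun p : Config d × (Λ → ℝ) => glue Λ p.1 p.2 := by
  refine continuous_pi fun k => ?_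
  unfold glue
  split_ifs with h <;> fun_prop

lemma glue_of_mem {Λ : Finset (Lattice d)} (y : Config d) (x : Λ → ℝ) {k : Lattice d}
    (h : k ∈ Λ) : glue Λ y x k = x ⟨k, h⟩ := by simp [glue, h]

lemma glue_of_notMem {Λ : Finset (Lattice d)} (y : Config d) (x : Λ → ℝ) {k : Lattice d}
    (h : k ∉ Λ) : glue Λ y x k = y k := by simp [glue, h]

lemma measurable_glue (Λ : Finset (Lattice d)) (y : Config d) : Measurable (glue Λ y) :=
  ((continuous_glue Λ).comp (Continuous.prodMk_right y)).measurable

namespace Model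

variable {F : ℝ → ℝ} {G : Lattice d → ℝ → ℝ} {ε r₀ lam : ℝ}

lemma weight_pos (F : ℝ → ℝ) (G : Lattice d → ℝ → ℝ) (lam : ℝ) (Λ : Finset (Lattice d))
    (x : Config d) : 0 < weight F G lam Λ x := by
  rw [weight_eq_exp]; exact Real.exp_pos _

lemma weight_glue_le (M : Model F G ε r₀ lam) (Λ : Finset (Lattice d)) (y : Config d)
    (x : Λ → ℝ) : weight F G lam Λ (glue Λ y x) ≤ ∏ k : Λ, Real.exp (-F (x k)) := by
  have h1 : ∏ k ∈ Λ, Real.exp (-F (glue Λ y x k)) = ∏ k : Λ, Real.exp (-F (x k)) := by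
    rw [← Finset.prod_coe_sort]
    exact Finset.prod_congr rfl fun k _ => by rw [glue_of_mem _ _ k.2]
  rw [weight, h1]
  refine mul_le_of_le_one_left (Finset.prod_nonneg fun _ _ => (Real.exp_pos _).le) ?_
  rw [Real.exp_le_one_iff]
  have := mul_nonneg M.lam_nonneg (M.interaction_nonneg Λ (glue Λ y x))
  linarith

lemma integrable_prod_exp (M : Model F G ε r₀ lam) (Λ : Finset (Lattice d)) :
    Integrable fun x : Λ → ℝ => ∏ k : Λ, Real.exp (-F (x k)) :=
  Integrable.fintype_prod fun _ => M.condA.uniformlyConvex.integrable_exp_neg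

lemma continuous_weight_glue (M : Model F G ε r₀ lam) (Λ : Finset (Lattice d)) :
    Continuous fun p : Config d × (Λ → ℝ) => weight F G lam Λ (glue Λ p.1 p.2) :=
  (M.continuous_weight Λ).comp (continuous_glue Λ)

lemma integrable_weight (M : Model F G ε r₀ lam) (Λ : Finset (Lattice d)) (y : Config d) :
    Integrable fun x : Λ → ℝ => weight F G lam Λ (glue Λ y x) := by
  refine (M.integrable_prod_exp Λ).mono'
    ((M.continuous_weight_glue Λ).comp (Continuous.prodMk_right y)).aestronglyMeasurable
    (Filter.Eventually.of_forall fun x => ?_)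
  rw [Real.norm_of_nonneg (weight_pos ..).le]
  exact M.weight_glue_le Λ y x

lemma partitionFn_pos (M : Model F G ε r₀ lam) (Λ : Finset (Lattice d)) (y : Config d) :
    0 < partitionFn F G lam Λ y := by
  rw [partitionFn, integral_pos_iff_support_of_nonneg (fun x => (weight_pos ..).le)
    (M.integrable_weight Λ y)]
  have : support (fun x : Λ → ℝ => weight F G lam Λ (glue Λ y x)) = Set.univ :=
    Set.eq_univ_of_forall fun x => (weight_pos ..).ne'
  rw [this]
  exact Measure.measure_univ_pos.2 (NeZero.ne _)

/-- The density of the finite volume measure as an extended nonnegative function on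
configurations. -/
noncomputable def density (F : ℝ → ℝ) (G : Lattice d → ℝ → ℝ) (lam : ℝ)
    (Λ : Finset (Lattice d)) (x : Config d) : ℝ≥0∞ := ENNReal.ofReal (weight F G lam Λ x)

lemma measurable_density (M : Model F G ε r₀ lam) (Λ : Finset (Lattice d)) :
    Measurable (density F G lam Λ) := (M.continuous_weight Λ).measurable.ennreal_ofReal

lemma lmarginal_density (M : Model F G ε r₀ lam) (Λ : Finset (Lattice d)) (y : Config d) :
    lmarginal (fun _ => volume) Λ (density F G lam Λ) y
      = ENNReal.ofReal (partitionFn F G lam Λ y) := by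
  rw [partitionFn, ofReal_integral_eq_lintegral_ofReal (M.integrable_weight Λ y)
    (Filter.Eventually.of_forall fun x => (weight_pos ..).le)]
  rfl

/-- The finite volume Gibbs measure in `Λ` with boundary condition `y`, as a measure on the whole
configuration space. -/
noncomputable def finiteVolume (F : ℝ → ℝ) (G : Lattice d → ℝ → ℝ) (lam : ℝ)
    (Λ : Finset (Lattice d)) (y : Config d) : Measure (Config d) :=
  ((ENNReal.ofReal (partitionFn F G lam Λ y))⁻¹ •
    (volume : Measure (Λ → ℝ)).withDensity fun x => density F G lam Λ (glue Λ y x)).map (glue Λ y)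

lemma lintegral_finiteVolume (M : Model F G ε r₀ lam) (Λ : Finset (Lattice d)) (y : Config d)
    {f : Config d → ℝ≥0∞} (hf : Measurable f) :
    ∫⁻ x, f x ∂finiteVolume F G lam Λ y = (ENNReal.ofReal (partitionFn F G lam Λ y))⁻¹ *
      lmarginal (fun _ => volume) Λ (fun x => f x * density F G lam Λ x) y := by
  have hg := measurable_glue Λ y
  rw [finiteVolume, lintegral_map hf hg, lintegral_smul_measure,
    lintegral_withDensity_eq_lintegral_mul (f := fun x => density F G lam Λ (glue Λ y x)) _
      ((M.measurable_density Λ).comp hg) (g := fun x => f (glue Λ y x)) (hf.comp hg)]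
  simp only [smul_eq_mul, Pi.mul_apply, lmarginal]
  congr 2
  exact funext fun x => mul_comm _ _

lemma isProbabilityMeasure_finiteVolume (M : Model F G ε r₀ lam) (Λ : Finset (Lattice d))
    (y : Config d) : IsProbabilityMeasure (finiteVolume F G lam Λ y) := by
  constructor
  rw [← lintegral_one, M.lintegral_finiteVolume Λ y measurable_const]
  simp only [one_mul]
  rw [M.lmarginal_density]
  exact ENNReal.inv_mul_cancel (by simpa using M.partitionFn_pos Λ y) ENNReal.ofReal_ne_top

lemma condMean_eq_integral (M : Model F G ε r₀ lam) (Λ : Finset (Lattice d)) (y : Config d)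
    {f : Config d → ℝ} (hf : Measurable f) :
    condMean F G lam Λ f y = ∫ x, f x ∂finiteVolume F G lam Λ y := by
  have hg := measurable_glue Λ y
  rw [finiteVolume, integral_map hg.aemeasurable hf.aestronglyMeasurable, integral_smul_measure,
    integral_withDensity_eq_integral_toReal_smul
      (f := fun x => density F G lam Λ (glue Λ y x)) ((M.measurable_density Λ).comp hg)
      (Filter.Eventually.of_forall fun x => ENNReal.ofReal_lt_top), condMean]
  simp only [ENNReal.toReal_inv, ENNReal.toReal_ofReal (M.partitionFn_pos Λ y).le, smul_eq_mul,
    density, ENNReal.toReal_ofReal (weight_pos ..).le]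
  congr 2
  exact funext fun x => mul_comm _ _

lemma continuous_condMean (M : Model F G ε r₀ lam) (Λ : Finset (Lattice d))
    {f : Config d → ℝ} (hf : Continuous f) {C : ℝ} (hC : ∀ x, |f x| ≤ C) :
    Continuous (condMean F G lam Λ f) := by
  have key : ∀ g : Config d → ℝ, Continuous g → ∀ C : ℝ, (∀ x, |g x| ≤ C) →
      Continuous fun y => ∫ x : Λ → ℝ, g (glue Λ y x) * weight F G lam Λ (glue Λ y x) := by
    intro g hg C hC
    refine continuous_of_dominated (bound := fun x => C * ∏ k : Λ, Real.exp (-F (x k)))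
      (fun y => ?_) (fun y => ?_) ((M.integrable_prod_exp Λ).const_mul C) ?_
    · exact (((hg.comp (continuous_glue Λ)).mul (M.continuous_weight_glue Λ)).comp
        (Continuous.prodMk_right y)).aestronglyMeasurable
    · refine Filter.Eventually.of_forall fun x => ?_
      rw [norm_mul, Real.norm_of_nonneg (weight_pos ..).le]
      exact mul_le_mul (hC _) (M.weight_glue_le Λ y x) (weight_pos ..).le
        ((abs_nonneg _).trans (hC y))
    · exact Filter.Eventually.of_forall fun x =>
        ((hg.comp (continuous_glue Λ)).mul (M.continuous_weight_glue Λ)).comp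
          (Continuous.prodMk_left x)
  refine Continuous.mul ?_ (key f hf C hC)
  refine Continuous.inv₀ ?_ fun y => (M.partitionFn_pos Λ y).ne'
  simpa [partitionFn] using! key (fun _ => 1) continuous_const 1 (by simp)

lemma abs_integral_le_of_bounded {Ω : Type*} [MeasurableSpace Ω] (μ : Measure Ω)
    [IsProbabilityMeasure μ] {f : Ω → ℝ} {C : ℝ} (hC : ∀ x, |f x| ≤ C) : |∫ x, f x ∂μ| ≤ C := by
  simpa using norm_integral_le_of_norm_le_const (μ := μ) (f := f)
    (Filter.Eventually.of_forall hC)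

lemma abs_condMean_le (M : Model F G ε r₀ lam) (Λ : Finset (Lattice d))
    {f : Config d → ℝ} (hf : Continuous f) {C : ℝ} (hC : ∀ x, |f x| ≤ C) (y : Config d) :
    |condMean F G lam Λ f y| ≤ C := by
  have := M.isProbabilityMeasure_finiteVolume Λ y
  rw [M.condMean_eq_integral Λ y hf.measurable]
  exact abs_integral_le_of_bounded _ hC

/-- Consistency of the specification, for nonnegative functions: the densities in `Λ ⊆ Λ'` differ
by a factor that does not involve the spins in `Λ`. -/
lemma lintegral_lintegral_finiteVolume (M : Model F G ε r₀ lam) {Λ Λ' : Finset (Lattice d)}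
    (h : Λ ⊆ Λ') (y : Config d) {f : Config d → ℝ≥0∞} (hf : Measurable f) :
    ∫⁻ z, ∫⁻ x, f x ∂finiteVolume F G lam Λ z ∂finiteVolume F G lam Λ' y
      = ∫⁻ x, f x ∂finiteVolume F G lam Λ' y := by
  set w := density F G lam Λ
  set w' := density F G lam Λ'
  have hw : Measurable w := M.measurable_density Λ
  have hw' : Measurable w' := M.measurable_density Λ'
  set R : Config d → ℝ≥0∞ := fun z =>
    ENNReal.ofReal (Real.exp (-(energy F G lam Λ' z - energy F G lam Λ z)))
  have hR : ∀ z (x : Λ → ℝ), w' (updateFinset z Λ x) = w (updateFinset z Λ x) * R z := by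
    intro z x
    simp only [w, w', density, R]
    rw [weight_eq_exp, weight_eq_exp, ← ENNReal.ofReal_mul (Real.exp_pos _).le, ← Real.exp_add,
      ← M.energy_sub_energy h (x := updateFinset z Λ x) (y := z)]
    · ring_nf
    · intro k hk
      simp [updateFinset, hk]
  have hmul : ∀ (g : Config d → ℝ≥0∞), Measurable g → ∀ z,
      lmarginal (fun _ => volume) Λ (fun x => g x * w' x) z
        = lmarginal (fun _ => volume) Λ (fun x => g x * w x) z * R z := by
    intro g hg z
    simp only [lmarginal, hR, ← mul_assoc]
    exact lintegral_mul_const _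
      (((hg.mul hw).comp (measurable_updateFinset (s := Λ) (x := z))))
  have hinner : (fun z => ∫⁻ x, f x ∂finiteVolume F G lam Λ z) = fun z =>
      (lmarginal (fun _ => volume) Λ w z)⁻¹ *
        lmarginal (fun _ => volume) Λ (fun x => f x * w x) z := by
    funext z
    rw [M.lintegral_finiteVolume Λ z hf, M.lmarginal_density]
  have hmeas : Measurable fun z => (lmarginal (fun _ => volume) Λ w z)⁻¹ *
        lmarginal (fun _ => volume) Λ (fun x => f x * w x) z :=
    (Measurable.lmarginal _ hw).inv.mul (Measurable.lmarginal _ (hf.mul hw))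
  rw [hinner, M.lintegral_finiteVolume Λ' y hmeas, M.lintegral_finiteVolume Λ' y hf]
  congr 1
  refine congrFun (lmarginal_eq_of_subset h (hmeas.mul hw') (hf.mul hw') (funext fun z => ?_)) y
  refine (hmul _ hmeas z).trans (Eq.trans ?_ (hmul f hf z).symm)
  congr 1
  have hZ0 : lmarginal (fun _ => volume) Λ w z ≠ 0 := by
    rw [M.lmarginal_density]; simpa using M.partitionFn_pos Λ z
  have hZt : lmarginal (fun _ => volume) Λ w z ≠ ⊤ := by
    rw [M.lmarginal_density]; exact ENNReal.ofReal_ne_top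
  have hconst : ∀ (g : Config d → ℝ≥0∞) (x : Λ → ℝ),
      lmarginal (fun _ => volume) Λ g (updateFinset z Λ x)
        = lmarginal (fun _ => volume) Λ g z :=
    fun g x => lmarginal_congr _ _ fun k hk => by simp [updateFinset, hk]
  conv_lhs => rw [lmarginal]
  simp only [hconst]
  rw [lintegral_const_mul (f := fun x => w (updateFinset z Λ x)) _
    (hw.comp (measurable_updateFinset (s := Λ) (x := z)))]
  change _ * lmarginal (fun _ => volume) Λ w z = _
  rw [mul_right_comm, ENNReal.inv_mul_cancel hZ0 hZt, one_mul]

/-- Adding the bound `C` makes a bounded function nonnegative, so that Lebesgue integrals can be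
used for it. -/
lemma ofReal_integral_add_const {Ω : Type*} [MeasurableSpace Ω] (μ : Measure Ω)
    [IsProbabilityMeasure μ] {g : Ω → ℝ} (hg : Measurable g) {C : ℝ} (hC : ∀ x, |g x| ≤ C) :
    ENNReal.ofReal (∫ x, g x ∂μ + C) = ∫⁻ x, ENNReal.ofReal (g x + C) ∂μ := by
  have hint : Integrable g μ :=
    Integrable.of_bound hg.aestronglyMeasurable C (Filter.Eventually.of_forall hC)
  have h : ∫ x, g x + C ∂μ = ∫ x, g x ∂μ + C := by
    rw [integral_add hint (integrable_const C)]; simp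
  rw [← h]
  refine ofReal_integral_eq_lintegral_ofReal (hint.add (integrable_const C))
    (Filter.Eventually.of_forall fun x => ?_)
  have := (abs_le.1 (hC x)).1
  simp only [Pi.zero_apply]; linarith

/-- Consistency of the specification: a finite volume measure satisfies the equilibrium equations
in smaller volumes. -/
lemma integral_condMean_finiteVolume (M : Model F G ε r₀ lam) {Λ Λ' : Finset (Lattice d)}
    (h : Λ ⊆ Λ') (y : Config d) {f : Config d → ℝ} (hf : Continuous f) {C : ℝ}
    (hC : ∀ x, |f x| ≤ C) :
    ∫ z, condMean F G lam Λ f z ∂finiteVolume F G lam Λ' y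
      = ∫ x, f x ∂finiteVolume F G lam Λ' y := by
  have inst := M.isProbabilityMeasure_finiteVolume (d := d)
  have hcm := M.continuous_condMean Λ hf hC
  have hcmC := M.abs_condMean_le Λ hf hC
  have h1 := M.lintegral_lintegral_finiteVolume h y
    (f := fun x => ENNReal.ofReal (f x + C)) (hf.measurable.add_const C).ennreal_ofReal
  simp_rw [← ofReal_integral_add_const _ hf.measurable hC,
    ← M.condMean_eq_integral Λ _ hf.measurable] at h1
  rw [← ofReal_integral_add_const _ hcm.measurable hcmC] at h1
  have a1 := abs_le.1 (abs_integral_le_of_bounded (finiteVolume F G lam Λ' y) hC)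
  have a2 := abs_le.1 (abs_integral_le_of_bounded (finiteVolume F G lam Λ' y) hcmC)
  rw [ENNReal.ofReal_eq_ofReal_iff (by linarith) (by linarith)] at h1
  linarith

end Model

end LatticeGibbs

/-! ### The virial inequality -/

namespace LatticeGibbs

open Function Filter Topology

/-- A derivative-form virial inequality. If `H` decreases along the segments towards `m` and `L` is
its radial derivative, then `∫ L exp (-H) ≤ n ∫ exp (-H)` in dimension `n`. It is the derivative at
`s = 1` of the scaling identity `∫ exp (-H (m + s (x - m))) dx = s⁻ⁿ ∫ exp (-H)`, in which
Fatou's lemma replaces an integration by parts and no growth condition on `L` is needed. -/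
lemma lintegral_radial_deriv_le {E : Type*} [NormedAddCommGroup E] [NormedSpace ℝ E]
    [FiniteDimensional ℝ E] [MeasurableSpace E] [BorelSpace E] (μ : Measure E)
    [μ.IsAddHaarMeasure] {H L : E → ℝ} (m : E) (hH : Measurable H)
    (hint : Integrable (fun x => Real.exp (-H x)) μ)
    (hmono : ∀ x, ∀ s ∈ Set.Ioo (0 : ℝ) 1, H (m + s • (x - m)) ≤ H x)
    (hder : ∀ x, HasDerivAt (fun s : ℝ => H (m + s • (x - m))) (L x) 1) :
    ∫⁻ x, ENNReal.ofReal (L x * Real.exp (-H x)) ∂μ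
      ≤ ENNReal.ofReal (Module.finrank ℝ E * ∫ x, Real.exp (-H x) ∂μ) := by
  set n := Module.finrank ℝ E
  set Z := ∫ x, Real.exp (-H x) ∂μ
  obtain ⟨s, -, hs1, hslim⟩ := exists_seq_strictMono_tendsto' (show (0 : ℝ) < 1 by norm_num)
  have hs0 : ∀ k, s k ≠ 0 := fun k => (hs1 k).1.ne'
  have hslim' : Tendsto s atTop (𝓝[≠] 1) := tendsto_nhdsWithin_iff.2
    ⟨hslim, Eventually.of_forall fun k => (hs1 k).2.ne⟩
  set D : ℕ → E → ℝ := fun k x => (H x - H (m + s k • (x - m))) / (1 - s k)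
  have hline : ∀ k, Measurable fun x : E => m + s k • (x - m) := fun k =>
    (by fun_prop : Continuous fun x : E => m + s k • (x - m)).measurable
  have hD : ∀ x, Tendsto (fun k => D k x) atTop (𝓝 (L x)) := by
    intro x
    refine ((hasDerivAt_iff_tendsto_slope.1 (hder x)).comp hslim').congr fun k => ?_
    simp only [comp, slope_def_field, D, one_smul, add_sub_cancel]
    rw [← neg_sub (H x), ← neg_sub 1 (s k), neg_div_neg_eq]
  -- the scaling identity
  have hintk : ∀ k, Integrable (fun x => Real.exp (-H (m + s k • (x - m)))) μ := fun k => by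
    have := (hint.comp_add_left m).comp_smul (hs0 k)
    exact this.comp_sub_right m
  have hscale : ∀ k, ∫ x, Real.exp (-H (m + s k • (x - m))) ∂μ = (s k ^ n)⁻¹ * Z := fun k => by
    rw [integral_sub_right_eq_self (fun x => Real.exp (-H (m + s k • x))) m,
      Measure.integral_comp_smul μ (fun x => Real.exp (-H (m + x))),
      integral_add_left_eq_self (fun x => Real.exp (-H x)) m, smul_eq_mul, abs_of_nonneg]
    exact inv_nonneg.2 (pow_nonneg (hs1 k).1.le _)
  have hbound : ∀ k, ∫⁻ x, ENNReal.ofReal (D k x * Real.exp (-H x)) ∂μ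
      ≤ ENNReal.ofReal (((s k ^ n)⁻¹ * Z - Z) / (1 - s k)) := by
    intro k
    have h1s : 0 < 1 - s k := by linarith [(hs1 k).2]
    rw [← hscale, ← integral_sub (hintk k) hint, ← integral_div,
      ofReal_integral_eq_lintegral_ofReal (by exact ((hintk k).sub hint).div_const _)]
    · refine lintegral_mono fun x => ENNReal.ofReal_le_ofReal ?_
      simp only [D]
      rw [div_mul_eq_mul_div]
      refine div_le_div_of_nonneg_right ?_ h1s.le
      -- `u exp (-H x) ≤ (exp u - 1) exp (-H x)` for the decrease `u` of `H` from `x` to the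
      -- scaled point
      have := Real.add_one_le_exp (H x - H (m + s k • (x - m)))
      have h2 : Real.exp (-H (m + s k • (x - m)))
          = Real.exp (H x - H (m + s k • (x - m))) * Real.exp (-H x) := by
        rw [← Real.exp_add]; ring_nf
      rw [h2]
      nlinarith [Real.exp_pos (-H x)]
    · refine Eventually.of_forall fun x => div_nonneg (sub_nonneg.2 (Real.exp_le_exp.2 ?_)) h1s.le
      exact neg_le_neg (hmono x _ (hs1 k))
  have hlim : Tendsto (fun k => ENNReal.ofReal (((s k ^ n)⁻¹ * Z - Z) / (1 - s k))) atTop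
      (𝓝 (ENNReal.ofReal (n * Z))) := by
    refine (ENNReal.continuous_ofReal.tendsto _).comp ?_
    have h1 : HasDerivAt (fun s : ℝ => (s ^ n)⁻¹ * Z) (-(n * Z)) 1 := by
      have := ((hasDerivAt_pow n (1 : ℝ)).inv (by simp)).mul_const Z
      convert! this using 1
      simp
    have h2 := ((hasDerivAt_iff_tendsto_slope.1 h1).comp hslim').neg
    rw [neg_neg] at h2
    refine h2.congr fun k => ?_
    simp only [comp, slope_def_field, one_pow, inv_one, one_mul]
    rw [← neg_sub 1 (s k), div_neg, neg_neg]
  calc ∫⁻ x, ENNReal.ofReal (L x * Real.exp (-H x)) ∂μ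
      = ∫⁻ x, liminf (fun k => ENNReal.ofReal (D k x * Real.exp (-H x))) atTop ∂μ := by
        refine lintegral_congr fun x => (Tendsto.liminf_eq ?_).symm
        exact (ENNReal.continuous_ofReal.tendsto _).comp ((hD x).mul_const _)
    _ ≤ liminf (fun k => ∫⁻ x, ENNReal.ofReal (D k x * Real.exp (-H x)) ∂μ) atTop := by
        refine lintegral_liminf_le fun k => ?_
        exact (((hH.sub (hH.comp (hline k))).div_const _).mul
          (Real.measurable_exp.comp hH.neg)).ennreal_ofReal
    _ ≤ liminf (fun k => ENNReal.ofReal (((s k ^ n)⁻¹ * Z - Z) / (1 - s k))) atTop :=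
        liminf_le_liminf (Eventually.of_forall hbound)
    _ = ENNReal.ofReal (n * Z) := hlim.liminf_eq

/-- The arclength coordinate `∫_0^x √F''` of the metric `ρ`. -/
noncomputable def psi (F : ℝ → ℝ) (x : ℝ) : ℝ := ∫ s in (0 : ℝ)..x, √(deriv (deriv F) s)

lemma rho_zero_right (F : ℝ → ℝ) (x : ℝ) : rho F x 0 = -psi F x := by
  rw [rho, psi, intervalIntegral.integral_symm]

section psi

variable {F V : ℝ → ℝ} {ε : ℝ}

lemma continuous_sqrt_deriv2 (hF : ContDiff ℝ 2 F) :
    Continuous fun s => √(deriv (deriv F) s) := (continuous_deriv_deriv hF).sqrt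

lemma psi_sub (hF : ContDiff ℝ 2 F) (x y : ℝ) :
    psi F x - psi F y = ∫ s in y..x, √(deriv (deriv F) s) := by
  have h : ∀ a b, IntervalIntegrable (fun s => √(deriv (deriv F) s)) volume a b := fun a b =>
    (continuous_sqrt_deriv2 hF).intervalIntegrable a b
  exact intervalIntegral.integral_interval_sub_left (h _ _) (h _ _)

lemma continuous_psi (hF : ContDiff ℝ 2 F) : Continuous (psi F) :=
  intervalIntegral.continuous_primitive
    (fun _ _ => (continuous_sqrt_deriv2 hF).intervalIntegrable (μ := volume) _ _) 0

lemma sqrt_mul_abs_sub_le (hF : UniformlyConvex F ε) (x y : ℝ) :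
    √ε * |x - y| ≤ |psi F x - psi F y| := by
  wlog hxy : y ≤ x generalizing x y
  · rw [abs_sub_comm x, abs_sub_comm (psi F x)]
    exact this y x (le_of_not_ge hxy)
  have h := continuous_sqrt_deriv2 hF.contDiff
  rw [psi_sub hF.contDiff, abs_of_nonneg (sub_nonneg.2 hxy), abs_of_nonneg
    (intervalIntegral.integral_nonneg hxy fun s _ => Real.sqrt_nonneg _)]
  have := intervalIntegral.integral_mono_on (μ := volume) hxy
    (continuous_const.intervalIntegrable y x) (h.intervalIntegrable y x)
    fun s _ => Real.sqrt_le_sqrt (hF.convex s)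
  simpa [mul_comm] using this

/-- The Cauchy–Schwarz inequality behind the metric `ρ`: its square is dominated by the increments
of the gradient of any potential at least as convex as `F`. -/
lemma psi_sub_sq_le (hF : UniformlyConvex F ε) (hV : ContDiff ℝ 2 V)
    (hFV : ∀ x, deriv (deriv F) x ≤ deriv (deriv V) x) (x y : ℝ) :
    (psi F x - psi F y) ^ 2 ≤ (x - y) * (deriv V x - deriv V y) := by
  wlog hxy : y ≤ x generalizing x y
  · have := this y x (le_of_not_ge hxy)
    nlinarith
  rcases hxy.eq_or_lt with rfl | hlt
  · simp
  have h := continuous_sqrt_deriv2 hF.contDiff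
  have hV2 := continuous_deriv_deriv hV
  set I := psi F x - psi F y
  have hI : I = ∫ s in y..x, √(deriv (deriv F) s) := psi_sub hF.contDiff x y
  have hA : ∫ s in y..x, deriv (deriv V) s = deriv V x - deriv V y :=
    intervalIntegral.integral_deriv_eq_sub (fun s _ => differentiable_deriv hV s)
      (hV2.intervalIntegrable _ _)
  -- integrate `(√F'' - t) ^ 2 ≥ 0` with `t` the mean of `√F''`
  set t := I / (x - y)
  have hle : ∫ s in y..x, (2 * t * √(deriv (deriv F) s) - t ^ 2)
      ≤ ∫ s in y..x, deriv (deriv V) s := by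
    refine intervalIntegral.integral_mono_on hxy ?_ (hV2.intervalIntegrable _ _) fun s _ => ?_
    · exact (Continuous.intervalIntegrable (by fun_prop) _ _)
    · have h1 := Real.sq_sqrt (hF.eps_pos.le.trans (hF.convex s))
      have h2 := hFV s
      nlinarith [sq_nonneg (√(deriv (deriv F) s) - t)]
  rw [hA, intervalIntegral.integral_sub (Continuous.intervalIntegrable (by fun_prop) _ _)
    (continuous_const.intervalIntegrable _ _), intervalIntegral.integral_const_mul, ← hI,
    intervalIntegral.integral_const, smul_eq_mul] at hle
  have hpos : 0 < x - y := sub_pos.2 hlt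
  have ht : I = t * (x - y) := by simp only [t]; field_simp
  have : I ^ 2 = (x - y) * (2 * t * I - (x - y) * t ^ 2) := by rw [ht]; ring
  rw [this]
  exact mul_le_mul_of_nonneg_left hle hpos.le

/-- In the metric `ρ`, the second moment of a one-dimensional Gibbs measure about the minimum of
its potential is at most `1`. -/
lemma lintegral_psi_sub_sq_le (hF : UniformlyConvex F ε) (hV : UniformlyConvex V ε)
    (hFV : ∀ x, deriv (deriv F) x ≤ deriv (deriv V) x) {m : ℝ} (hm : deriv V m = 0) :
    ∫⁻ x, ENNReal.ofReal ((psi F x - psi F m) ^ 2 * Real.exp (-V x))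
      ≤ ENNReal.ofReal (∫ x, Real.exp (-V x)) := by
  have hd := differentiable_of_contDiff_two hV.contDiff
  have key := lintegral_radial_deriv_le (volume : Measure ℝ) (H := V)
    (L := fun x => deriv V x * (x - m)) m hV.contDiff.continuous.measurable
    hV.integrable_exp_neg (fun x s hs => ?_) (fun x => ?_)
  · simp only [Module.finrank_self, Nat.cast_one, one_mul] at key
    refine (lintegral_mono fun x => ENNReal.ofReal_le_ofReal ?_).trans key
    refine mul_le_mul_of_nonneg_right ?_ (Real.exp_pos _).le
    have := psi_sub_sq_le hF hV.contDiff hFV x m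
    rw [hm] at this
    linarith
  · have h1 := hV.convexOn.2 (Set.mem_univ m) (Set.mem_univ x) (sub_nonneg.2 hs.2.le) hs.1.le
      (by ring)
    have h2 := hV.parabola_le hm x
    have h3 : 0 ≤ ε / 2 * (x - m) ^ 2 := mul_nonneg (half_pos hV.eps_pos).le (sq_nonneg _)
    have h4 : (1 - s) • m + s • x = m + s • (x - m) := by simp only [smul_eq_mul]; ring
    rw [h4] at h1
    simp only [smul_eq_mul] at h1 ⊢
    nlinarith [hs.2]
  · have h1 : HasDerivAt (fun s : ℝ => m + s • (x - m)) (x - m) 1 := by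
      simpa using ((hasDerivAt_id (1 : ℝ)).smul_const (x - m)).const_add m
    have h2 : HasDerivAt V (deriv V x) (m + (1 : ℝ) • (x - m)) := by
      simpa using (hd x).hasDerivAt
    exact h2.comp 1 h1

end psi

lemma ConvexOn.le_mul_deriv {g : ℝ → ℝ} (hg : ConvexOn ℝ Set.univ g) (hd : Differentiable ℝ g)
    (h0 : g 0 = 0) (u : ℝ) : g u ≤ u * deriv g u := by
  rcases lt_trichotomy u 0 with h | h | h
  · have := hg.deriv_le_slope (Set.mem_univ u) (Set.mem_univ 0) h (hd u)
    rw [slope_def_field, h0, le_div_iff₀ (by linarith)] at this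
    linarith
  · simp [h, h0]
  · have := hg.slope_le_deriv (Set.mem_univ 0) (Set.mem_univ u) h (hd u)
    rw [slope_def_field, h0, div_le_iff₀ (by linarith)] at this
    linarith

namespace Model

variable {d : ℕ} {F : ℝ → ℝ} {G : Lattice d → ℝ → ℝ} {ε r₀ lam : ℝ}

/-- With the minimizer `p` of `F` as boundary condition, the second moments about `p` in the metric
`ρ` add up to at most the number of sites: the constant configuration `p` minimizes the energy, and
the pair interactions only increase its radial derivative. -/
lemma lintegral_sum_psi_sub_sq_le (M : Model F G ε r₀ lam) {p : ℝ} (hp : deriv F p = 0)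
    (Λ : Finset (Lattice d)) :
    ∫⁻ x, ∑ k ∈ Λ, ENNReal.ofReal ((psi F (x k) - psi F p) ^ 2)
      ∂finiteVolume F G lam Λ (fun _ => p) ≤ Λ.card := by
  classical
  have hF := M.condA.uniformlyConvex
  have hψ := continuous_psi hF.contDiff
  have hdF := differentiable_of_contDiff_two hF.contDiff
  set y : Config d := fun _ => p
  set H : (Λ → ℝ) → ℝ := fun x => energy F G lam Λ (glue Λ y x)
  set m : Λ → ℝ := fun _ => p
  set B := collar r₀ Λ
  have hglue : ∀ (x : Λ → ℝ) (s : ℝ) k, glue Λ y (m + s • (x - m)) k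
      = p + s * (glue Λ y x k - p) := by
    intro x s k
    by_cases hk : k ∈ Λ
    · simp [glue_of_mem _ _ hk, m]
    · simp [glue_of_notMem _ _ hk, y]
  have hdiff : ∀ (x : Λ → ℝ) (s : ℝ) k j, glue Λ y (m + s • (x - m)) k
      - glue Λ y (m + s • (x - m)) j = s * (glue Λ y x k - glue Λ y x j) := by
    intro x s k j; rw [hglue, hglue]; ring
  -- `L` is the radial derivative of the energy at `x`, and `P` collects its pair terms
  set P : (Λ → ℝ) → Lattice d → Lattice d → ℝ := fun x k j =>
    if k ≠ j ∧ (k ∈ Λ ∨ j ∈ Λ) then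
      deriv (G (k - j)) (glue Λ y x k - glue Λ y x j) * (glue Λ y x k - glue Λ y x j) else 0
  set L : (Λ → ℝ) → ℝ := fun x => lam * ((1 / 2 : ℝ) * ∑ k ∈ B, ∑ j ∈ B, P x k j)
    + ∑ k ∈ Λ, deriv F (glue Λ y x k) * (glue Λ y x k - p)
  have hHcont : Continuous H := (M.continuous_energy Λ).comp
    ((continuous_glue Λ).comp (Continuous.prodMk_right y))
  have hHint : Integrable fun x => Real.exp (-H x) := by
    simpa only [weight_eq_exp] using M.integrable_weight Λ y
  have hmono : ∀ x, ∀ s ∈ Set.Ioo (0 : ℝ) 1, H (m + s • (x - m)) ≤ H x := by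
    intro x s hs
    simp only [H, energy]
    refine add_le_add (mul_le_mul_of_nonneg_left ?_ M.lam_nonneg)
      (Finset.sum_le_sum fun k _ => ?_)
    · rw [M.interaction_eq subset_rfl, M.interaction_eq subset_rfl]
      refine mul_le_mul_of_nonneg_left (Finset.sum_le_sum fun k _ =>
        Finset.sum_le_sum fun j _ => ?_) (by norm_num)
      unfold pairTerm
      split_ifs with h
      · have hkj := sub_ne_zero.2 h.1
        rw [hdiff]
        have h1 := (M.convexOn_G hkj).2 (Set.mem_univ 0)
          (Set.mem_univ (glue Λ y x k - glue Λ y x j)) (sub_nonneg.2 hs.2.le) hs.1.le (by ring)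
        simp only [smul_eq_mul, mul_zero, zero_add, M.condB.zero _ hkj] at h1
        nlinarith [M.nonneg _ hkj (glue Λ y x k - glue Λ y x j), hs.2]
      · exact le_rfl
    · rw [hglue]
      have h1 := hF.convexOn.2 (Set.mem_univ p) (Set.mem_univ (glue Λ y x k))
        (sub_nonneg.2 hs.2.le) hs.1.le (by ring)
      have h2 := hF.parabola_le hp (glue Λ y x k)
      have h3 : 0 ≤ ε / 2 * (glue Λ y x k - p) ^ 2 :=
        mul_nonneg (half_pos hF.eps_pos).le (sq_nonneg _)
      have h4 : (1 - s) • p + s • glue Λ y x k = p + s * (glue Λ y x k - p) := by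
        simp only [smul_eq_mul]; ring
      rw [h4] at h1
      simp only [smul_eq_mul] at h1
      nlinarith [hs.2]
  have hder : ∀ x, HasDerivAt (fun s : ℝ => H (m + s • (x - m))) (L x) 1 := by
    intro x
    simp only [H, energy, M.interaction_eq (subset_rfl : collar r₀ Λ ⊆ B)]
    refine HasDerivAt.add (HasDerivAt.const_mul _ (HasDerivAt.const_mul _ ?_)) ?_
    · refine HasDerivAt.fun_sum fun k _ => HasDerivAt.fun_sum fun j _ => ?_
      simp only [pairTerm, P]
      split_ifs with h
      · simp_rw [hdiff]
        have h1 : HasDerivAt (fun s : ℝ => s * (glue Λ y x k - glue Λ y x j))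
            (glue Λ y x k - glue Λ y x j) 1 := by
          simpa using (hasDerivAt_id (1 : ℝ)).mul_const (glue Λ y x k - glue Λ y x j)
        have h2 := (differentiable_of_contDiff_two (M.condB.contDiff _ (sub_ne_zero.2 h.1))
          (1 * (glue Λ y x k - glue Λ y x j))).hasDerivAt
        simpa only [one_mul] using! h2.comp 1 h1
      · exact hasDerivAt_const _ _
    · refine HasDerivAt.fun_sum fun k _ => ?_
      simp_rw [hglue]
      have h1 : HasDerivAt (fun s : ℝ => p + s * (glue Λ y x k - p)) (glue Λ y x k - p) 1 := by
        simpa using ((hasDerivAt_id (1 : ℝ)).mul_const (glue Λ y x k - p)).const_add p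
      have h2 := (hdF (p + 1 * (glue Λ y x k - p))).hasDerivAt
      simpa only [one_mul, add_sub_cancel] using! h2.comp 1 h1
  have key := lintegral_radial_deriv_le (volume : Measure (Λ → ℝ)) m hHcont.measurable hHint
    hmono hder
  have hL : ∀ x, ∑ k ∈ Λ, (psi F (glue Λ y x k) - psi F p) ^ 2 ≤ L x := by
    intro x
    have h1 : 0 ≤ lam * ((1 / 2 : ℝ) * ∑ k ∈ B, ∑ j ∈ B, P x k j) := by
      refine mul_nonneg M.lam_nonneg (mul_nonneg (by norm_num)
        (Finset.sum_nonneg fun k _ => Finset.sum_nonneg fun j _ => ?_))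
      simp only [P]
      split_ifs with h
      · have hkj := sub_ne_zero.2 h.1
        have h1 := ConvexOn.le_mul_deriv (M.convexOn_G hkj)
          (differentiable_of_contDiff_two (M.condB.contDiff _ hkj)) (M.condB.zero _ hkj)
          (glue Λ y x k - glue Λ y x j)
        have h2 := M.nonneg _ hkj (glue Λ y x k - glue Λ y x j)
        linarith
      · exact le_rfl
    have h2 : ∑ k ∈ Λ, (psi F (glue Λ y x k) - psi F p) ^ 2
        ≤ ∑ k ∈ Λ, deriv F (glue Λ y x k) * (glue Λ y x k - p) := by
      refine Finset.sum_le_sum fun k _ => ?_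
      have := psi_sub_sq_le hF hF.contDiff (fun _ => le_rfl) (glue Λ y x k) p
      rw [hp] at this
      linarith
    simp only [L]
    linarith
  have hZ := M.partitionFn_pos Λ y
  have hmeas : Measurable fun x : Config d =>
      ∑ k ∈ Λ, ENNReal.ofReal ((psi F (x k) - psi F p) ^ 2) :=
    Finset.measurable_fun_sum _ fun k _ =>
      (((hψ.comp (continuous_apply k)).sub continuous_const).pow 2).measurable.ennreal_ofReal
  rw [M.lintegral_finiteVolume Λ y hmeas]
  have hZeq : ∫ x, Real.exp (-H x) = partitionFn F G lam Λ y := by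
    simp only [partitionFn, weight_eq_exp, H]
  rw [hZeq] at key
  calc _ ≤ (ENNReal.ofReal (partitionFn F G lam Λ y))⁻¹ *
        ENNReal.ofReal (Λ.card * partitionFn F G lam Λ y) := by
        refine mul_le_mul_right (le_trans (lintegral_mono fun x => ?_) (key.trans_eq ?_)) _
        · change (∑ k ∈ Λ, ENNReal.ofReal ((psi F (glue Λ y x k) - psi F p) ^ 2))
            * ENNReal.ofReal (weight F G lam Λ (glue Λ y x)) ≤ _
          rw [← ENNReal.ofReal_sum_of_nonneg (fun _ _ => sq_nonneg _),
            ← ENNReal.ofReal_mul (Finset.sum_nonneg fun _ _ => sq_nonneg _), weight_eq_exp]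
          exact ENNReal.ofReal_le_ofReal
            (mul_le_mul_of_nonneg_right (hL x) (Real.exp_pos _).le)
        · simp
    _ = Λ.card := by
        rw [ENNReal.ofReal_mul (Nat.cast_nonneg _), mul_left_comm, ENNReal.inv_mul_cancel
          (by simpa using hZ) ENNReal.ofReal_ne_top, mul_one, ENNReal.ofReal_natCast]

end Model

end LatticeGibbs

/-! ### Existence of Gibbs measures -/

namespace LatticeGibbs

open Function Filter Topology

variable {d : ℕ}

/-- The cube of side `2 n + 1` centred at the origin. -/
noncomputable def box (d n : ℕ) : Finset (Lattice d) :=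
  Fintype.piFinset fun _ => Finset.Icc (-n : ℤ) n

lemma mem_box {n : ℕ} {k : Lattice d} : k ∈ box d n ↔ ∀ i, |k i| ≤ n := by
  simp [box, abs_le]

lemma card_box (d n : ℕ) : (box d n).card = (2 * n + 1) ^ d := by
  rw [box, Fintype.card_piFinset_const, Int.card_Icc]
  congr 1; omega

lemma card_box_pos (d n : ℕ) : 0 < (box d n).card := by rw [card_box]; positivity

lemma exists_subset_box (Λ : Finset (Lattice d)) : ∃ R : ℕ, Λ ⊆ box d R := by
  refine ⟨Λ.sup fun k => Finset.univ.sup fun i => (k i).natAbs, fun k hk => mem_box.2 fun i => ?_⟩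
  have h1 : (k i).natAbs ≤ Finset.univ.sup fun i => (k i).natAbs :=
    Finset.le_sup (f := fun i => (k i).natAbs) (Finset.mem_univ i)
  have h2 := h1.trans (Finset.le_sup (f := fun k : Lattice d =>
    Finset.univ.sup fun i => (k i).natAbs) hk)
  rw [Int.abs_eq_natAbs]
  exact_mod_cast h2

/-- The cubes form a Følner sequence: the proportion of translation vectors in the cube that move
`Λ` partly out of the cube tends to zero. -/
lemma tendsto_card_filter_box (Λ : Finset (Lattice d)) :
    Tendsto (fun n : ℕ => (((box d n).filter fun a => ¬ Λ.image (· + a) ⊆ box d n).card : ℝ)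
      / (box d n).card) atTop (𝓝 0) := by
  classical
  obtain ⟨R, hR⟩ := exists_subset_box Λ
  rw [← tendsto_add_atTop_iff_nat R]
  have hle : ∀ n : ℕ, ((((box d (n + R)).filter fun a =>
      ¬ Λ.image (· + a) ⊆ box d (n + R)).card : ℝ) / (box d (n + R)).card)
      ≤ 1 - ((2 * (n : ℝ) + 1) / (2 * (n + R : ℕ) + 1)) ^ d := by
    intro n
    have hsub : box d n ⊆ box d (n + R) := fun k hk => mem_box.2 fun i =>
      (mem_box.1 hk i).trans (by push_cast; omega)
    have h1 : ((box d (n + R)).filter fun a => ¬ Λ.image (· + a) ⊆ box d (n + R))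
        ⊆ box d (n + R) \ box d n := by
      intro a ha
      rw [Finset.mem_filter] at ha
      refine Finset.mem_sdiff.2 ⟨ha.1, fun han => ha.2 fun j hj => ?_⟩
      obtain ⟨k, hk, rfl⟩ := Finset.mem_image.1 hj
      refine mem_box.2 fun i => ?_
      have h1 := mem_box.1 (hR hk) i
      have h2 := mem_box.1 han i
      have h3 := abs_add_le (k i) (a i)
      push_cast
      simp only [Pi.add_apply]
      linarith
    have h2 := Finset.card_le_card h1
    have h3 := Finset.card_sdiff_add_card_eq_card hsub
    have h4 : ((box d (n + R)).card : ℝ) = (2 * (n + R : ℕ) + 1 : ℝ) ^ d := by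
      rw [card_box]; push_cast; ring
    have h5 : ((box d n).card : ℝ) = (2 * n + 1 : ℝ) ^ d := by
      rw [card_box]; push_cast; ring
    have h6 : (0 : ℝ) < (box d (n + R)).card := by exact_mod_cast card_box_pos d _
    rw [div_pow, ← h4, ← h5, div_le_iff₀ h6, sub_mul, div_mul_cancel₀ _ h6.ne', one_mul]
    have h7 : (((box d (n + R)).filter fun a => ¬ Λ.image (· + a) ⊆ box d (n + R)).card : ℝ)
        ≤ (box d (n + R) \ box d n).card := by exact_mod_cast h2
    have h8 : ((box d (n + R) \ box d n).card : ℝ) + (box d n).card = (box d (n + R)).card := by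
      exact_mod_cast h3
    linarith
  refine squeeze_zero (fun n => by positivity) hle ?_
  have h1 : Tendsto (fun n : ℕ => (2 * (n : ℝ) + 1) / (2 * (n + R : ℕ) + 1)) atTop (𝓝 1) := by
    have h2 : Tendsto (fun n : ℕ => 1 - (2 * R : ℝ) / (2 * (n + R : ℕ) + 1)) atTop
        (𝓝 (1 - 0)) := by
      refine tendsto_const_nhds.sub (Tendsto.div_atTop tendsto_const_nhds ?_)
      refine tendsto_atTop_add_const_right _ _ (Tendsto.const_mul_atTop (by norm_num) ?_)
      exact tendsto_natCast_atTop_atTop.comp (tendsto_add_atTop_nat R)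
    rw [sub_zero] at h2
    refine h2.congr fun n => ?_
    have : (2 * ((n + R : ℕ) : ℝ) + 1) ≠ 0 := by positivity
    rw [eq_div_iff this, sub_mul, div_mul_cancel₀ _ this]
    push_cast; ring
  simpa using (h1.pow d).const_sub 1

/-- The translation of configurations by `a`. -/
def translate (a : Lattice d) (x : Config d) : Config d := fun k => x (k + a)

lemma continuous_translate (a : Lattice d) : Continuous (translate a) :=
  continuous_pi fun k => continuous_apply (k + a)

namespace Model

variable {F : ℝ → ℝ} {G : Lattice d → ℝ → ℝ} {ε r₀ lam : ℝ}

/-- Off `Λ`, the finite volume measure is concentrated on the boundary condition. -/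
lemma ae_eq_of_notMem (Λ : Finset (Lattice d)) (y : Config d) {k : Lattice d} (hk : k ∉ Λ) :
    ∀ᵐ x ∂finiteVolume F G lam Λ y, x k = y k := by
  rw [finiteVolume, ae_map_iff (measurable_glue Λ y).aemeasurable
    (measurableSet_eq_fun (measurable_pi_apply k) measurable_const)]
  exact Eventually.of_forall fun x => glue_of_notMem y x hk

lemma map_translate_finiteVolume (M : Model F G ε r₀ lam) (Λ : Finset (Lattice d))
    (a : Lattice d) (y : Config d) :
    (finiteVolume F G lam (Λ.image (· + a)) y).map (translate a)
      = finiteVolume F G lam Λ (translate a y) := by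
  have hinj : Injective (fun k : Lattice d => k + a) := add_left_injective a
  have hτ := (continuous_translate a).measurable
  have hd : ∀ z, density F G lam (Λ.image (· + a)) z = density F G lam Λ (translate a z) := by
    intro z
    rw [density, density, weight_eq_exp, weight_eq_exp, M.energy_translate]
    rfl
  have key : ∀ g : Config d → ℝ≥0∞, Measurable g →
      lmarginal (fun _ => volume) (Λ.image (· + a))
        (fun z => g (translate a z) * density F G lam (Λ.image (· + a)) z) y
      = lmarginal (fun _ => volume) Λ (fun z => g z * density F G lam Λ z) (translate a y) := by
    intro g hg
    simp_rw [hd]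
    exact lmarginal_image (μ := fun _ : Lattice d => (volume : Measure ℝ)) hinj Λ
      (hg.mul (M.measurable_density Λ)) y
  have hZ : ENNReal.ofReal (partitionFn F G lam (Λ.image (· + a)) y)
      = ENNReal.ofReal (partitionFn F G lam Λ (translate a y)) := by
    rw [← M.lmarginal_density, ← M.lmarginal_density]
    simpa using! key (fun _ => 1) measurable_const
  refine Measure.ext_of_lintegral _ fun g hg => ?_
  rw [lintegral_map hg hτ,
    M.lintegral_finiteVolume _ _ (f := fun z => g (translate a z)) (hg.comp hτ),
    M.lintegral_finiteVolume _ _ hg, hZ]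
  exact congrArg _ (key g hg)

lemma condMean_translate (M : Model F G ε r₀ lam) (Λ : Finset (Lattice d)) (a : Lattice d)
    {f : Config d → ℝ} (hf : Continuous f) (y : Config d) :
    condMean F G lam Λ f (translate a y)
      = condMean F G lam (Λ.image (· + a)) (f ∘ translate a) y := by
  have hτ := (continuous_translate a)
  rw [M.condMean_eq_integral _ _ hf.measurable, M.condMean_eq_integral _ _ (hf.comp hτ).measurable,
    ← M.map_translate_finiteVolume, integral_map hτ.aemeasurable hf.aestronglyMeasurable]
  rfl

/-- The average of the translates of the finite volume measure in a cube with constant boundary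
condition `p`. -/
noncomputable def averaged (F : ℝ → ℝ) (G : Lattice d → ℝ → ℝ) (lam p : ℝ) (n : ℕ) :
    Measure (Config d) :=
  ((box d n).card : ℝ≥0∞)⁻¹ •
    ∑ a ∈ box d n, (finiteVolume F G lam (box d n) fun _ => p).map (translate a)

lemma lintegral_averaged (p : ℝ) (n : ℕ) {f : Config d → ℝ≥0∞} (hf : Measurable f) :
    ∫⁻ x, f x ∂averaged F G lam p n = ((box d n).card : ℝ≥0∞)⁻¹ * ∑ a ∈ box d n,
      ∫⁻ x, f (translate a x) ∂finiteVolume F G lam (box d n) fun _ => p := by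
  rw [averaged, lintegral_smul_measure, lintegral_finsetSum_measure, smul_eq_mul]
  congr 1
  exact Finset.sum_congr rfl fun a _ => lintegral_map hf (continuous_translate a).measurable

lemma inv_card_mul_card (d n : ℕ) :
    ((box d n).card : ℝ≥0∞)⁻¹ * (box d n).card = 1 :=
  ENNReal.inv_mul_cancel (by exact_mod_cast (card_box_pos d n).ne') (ENNReal.natCast_ne_top _)

/-- A moment bound valid for all finite volume measures is valid for the averages. -/
lemma lintegral_averaged_le (p : ℝ) (n : ℕ) {φ : ℝ → ℝ≥0∞}
    (hφ : Measurable φ) {C : ℝ≥0∞}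
    (hC : ∀ Λ k, ∫⁻ x, φ (x k) ∂finiteVolume F G lam Λ (fun _ => p) ≤ C) (k : Lattice d) :
    ∫⁻ x, φ (x k) ∂averaged F G lam p n ≤ C := by
  rw [lintegral_averaged p n (f := fun x => φ (x k)) (hφ.comp (measurable_pi_apply k))]
  calc _ ≤ ((box d n).card : ℝ≥0∞)⁻¹ * ∑ a ∈ box d n, C :=
        mul_le_mul_right (Finset.sum_le_sum fun a _ => hC _ (k + a)) _
    _ = C := by
        rw [Finset.sum_const, nsmul_eq_mul, ← mul_assoc, inv_card_mul_card, one_mul]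

lemma isProbabilityMeasure_averaged (M : Model F G ε r₀ lam) (p : ℝ) (n : ℕ) :
    IsProbabilityMeasure (averaged (d := d) F G lam p n) := by
  have := M.isProbabilityMeasure_finiteVolume (box d n) (fun _ => p)
  constructor
  rw [← lintegral_one, lintegral_averaged p n measurable_const]
  simp [inv_card_mul_card]

/-- In the averages all sites have second moment at most `1` in the metric `ρ`, because the second
moments of a finite volume measure add up to at most the volume. -/
lemma lintegral_psi_averaged_le (M : Model F G ε r₀ lam) {p : ℝ} (hp : deriv F p = 0) (n : ℕ)
    (k : Lattice d) :
    ∫⁻ x, ENNReal.ofReal ((psi F (x k) - psi F p) ^ 2) ∂averaged F G lam p n ≤ 1 := by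
  classical
  have hψ := continuous_psi M.condA.contDiff
  set h : ℝ → ℝ≥0∞ := fun u => ENNReal.ofReal ((psi F u - psi F p) ^ 2)
  have hh : Measurable h := ((hψ.sub continuous_const).pow 2).measurable.ennreal_ofReal
  have hhk : ∀ j : Lattice d, Measurable fun x : Config d => h (x j) := fun j =>
    hh.comp (measurable_pi_apply j)
  rw [lintegral_averaged p n (f := fun x => h (x k)) (hhk k)]
  rw [← inv_card_mul_card d n]
  refine mul_le_mul_right ?_ _
  rw [← lintegral_finsetSum (f := fun a x => h (translate a x k)) _ fun a _ =>
    (hhk k).comp (continuous_translate a).measurable]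
  refine le_trans (lintegral_mono_ae ?_) (M.lintegral_sum_psi_sub_sq_le hp (box d n))
  have hae : ∀ᵐ x ∂finiteVolume F G lam (box d n) (fun _ => p), ∀ j, j ∉ box d n → x j = p :=
    ae_all_iff.2 fun j => by
      by_cases hj : j ∈ box d n
      · simp [hj]
      · filter_upwards [ae_eq_of_notMem (F := F) (G := G) (lam := lam) (box d n) (fun _ => p) hj]
          with x hx _ using hx
  filter_upwards [hae] with x hx
  have h1 : ∑ a ∈ box d n, h (translate a x k) = ∑ j ∈ (box d n).image (k + ·), h (x j) := by
    rw [Finset.sum_image (add_right_injective k).injOn]; rfl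
  rw [h1]
  refine Finset.sum_le_sum_of_ne_zero fun j _ hj => ?_
  by_contra hjn
  exact hj (by simp [h, hx j hjn])

/-- The averages almost satisfy the equilibrium equations in a fixed volume: a translate of the
finite volume measure violates them only if the translated volume leaves the cube. -/
lemma tendsto_integral_condMean_sub (M : Model F G ε r₀ lam) (p : ℝ) (Λ : Finset (Lattice d))
    {f : Config d → ℝ} (hf : Continuous f) {C : ℝ} (hC : ∀ x, |f x| ≤ C) :
    Tendsto (fun n => ∫ x, (condMean F G lam Λ f x - f x) ∂averaged F G lam p n) atTop (𝓝 0) := by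
  classical
  have inst := M.isProbabilityMeasure_finiteVolume (d := d)
  have hcm := M.continuous_condMean Λ hf hC
  have hcmC := M.abs_condMean_le Λ hf hC
  set g : Config d → ℝ := fun x => condMean F G lam Λ f x - f x
  have hg : Continuous g := hcm.sub hf
  have hgC : ∀ x, |g x| ≤ 2 * C := fun x => by
    have h1 := abs_le.1 (hC x)
    have h2 := abs_le.1 (hcmC x)
    rw [abs_le]; constructor <;> simp only [g] <;> linarith
  have hbound : ∀ n, ‖∫ x, g x ∂averaged F G lam p n‖ ≤ 2 * C *
      ((((box d n).filter fun a => ¬ Λ.image (· + a) ⊆ box d n).card : ℝ) / (box d n).card) := by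
    intro n
    set ν := finiteVolume F G lam (box d n) fun _ => p
    have hi : ∀ (μ : Measure (Config d)) [IsProbabilityMeasure μ] (u : Config d → ℝ),
        Continuous u → (∀ x, |u x| ≤ C) → Integrable u μ := fun μ _ u hu huC =>
      Integrable.of_bound hu.aestronglyMeasurable C (Eventually.of_forall huC)
    have hzero : ∀ a, Λ.image (· + a) ⊆ box d n → ∫ x, g (translate a x) ∂ν = 0 := by
      intro a ha
      have hτ := continuous_translate (d := d) a
      simp only [g]
      rw [integral_sub (by exact hi ν _ (hcm.comp hτ) fun x => hcmC _)
        (by exact hi ν _ (hf.comp hτ) fun x => hC _), sub_eq_zero]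
      simp_rw [M.condMean_translate Λ a hf]
      exact M.integral_condMean_finiteVolume ha _ (hf.comp hτ) fun x => hC _
    have hmap : ∀ a ∈ box d n, Integrable g (ν.map (translate a)) := fun a _ => by
      have : IsProbabilityMeasure (ν.map (translate a)) :=
        Measure.isProbabilityMeasure_map (continuous_translate a).aemeasurable
      exact Integrable.of_bound hg.aestronglyMeasurable (2 * C) (Eventually.of_forall hgC)
    rw [averaged, integral_smul_measure, integral_finsetSum_measure hmap]
    have h1 : ∀ a ∈ box d n, ∫ x, g x ∂ν.map (translate a)
        = if ¬ Λ.image (· + a) ⊆ box d n then ∫ x, g (translate a x) ∂ν else 0 := by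
      intro a _
      rw [integral_map (continuous_translate a).aemeasurable hg.aestronglyMeasurable]
      split_ifs with h
      · exact hzero a h
      · rfl
    rw [Finset.sum_congr rfl h1, ← Finset.sum_filter, norm_smul, mul_div_assoc', mul_comm,
      div_eq_mul_inv]
    simp only [ENNReal.toReal_inv, ENNReal.toReal_natCast, norm_inv, Real.norm_natCast]
    refine mul_le_mul_of_nonneg_right ?_ (by positivity)
    refine (norm_sum_le _ _).trans ((Finset.sum_le_card_nsmul _ _ (2 * C) fun a _ => ?_).trans_eq
      (by rw [nsmul_eq_mul, mul_comm]))
    exact abs_integral_le_of_bounded ν fun x => hgC _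
  refine squeeze_zero_norm hbound ?_
  simpa using (tendsto_card_filter_box Λ).const_mul (2 * C)

/-- Existence of Gibbs measures. The limit inherits every moment bound that holds uniformly for the
finite volume measures. -/
theorem exists_isGibbs (M : Model F G ε r₀ lam) {p : ℝ} (hp : deriv F p = 0) :
    ∃ μ : Measure (Config d), IsGibbs F G lam μ ∧
      (∀ k, ∫⁻ x, ENNReal.ofReal ((psi F (x k) - psi F p) ^ 2) ∂μ ≤ 1) ∧
      ∀ φ : ℝ → ℝ, Continuous φ → (∀ u, 0 ≤ φ u) → ∀ C : ℝ≥0∞, C ≠ ∞ →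
        (∀ Λ k, ∫⁻ x, ENNReal.ofReal (φ (x k)) ∂finiteVolume F G lam Λ (fun _ => p) ≤ C) →
        ∀ k, ∫⁻ x, ENNReal.ofReal (φ (x k)) ∂μ ≤ C := by
  classical
  have hF := M.condA.uniformlyConvex
  have hψ := continuous_psi hF.contDiff
  have inst := M.isProbabilityMeasure_averaged (d := d) p
  set ν : ℕ → ProbabilityMeasure (Config d) := fun n => ⟨averaged F G lam p n, inst n⟩
  have htight : IsTightMeasureSet
      {((μ : ProbabilityMeasure (Config d)) : Measure (Config d)) | μ ∈ Set.range ν} := by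
    rw [isTightMeasureSet_iff_exists_isCompact_measure_compl_le]
    intro η hη
    obtain ⟨t, ht, hts⟩ := ENNReal.exists_pos_sum_of_countable' hη.ne' (Lattice d)
    set A : Lattice d → Set ℝ := fun k =>
      {u | ENNReal.ofReal ((psi F u - psi F p) ^ 2) ≤ (t k)⁻¹}
    have hAcont : Continuous fun u => ENNReal.ofReal ((psi F u - psi F p) ^ 2) :=
      ENNReal.continuous_ofReal.comp ((hψ.sub continuous_const).pow 2)
    -- in the metric `ρ`, the spin at `k` has distance from `p` at most `(t k) ^ (-1 / 2)` up to
    -- an event of probability `t k`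
    refine ⟨Set.univ.pi A, isCompact_univ_pi fun k => ?_, ?_⟩
    · refine Metric.isCompact_of_isClosed_isBounded (isClosed_le hAcont continuous_const) ?_
      refine (Metric.isBounded_closedBall (x := p) (r := √((t k)⁻¹.toReal) / √ε)).subset ?_
      intro u hu
      have h1 := ENNReal.toReal_mono (ENNReal.inv_ne_top.2 (ht k).ne') hu
      rw [ENNReal.toReal_ofReal (sq_nonneg _)] at h1
      have h2 := (sqrt_mul_abs_sub_le hF u p).trans (Real.abs_le_sqrt h1)
      rw [Metric.mem_closedBall, Real.dist_eq, le_div_iff₀ (Real.sqrt_pos.2 hF.eps_pos), mul_comm]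
      exact h2
    · rintro _ ⟨_, ⟨n, rfl⟩, rfl⟩
      have h1 : (Set.univ.pi A)ᶜ ⊆ ⋃ k, {x : Config d |
          (t k)⁻¹ ≤ ENNReal.ofReal ((psi F (x k) - psi F p) ^ 2)} := by
        intro x hx
        simp only [Set.mem_compl_iff, Set.mem_univ_pi, not_forall] at hx
        obtain ⟨k, hk⟩ := hx
        exact Set.mem_iUnion.2 ⟨k, show (t k)⁻¹ ≤ _ from le_of_not_ge hk⟩
      refine (measure_mono h1).trans ((measure_iUnion_le _).trans (le_trans ?_ hts.le))
      refine ENNReal.tsum_le_tsum fun k => ?_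
      have h2 := mul_meas_ge_le_lintegral (μ := averaged F G lam p n)
        (hAcont.measurable.comp (measurable_pi_apply k)) (t k)⁻¹
      have h3 := h2.trans (M.lintegral_psi_averaged_le hp n k)
      have ht' : t k ≠ ∞ := ne_top_of_le_ne_top (hts.ne_top) (ENNReal.le_tsum k)
      rw [mul_comm, ← div_eq_mul_inv, ENNReal.div_le_iff (ht k).ne' ht', one_mul] at h3
      exact h3
  -- a limit along an ultrafilter, which spares the choice of a subsequence
  obtain ⟨μ, -, hμ⟩ := (isCompact_closure_of_isTightMeasureSet htight).ultrafilter_le_nhds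
    ((hyperfilter ℕ).map ν) (by
      rw [le_principal_iff]
      exact mem_map.2 (univ_mem' fun n => subset_closure ⟨n, rfl⟩))
  have hlim : Tendsto ν (hyperfilter ℕ : Filter ℕ) (𝓝 μ) := hμ
  have hint : ∀ f : Config d → ℝ, Continuous f → ∀ C : ℝ, (∀ x, |f x| ≤ C) →
      Tendsto (fun n => ∫ x, f x ∂averaged F G lam p n) (hyperfilter ℕ : Filter ℕ)
        (𝓝 (∫ x, f x ∂(μ : Measure (Config d)))) := fun f hf C hC =>
    ProbabilityMeasure.tendsto_iff_forall_integral_tendsto.1 hlim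
      (BoundedContinuousFunction.ofNormedAddCommGroup f hf C hC)
  have hmom : ∀ φ : ℝ → ℝ, Continuous φ → (∀ u, 0 ≤ φ u) → ∀ C : ℝ≥0∞, C ≠ ∞ → ∀ k,
      (∀ n, ∫⁻ x, ENNReal.ofReal (φ (x k)) ∂averaged F G lam p n ≤ C) →
      ∫⁻ x, ENNReal.ofReal (φ (x k)) ∂(μ : Measure (Config d)) ≤ C := by
    intro φ hφ hφ0 C hCt k hC
    -- weak convergence applies to the truncations of `φ`
    have hmono : ∫⁻ x, ENNReal.ofReal (φ (x k)) ∂(μ : Measure (Config d))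
        = ⨆ N : ℕ, ∫⁻ x, ENNReal.ofReal (min (φ (x k)) N) ∂(μ : Measure (Config d)) := by
      rw [← lintegral_iSup]
      · refine lintegral_congr fun x => le_antisymm ?_ (iSup_le fun N =>
          ENNReal.ofReal_le_ofReal (min_le_left _ _))
        obtain ⟨N, hN⟩ := exists_nat_ge (φ (x k))
        exact le_iSup_of_le N (by rw [min_eq_left hN])
      · exact fun N => ((hφ.comp (continuous_apply k)).min
          continuous_const).measurable.ennreal_ofReal
      · exact fun N N' h x => ENNReal.ofReal_le_ofReal
          (min_le_min_left _ (by exact_mod_cast h))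
    rw [hmono]
    refine iSup_le fun N => ?_
    have hc : Continuous fun x : Config d => min (φ (x k)) (N : ℝ) :=
      (hφ.comp (continuous_apply k)).min continuous_const
    have h0 : ∀ x : Config d, 0 ≤ min (φ (x k)) (N : ℝ) := fun x =>
      le_min (hφ0 _) (Nat.cast_nonneg _)
    have hb : ∀ x : Config d, |min (φ (x k)) (N : ℝ)| ≤ N := fun x => by
      rw [abs_of_nonneg (h0 x)]; exact min_le_right _ _
    have hi : ∀ (μ : Measure (Config d)) [IsProbabilityMeasure μ],
        Integrable (fun x => min (φ (x k)) (N : ℝ)) μ := fun μ _ =>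
      Integrable.of_bound hc.aestronglyMeasurable N (Eventually.of_forall hb)
    rw [← ofReal_integral_eq_lintegral_ofReal (hi _) (Eventually.of_forall h0)]
    refine ENNReal.ofReal_le_of_le_toReal (le_of_tendsto (hint _ hc N hb)
      (Eventually.of_forall fun n => ?_))
    rw [← ENNReal.ofReal_le_iff_le_toReal hCt,
      ofReal_integral_eq_lintegral_ofReal (hi _) (Eventually.of_forall h0)]
    exact (lintegral_mono fun x => ENNReal.ofReal_le_ofReal (min_le_left _ _)).trans (hC n)
  refine ⟨μ, ⟨inferInstance, fun Λ f hf => ?_⟩, fun k => ?_, fun φ hφ hφ0 C hCt hC k => ?_⟩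
  · obtain ⟨C, hC⟩ := hf.bounded
    have hcm := M.continuous_condMean Λ hf.continuous hC
    have hcmC := M.abs_condMean_le Λ hf.continuous hC
    have hi : ∀ (u : Config d → ℝ), Continuous u → (∀ x, |u x| ≤ C) →
        Integrable u (μ : Measure (Config d)) := fun u hu huC =>
      Integrable.of_bound hu.aestronglyMeasurable C (Eventually.of_forall huC)
    have h1 := (M.tendsto_integral_condMean_sub p Λ hf.continuous hC).mono_left
      (Nat.hyperfilter_le_atTop)
    have h2 := hint (fun x => condMean F G lam Λ f x - f x) (hcm.sub hf.continuous) (C + C)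
      fun x => (abs_sub _ _).trans (add_le_add (hcmC x) (hC x))
    have h3 := tendsto_nhds_unique h2 h1
    rwa [integral_sub (hi _ hcm hcmC) (hi _ hf.continuous hC), sub_eq_zero] at h3
  · exact hmom _ ((hψ.sub continuous_const).pow 2) (fun u => sq_nonneg _) 1 ENNReal.one_ne_top k
      fun n => M.lintegral_psi_averaged_le hp n k
  · exact hmom φ hφ hφ0 C hCt k fun n => lintegral_averaged_le p n
      (φ := fun u => ENNReal.ofReal (φ u)) hφ.measurable.ennreal_ofReal hC k

end Model

end LatticeGibbs

/-! ### Prékopa–Leindler and Gaussian moments -/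

namespace LatticeGibbs

open Function Filter Topology

/-- The one-dimensional Brunn–Minkowski inequality, for sets of midpoints. -/
lemma volume_add_volume_le_of_midpoint {A B S : Set ℝ} (hA : MeasurableSet A)
    (hB : MeasurableSet B) (hA0 : A.Nonempty) (hB0 : B.Nonempty)
    (hS : ∀ x ∈ A, ∀ y ∈ B, (x + y) / 2 ∈ S) :
    volume A + volume B ≤ 2 * volume S := by
  obtain ⟨a₀, ha₀⟩ := hA0
  obtain ⟨b₀, hb₀⟩ := hB0
  have key : ∀ K ⊆ A, IsCompact K → ∀ L ⊆ B, IsCompact L →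
      volume K + volume L ≤ 2 * volume S := by
    intro K hKA hK L hLB hL
    -- inner regularity may return the empty set, for which the midpoint condition says nothing
    set K' := insert a₀ K
    set L' := insert b₀ L
    obtain ⟨a, haK, ha⟩ := (hK.insert a₀).exists_isGreatest (Set.insert_nonempty _ _)
    obtain ⟨b, hbL, hb⟩ := (hL.insert b₀).exists_isLeast (Set.insert_nonempty _ _)
    have hK'A : K' ⊆ A := Set.insert_subset ha₀ hKA
    have hL'B : L' ⊆ B := Set.insert_subset hb₀ hLB
    -- as `a = max K'` and `b = min L'`, the translates `K' + b` and `a + L'` only meet at `a + b`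
    have h1 : (fun x => (x + b) / 2) '' K' ⊆ S := by
      rintro _ ⟨x, hx, rfl⟩; exact hS x (hK'A hx) b (hL'B hbL)
    have h2 : (fun x => (a + x) / 2) '' L' ⊆ S := by
      rintro _ ⟨x, hx, rfl⟩; exact hS a (hK'A haK) x (hL'B hx)
    have e1 : ∀ (c : ℝ) (T : Set ℝ), volume T = 2 * volume ((fun x => (x + c) / 2) '' T) := by
      intro c T
      have : (fun x : ℝ => (x + c) / 2) '' T
          = (fun x => x + c / 2) '' ((fun x => (1 / 2 : ℝ) • x) '' T) := by
        rw [Set.image_image]; congr 1; funext x; simp only [smul_eq_mul]; ring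
      rw [this, Set.image_add_right, measure_preimage_add_right]
      rw [Set.image_smul, Measure.addHaar_smul]
      simp only [Module.finrank_self, pow_one]
      rw [← mul_assoc, abs_of_pos (by norm_num : (0 : ℝ) < 1 / 2)]
      have : (2 : ℝ≥0∞) = ENNReal.ofReal 2 := by simp
      rw [this, ← ENNReal.ofReal_mul (by norm_num)]
      simp
    have h3 : volume K' + volume L' ≤ 2 * volume S := by
      rw [e1 b K', e1 a L', ← mul_add]
      refine mul_le_mul_right ?_ _
      have h4 : (fun x => (x + a) / 2) '' L' ⊆ S := by simpa only [add_comm _ a] using h2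
      have hcompact : IsCompact ((fun x => (x + a) / 2) '' L') :=
        (hL.insert b₀).image (by fun_prop)
      rw [← measure_union₀ hcompact.measurableSet.nullMeasurableSet]
      · exact measure_mono (Set.union_subset h1 h4)
      · refine measure_mono_null (t := {(a + b) / 2}) ?_ (measure_singleton _)
        rintro _ ⟨⟨x, hx, rfl⟩, ⟨y, hy, hxy⟩⟩
        have hx' := ha hx
        have hy' := hb hy
        simp only [Set.mem_singleton_iff] at hxy ⊢
        linarith
    exact (add_le_add (measure_mono (Set.subset_insert _ _))
      (measure_mono (Set.subset_insert _ _))).trans h3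
  rw [hA.measure_eq_iSup_isCompact, hB.measure_eq_iSup_isCompact]
  simp only [iSup_and']
  exact ENNReal.biSup_add_biSup_le' (p := fun K => K ⊆ A ∧ IsCompact K)
    (q := fun L => L ⊆ B ∧ IsCompact L) ⟨∅, Set.empty_subset _, isCompact_empty⟩
    ⟨∅, Set.empty_subset _, isCompact_empty⟩ fun K hK L hL => key K hK.1 hK.2 L hL.1 hL.2

/-- The Prékopa–Leindler inequality in its additive form, for functions with supremum `1`. -/
lemma lintegral_add_lintegral_le_of_midpoint {f g h : ℝ → ℝ} (hf : Measurable f)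
    (hg : Measurable g) (hh : Measurable h) (hf0 : ∀ x, 0 ≤ f x) (hg0 : ∀ x, 0 ≤ g x)
    (hh0 : ∀ x, 0 ≤ h x) (hf1 : ∀ x, f x ≤ 1) (hg1 : ∀ x, g x ≤ 1)
    (hfs : ∀ t < 1, ∃ x, t < f x) (hgs : ∀ t < 1, ∃ x, t < g x)
    (H : ∀ x y, f x * g y ≤ h ((x + y) / 2) ^ 2) :
    (∫⁻ x, ENNReal.ofReal (f x)) + ∫⁻ x, ENNReal.ofReal (g x)
      ≤ 2 * ∫⁻ x, ENNReal.ofReal (h x) := by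
  have cake : ∀ u : ℝ → ℝ, Measurable u → (∀ x, 0 ≤ u x) →
      ∫⁻ x, ENNReal.ofReal (u x) = ∫⁻ t in Set.Ioi (0 : ℝ), volume {x | t < u x} :=
    fun u hu hu0 => lintegral_eq_lintegral_meas_lt _ (Eventually.of_forall hu0) hu.aemeasurable
  have hmeas : ∀ u : ℝ → ℝ, Measurable fun t : ℝ => volume {x | t < u x} := fun u =>
    Antitone.measurable fun s t hst => measure_mono fun x hx => lt_of_le_of_lt hst hx
  rw [cake f hf hf0, cake g hg hg0, cake h hh hh0, ← lintegral_add_left (hmeas f),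
    ← lintegral_const_mul _ (hmeas h)]
  refine setLIntegral_mono (by exact (hmeas h).const_mul 2) fun t ht => ?_
  rcases lt_or_ge t 1 with h1 | h1
  · refine volume_add_volume_le_of_midpoint (measurableSet_lt measurable_const hf)
      (measurableSet_lt measurable_const hg) (hfs t h1) (hgs t h1) fun x hx y hy => ?_
    have ht0 : 0 < t := ht
    have h2 : t ^ 2 < h ((x + y) / 2) ^ 2 := by
      refine lt_of_lt_of_le ?_ (H x y)
      rw [sq]
      exact mul_lt_mul'' hx hy ht0.le ht0.le
    exact lt_of_pow_lt_pow_left₀ 2 (hh0 _) h2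
  · have e : ∀ u : ℝ → ℝ, (∀ x, u x ≤ 1) → {x | t < u x} = ∅ := fun u hu =>
      Set.eq_empty_of_forall_notMem fun x hx =>
        (lt_irrefl t) (lt_of_lt_of_le hx ((hu x).trans h1))
    simp [e f hf1, e g hg1]

/-- The Prékopa–Leindler inequality on the line, for midpoints and bounded functions. -/
lemma prekopa_leindler_of_bounded {f g h : ℝ → ℝ} {C : ℝ} (hf : Measurable f)
    (hg : Measurable g) (hh : Measurable h) (hf0 : ∀ x, 0 ≤ f x) (hg0 : ∀ x, 0 ≤ g x)
    (hh0 : ∀ x, 0 ≤ h x) (hf1 : ∀ x, f x ≤ C) (hg1 : ∀ x, g x ≤ C)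
    (H : ∀ x y, f x * g y ≤ h ((x + y) / 2) ^ 2) :
    (∫⁻ x, ENNReal.ofReal (f x)) * ∫⁻ x, ENNReal.ofReal (g x)
      ≤ (∫⁻ x, ENNReal.ofReal (h x)) ^ 2 := by
  have hbf : BddAbove (Set.range f) := ⟨C, by rintro _ ⟨x, rfl⟩; exact hf1 x⟩
  have hbg : BddAbove (Set.range g) := ⟨C, by rintro _ ⟨x, rfl⟩; exact hg1 x⟩
  set a := ⨆ x, f x
  set b := ⨆ x, g x
  have hfa : ∀ x, f x ≤ a := le_ciSup hbf
  have hgb : ∀ x, g x ≤ b := le_ciSup hbg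
  rcases (hf0 0 |>.trans (hfa 0)).eq_or_lt with ha | ha
  · have : ∀ x, f x = 0 := fun x => le_antisymm (ha ▸ hfa x) (hf0 x)
    simp [this]
  rcases (hg0 0 |>.trans (hgb 0)).eq_or_lt with hb | hb
  · have : ∀ x, g x = 0 := fun x => le_antisymm (hb ▸ hgb x) (hg0 x)
    simp [this]
  have hab : 0 < √(a * b) := Real.sqrt_pos.2 (mul_pos ha hb)
  have key := lintegral_add_lintegral_le_of_midpoint (f := fun x => f x / a)
    (g := fun x => g x / b) (h := fun x => h x / √(a * b)) (hf.div_const a) (hg.div_const b)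
    (hh.div_const _) (fun x => div_nonneg (hf0 x) ha.le) (fun x => div_nonneg (hg0 x) hb.le)
    (fun x => div_nonneg (hh0 x) hab.le) (fun x => (div_le_one ha).2 (hfa x))
    (fun x => (div_le_one hb).2 (hgb x)) (fun t ht => ?_) (fun t ht => ?_) fun x y => ?_
  · have e : ∀ (u : ℝ → ℝ) (c : ℝ), 0 < c → Measurable u → ∫⁻ x, ENNReal.ofReal (u x / c)
        = (∫⁻ x, ENNReal.ofReal (u x)) / ENNReal.ofReal c := by
      intro u c hc hu
      simp_rw [ENNReal.ofReal_div_of_pos hc, div_eq_mul_inv]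
      exact lintegral_mul_const _ hu.ennreal_ofReal
    rw [e f a ha hf, e g b hb hg, e h _ hab hh] at key
    set I := ∫⁻ x, ENNReal.ofReal (f x)
    set J := ∫⁻ x, ENNReal.ofReal (g x)
    set K := ∫⁻ x, ENNReal.ofReal (h x)
    by_cases hK : K = ∞
    · simp [hK]
    have hKr : 2 * (K / ENNReal.ofReal √(a * b)) ≠ ∞ :=
      ENNReal.mul_ne_top (by simp) (ENNReal.div_ne_top hK (by simpa using hab))
    have hsum := ne_top_of_le_ne_top hKr key
    have hI : I ≠ ∞ := fun hI => by
      apply hsum; rw [hI, ENNReal.top_div_of_ne_top ENNReal.ofReal_ne_top, top_add]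
    have hJ : J ≠ ∞ := fun hJ => by
      apply hsum; rw [hJ, ENNReal.top_div_of_ne_top ENNReal.ofReal_ne_top, add_top]
    have key' := ENNReal.toReal_mono hKr key
    rw [ENNReal.toReal_add (ENNReal.div_ne_top hI (by simpa using ha))
      (ENNReal.div_ne_top hJ (by simpa using hb)), ENNReal.toReal_mul, ENNReal.toReal_div,
      ENNReal.toReal_div, ENNReal.toReal_div, ENNReal.toReal_ofReal ha.le,
      ENNReal.toReal_ofReal hb.le, ENNReal.toReal_ofReal hab.le, ENNReal.toReal_ofNat] at key'
    rw [← ENNReal.toReal_le_toReal (ENNReal.mul_ne_top hI hJ) (ENNReal.pow_ne_top hK),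
      ENNReal.toReal_mul, ENNReal.toReal_pow]
    set i := I.toReal
    set j := J.toReal
    set k := K.toReal
    have hi : 0 ≤ i / a := div_nonneg ENNReal.toReal_nonneg ha.le
    have hj : 0 ≤ j / b := div_nonneg ENNReal.toReal_nonneg hb.le
    have hsq : (i / a + j / b) ^ 2 ≤ (2 * (k / √(a * b))) ^ 2 :=
      pow_le_pow_left₀ (add_nonneg hi hj) key' 2
    rw [mul_pow, div_pow, Real.sq_sqrt (mul_pos ha hb).le] at hsq
    have h4 : 4 * (i / a * (j / b)) ≤ (i / a + j / b) ^ 2 := by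
      nlinarith [sq_nonneg (i / a - j / b)]
    have h5 : i / a * (j / b) = i * j / (a * b) := by rw [div_mul_div_comm]
    rw [h5] at h4
    have h6 : i * j / (a * b) ≤ k ^ 2 / (a * b) := by linarith
    exact (div_le_div_iff_of_pos_right (mul_pos ha hb)).1 h6
  · obtain ⟨x, hx⟩ := exists_lt_of_lt_ciSup (show t * a < ⨆ x, f x from by
      change t * a < a; nlinarith)
    exact ⟨x, (lt_div_iff₀ ha).2 hx⟩
  · obtain ⟨x, hx⟩ := exists_lt_of_lt_ciSup (show t * b < ⨆ x, g x from by
      change t * b < b; nlinarith)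
    exact ⟨x, (lt_div_iff₀ hb).2 hx⟩
  · rw [div_mul_div_comm, div_pow, Real.sq_sqrt (mul_pos ha hb).le]
    exact div_le_div_of_nonneg_right (H x y) (mul_pos ha hb).le

/-- The **Prékopa–Leindler inequality** on the line, for midpoints. -/
lemma prekopa_leindler {f g h : ℝ → ℝ≥0∞} (hf : Measurable f)
    (hg : Measurable g) (hh : Measurable h)
    (H : ∀ x y, f x * g y ≤ h ((x + y) / 2) ^ 2) :
    (∫⁻ x, f x) * ∫⁻ x, g x ≤ (∫⁻ x, h x) ^ 2 := by
  have trunc : ∀ u : ℝ → ℝ≥0∞, Measurable u →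
      ∫⁻ x, u x = ⨆ n : ℕ, ∫⁻ x, min (u x) n := by
    intro u hu
    rw [← lintegral_iSup (fun n => hu.min measurable_const)
      fun n m hnm x => min_le_min_left _ (by exact_mod_cast hnm)]
    refine lintegral_congr fun x => ?_
    rw [← inf_iSup_eq, ENNReal.iSup_natCast, inf_top_eq]
  have hreal : ∀ (u : ℝ → ℝ≥0∞) (n : ℕ) x, ENNReal.ofReal (min (u x) n).toReal = min (u x) n :=
    fun u n x => ENNReal.ofReal_toReal (ne_top_of_le_ne_top (ENNReal.natCast_ne_top n)
      (min_le_right _ _))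
  have hle : ∀ (u : ℝ → ℝ≥0∞) (n : ℕ) x, (min (u x) n).toReal ≤ n := fun u n x => by
    simpa using ENNReal.toReal_mono (ENNReal.natCast_ne_top n) (min_le_right (u x) (n : ℝ≥0∞))
  rw [trunc f hf, trunc g hg, ENNReal.iSup_mul]
  refine iSup_le fun n => ?_
  rw [ENNReal.mul_iSup]
  refine iSup_le fun m => ?_
  set N := max n m
  have key := prekopa_leindler_of_bounded (C := N) (f := fun x => (min (f x) n).toReal)
    (g := fun x => (min (g x) m).toReal) (h := fun x => (min (h x) N).toReal)
    (hf.min measurable_const).ennreal_toReal (hg.min measurable_const).ennreal_toReal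
    (hh.min measurable_const).ennreal_toReal (fun x => ENNReal.toReal_nonneg)
    (fun x => ENNReal.toReal_nonneg) (fun x => ENNReal.toReal_nonneg)
    (fun x => (hle f n x).trans (by exact_mod_cast le_max_left n m))
    (fun x => (hle g m x).trans (by exact_mod_cast le_max_right n m)) fun x y => ?_
  · simp only [hreal] at key
    refine key.trans (pow_le_pow_left' (lintegral_mono fun x => min_le_left _ _) 2)
  · rw [← ENNReal.toReal_mul, ← ENNReal.toReal_pow]
    have hNt : min (h ((x + y) / 2)) (N : ℝ≥0∞) ≠ ∞ :=
      ne_top_of_le_ne_top (ENNReal.natCast_ne_top N) (min_le_right _ _)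
    refine ENNReal.toReal_mono (ENNReal.pow_ne_top hNt) ?_
    rcases le_total (h ((x + y) / 2)) N with h1 | h1
    · rw [min_eq_left h1]
      exact (mul_le_mul' (min_le_left _ _) (min_le_left _ _)).trans (H x y)
    · rw [min_eq_right h1, sq]
      refine mul_le_mul' ((min_le_right _ _).trans ?_) ((min_le_right _ _).trans ?_)
      · exact_mod_cast le_max_left n m
      · exact_mod_cast le_max_right n m

/-- The Prékopa–Leindler inequality for partial integrals over finitely many coordinates: the
hypothesis on midpoints is inherited when a coordinate is integrated out. -/
lemma prekopa_leindler_lmarginal {ι : Type*} [DecidableEq ι] (s : Finset ι)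
    {f g h : (ι → ℝ) → ℝ≥0∞} (hf : Measurable f) (hg : Measurable g) (hh : Measurable h)
    (H : ∀ x y, f x * g y ≤ h (fun i => (x i + y i) / 2) ^ 2) (x y : ι → ℝ) :
    lmarginal (fun _ => volume) s f x * lmarginal (fun _ => volume) s g y
      ≤ lmarginal (fun _ => volume) s h (fun i => (x i + y i) / 2) ^ 2 := by
  induction s using Finset.induction generalizing x y with
  | empty => simpa using H x y
  | insert i s hi ih =>
    rw [lmarginal_insert f hf hi, lmarginal_insert g hg hi, lmarginal_insert h hh hi]
    have hm : ∀ u : (ι → ℝ) → ℝ≥0∞, Measurable u → ∀ z : ι → ℝ, Measurable fun t =>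
        lmarginal (fun _ : ι => (volume : Measure ℝ)) s u (update z i t) := fun u hu z =>
      (Measurable.lmarginal _ hu).comp (measurable_update z)
    refine prekopa_leindler (hm f hf x) (hm g hg y) (hm h hh _) fun a b => ?_
    refine (ih (update x i a) (update y i b)).trans_eq ?_
    congr 2
    funext j
    by_cases hj : j = i
    · subst hj; simp
    · simp [hj]

/-- A subgaussian bound on the exponential moments of `X` yields the sharp bound on those of
`X ^ 2`, by writing `exp (a X ^ 2)` as a Gaussian average of `exp (s X)`. -/
lemma lintegral_exp_mul_sq_le {Ω : Type*} [MeasurableSpace Ω] (μ : Measure Ω)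
    [IsProbabilityMeasure μ] {X : Ω → ℝ} (hX : Measurable X) {ε : ℝ} (hε : 0 < ε)
    (h : ∀ s : ℝ, ∫⁻ x, ENNReal.ofReal (Real.exp (s * X x)) ∂μ
      ≤ ENNReal.ofReal (Real.exp (s ^ 2 / (2 * ε)))) {a : ℝ} (ha0 : 0 ≤ a) (ha : a < ε / 2) :
    ∫⁻ x, ENNReal.ofReal (Real.exp (a * X x ^ 2)) ∂μ
      ≤ ENNReal.ofReal (Real.exp (a / (ε - 2 * a))) := by
  rcases ha0.eq_or_lt with rfl | ha0
  · simp
  have h2a : 0 < ε - 2 * a := by linarith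
  have gauss : ∀ b : ℝ, 0 < b → ∀ c : ℝ,
      ∫⁻ s : ℝ, ENNReal.ofReal (Real.exp (-b * (s - c) ^ 2)) = ENNReal.ofReal √(Real.pi / b) := by
    intro b hb c
    rw [← ofReal_integral_eq_lintegral_ofReal ((integrable_exp_neg_mul_sq hb).comp_sub_right c)
      (Eventually.of_forall fun s => (Real.exp_pos _).le),
      integral_sub_right_eq_self (fun s => Real.exp (-b * s ^ 2)) c, integral_gaussian]
  -- completing the square: `s t - b s ^ 2 = a t ^ 2 - b (s - 2 a t) ^ 2` for `b = 1 / (4 a)`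
  set b := 1 / (4 * a)
  have hb : 0 < b := by positivity
  have e1 : ∀ t : ℝ, ENNReal.ofReal √(Real.pi / b) * ENNReal.ofReal (Real.exp (a * t ^ 2))
      = ∫⁻ s : ℝ, ENNReal.ofReal (Real.exp (s * t)) * ENNReal.ofReal (Real.exp (-b * s ^ 2)) := by
    intro t
    rw [← gauss b hb (2 * a * t), ← lintegral_mul_const _ (by fun_prop)]
    refine lintegral_congr fun s => ?_
    rw [← ENNReal.ofReal_mul (Real.exp_pos _).le, ← ENNReal.ofReal_mul (Real.exp_pos _).le,
      ← Real.exp_add, ← Real.exp_add]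
    congr 2
    simp only [b]; field_simp; ring
  set b' := b - 1 / (2 * ε)
  have hb' : b' = (ε - 2 * a) / (4 * a * ε) := by simp only [b', b]; field_simp; ring
  have hb'0 : 0 < b' := by rw [hb']; positivity
  have e2 : ENNReal.ofReal √(Real.pi / b) * ∫⁻ x, ENNReal.ofReal (Real.exp (a * X x ^ 2)) ∂μ
      ≤ ENNReal.ofReal √(Real.pi / b') := by
    rw [← lintegral_const_mul _ (by fun_prop)]
    simp_rw [e1]
    rw [lintegral_lintegral_swap (by fun_prop), ← gauss b' hb'0 0]
    refine lintegral_mono fun s => ?_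
    rw [lintegral_mul_const _ (by fun_prop)]
    refine (mul_le_mul_left (h s) _).trans_eq ?_
    rw [← ENNReal.ofReal_mul (Real.exp_pos _).le, ← Real.exp_add]
    congr 2
    simp only [b']; ring
  have e3 : √(Real.pi / b') ≤ √(Real.pi / b) * Real.exp (a / (ε - 2 * a)) := by
    have h1 : Real.pi / b' ≤ Real.pi / b * Real.exp (a / (ε - 2 * a)) ^ 2 := by
      have h2 : Real.exp (a / (ε - 2 * a)) ^ 2 = Real.exp (2 * a / (ε - 2 * a)) := by
        rw [← Real.exp_nat_mul]; congr 1; push_cast; ring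
      have h3 := Real.add_one_le_exp (2 * a / (ε - 2 * a))
      have h4 : Real.pi / b' = Real.pi / b * (2 * a / (ε - 2 * a) + 1) := by
        rw [hb']; simp only [b]; field_simp; ring
      rw [h2, h4]
      exact mul_le_mul_of_nonneg_left h3 (by positivity)
    calc √(Real.pi / b') ≤ √(Real.pi / b * Real.exp (a / (ε - 2 * a)) ^ 2) :=
          Real.sqrt_le_sqrt h1
      _ = _ := by rw [Real.sqrt_mul (by positivity), Real.sqrt_sq (Real.exp_pos _).le]
  have hpos : 0 < √(Real.pi / b) := Real.sqrt_pos.2 (by positivity)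
  have e4 := e2.trans (ENNReal.ofReal_le_ofReal e3)
  rw [ENNReal.ofReal_mul (Real.sqrt_nonneg _)] at e4
  exact (ENNReal.mul_le_mul_iff_right (by simpa using hpos) ENNReal.ofReal_ne_top).1 e4

/-- The midpoint inequality for a uniformly convex function. -/
lemma UniformlyConvex.midpoint_le {V : ℝ → ℝ} {ε : ℝ} (h : UniformlyConvex V ε) (u v : ℝ) :
    2 * V ((u + v) / 2) + ε / 4 * (u - v) ^ 2 ≤ V u + V v := by
  set c := (u + v) / 2
  have hd := differentiable_of_contDiff_two h.contDiff
  have e1 : ∀ x, deriv (fun x => V x - deriv V c * x) x = deriv V x - deriv V c := fun x => by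
    rw [deriv_fun_sub (hd x) (by fun_prop), deriv_const_mul _ (by fun_prop)]; simp
  have h' : UniformlyConvex (fun x => V x - deriv V c * x) ε := by
    refine ⟨h.contDiff.sub (by fun_prop), h.eps_pos, fun x => ?_⟩
    rw [funext e1, deriv_sub_const]
    exact h.convex x
  have h1 := h'.parabola_le (m := c) (by rw [e1]; ring) u
  have h2 := h'.parabola_le (m := c) (by rw [e1]; ring) v
  have h3 : u - c = (u - v) / 2 := by simp only [c]; ring
  have h4 : v - c = -((u - v) / 2) := by simp only [c]; ring
  rw [h3] at h1
  rw [h4] at h2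
  have h5 : deriv V c * u + deriv V c * v = 2 * (deriv V c * c) := by simp only [c]; ring
  nlinarith

namespace Model

variable {d : ℕ} {F : ℝ → ℝ} {G : Lattice d → ℝ → ℝ} {ε r₀ lam : ℝ}

/-- The energy is convex, and uniformly so in each coordinate. -/
lemma energy_midpoint_le (M : Model F G ε r₀ lam) {Λ : Finset (Lattice d)} {k : Lattice d}
    (hk : k ∈ Λ) (x y : Config d) :
    2 * energy F G lam Λ (fun i => (x i + y i) / 2) + ε / 4 * (x k - y k) ^ 2
      ≤ energy F G lam Λ x + energy F G lam Λ y := by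
  have hF := M.condA.uniformlyConvex
  have h1 : 2 * interaction G Λ (fun i => (x i + y i) / 2)
      ≤ interaction G Λ x + interaction G Λ y := by
    rw [M.interaction_eq subset_rfl, M.interaction_eq subset_rfl, M.interaction_eq subset_rfl,
      ← mul_add, mul_left_comm]
    refine mul_le_mul_of_nonneg_left ?_ (by norm_num)
    rw [Finset.mul_sum, ← Finset.sum_add_distrib]
    refine Finset.sum_le_sum fun i _ => ?_
    rw [Finset.mul_sum, ← Finset.sum_add_distrib]
    refine Finset.sum_le_sum fun j _ => ?_
    unfold pairTerm
    split_ifs with h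
    · have h2 := (M.convexOn_G (sub_ne_zero.2 h.1)).2 (Set.mem_univ (x i - x j))
        (Set.mem_univ (y i - y j)) (by norm_num : (0 : ℝ) ≤ 1 / 2) (by norm_num : (0 : ℝ) ≤ 1 / 2)
        (by norm_num)
      have h3 : (1 / 2 : ℝ) • (x i - x j) + (1 / 2 : ℝ) • (y i - y j)
          = (x i + y i) / 2 - (x j + y j) / 2 := by simp only [smul_eq_mul]; ring
      rw [h3] at h2
      simp only [smul_eq_mul] at h2
      linarith
    · simp
  have h2 : 2 * ∑ i ∈ Λ, F ((x i + y i) / 2) + ε / 4 * (x k - y k) ^ 2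
      ≤ ∑ i ∈ Λ, F (x i) + ∑ i ∈ Λ, F (y i) := by
    have h3 : ε / 4 * (x k - y k) ^ 2 ≤ ∑ i ∈ Λ, ε / 4 * (x i - y i) ^ 2 :=
      Finset.single_le_sum (f := fun i => ε / 4 * (x i - y i) ^ 2)
        (fun i _ => mul_nonneg (by linarith [hF.eps_pos]) (sq_nonneg _)) hk
    refine (add_le_add_right h3 _).trans ?_
    rw [Finset.mul_sum, ← Finset.sum_add_distrib, ← Finset.sum_add_distrib]
    exact Finset.sum_le_sum fun i _ => hF.midpoint_le _ _
  unfold energy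
  nlinarith [mul_le_mul_of_nonneg_left h1 M.lam_nonneg]

lemma energy_neg (hF : ∀ x, F (-x) = F x) (hG : ∀ j, j ≠ 0 → ∀ x, G j (-x) = G j x)
    (M : Model F G ε r₀ lam) (Λ : Finset (Lattice d)) (x : Config d) :
    energy F G lam Λ (-x) = energy F G lam Λ x := by
  have h : ∀ k j, pairTerm G Λ (-x) k j = pairTerm G Λ x k j := by
    intro k j
    unfold pairTerm
    split_ifs with h
    · rw [← hG _ (sub_ne_zero.2 h.1)]
      simp only [Pi.neg_apply]
      congr 1; ring
    · rfl
  simp only [energy, M.interaction_eq subset_rfl, h, Pi.neg_apply, hF]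

/-- For even potentials and zero boundary condition, every coordinate is subgaussian with the
variance `1 / ε` of the uncoupled quadratic model. This is the Prékopa–Leindler inequality for the
density tilted by `exp (s x_k)` and its reflection. -/
lemma lintegral_exp_mul_finiteVolume_le (M : Model F G ε r₀ lam) (hF : ∀ x, F (-x) = F x)
    (hG : ∀ j, j ≠ 0 → ∀ x, G j (-x) = G j x) (Λ : Finset (Lattice d)) (k : Lattice d) (s : ℝ) :
    ∫⁻ x, ENNReal.ofReal (Real.exp (s * x k)) ∂finiteVolume F G lam Λ (fun _ => 0)
      ≤ ENNReal.ofReal (Real.exp (s ^ 2 / (2 * ε))) := by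
  have hε := M.condA.eps_pos
  have hprob := M.isProbabilityMeasure_finiteVolume Λ (fun _ => 0)
  by_cases hk : k ∉ Λ
  · have hae := ae_eq_of_notMem (F := F) (G := G) (lam := lam) Λ (fun _ => 0) hk
    rw [lintegral_congr_ae (g := fun _ => 1)]
    · rw [lintegral_one, measure_univ, ENNReal.one_le_ofReal]
      exact Real.one_le_exp (by positivity)
    · filter_upwards [hae] with x hx
      simp [hx]
  rw [not_not] at hk
  set w := density F G lam Λ
  have hw : Measurable w := M.measurable_density Λ
  set f : ℝ → Config d → ℝ≥0∞ := fun t x => ENNReal.ofReal (Real.exp (t * x k)) * w x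
  have hf : ∀ t, Measurable (f t) := fun t =>
    ((Real.continuous_exp.comp (continuous_const.mul
      (continuous_apply k))).measurable.ennreal_ofReal).mul hw
  set c := ENNReal.ofReal (Real.exp (s ^ 2 / (2 * ε)))
  have hH : ∀ x y, f s x * f (-s) y ≤ (c * w (fun i => (x i + y i) / 2)) ^ 2 := by
    intro x y
    simp only [f, w, density, c, weight_eq_exp]
    rw [← ENNReal.ofReal_mul (Real.exp_pos _).le, ← ENNReal.ofReal_mul (Real.exp_pos _).le,
      ← ENNReal.ofReal_mul (Real.exp_pos _).le, ← ENNReal.ofReal_pow (by positivity),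
      ← ENNReal.ofReal_mul (by positivity), ← Real.exp_add, ← Real.exp_add, ← Real.exp_add,
      ← Real.exp_add, ← Real.exp_nat_mul]
    refine ENNReal.ofReal_le_ofReal (Real.exp_le_exp.2 ?_)
    have h1 := M.energy_midpoint_le hk x y
    have h2 : s * (x k - y k) ≤ s ^ 2 / ε + ε / 4 * (x k - y k) ^ 2 := by
      have h3 : s ^ 2 / ε + ε / 4 * (x k - y k) ^ 2 - s * (x k - y k)
          = (s - ε / 2 * (x k - y k)) ^ 2 / ε := by field_simp; ring
      have h4 : 0 ≤ (s - ε / 2 * (x k - y k)) ^ 2 / ε := by positivity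
      linarith
    have h3 : s ^ 2 / ε = 2 * (s ^ 2 / (2 * ε)) := by field_simp
    push_cast
    linarith
  have hPL := prekopa_leindler_lmarginal Λ (hf s) (hf (-s)) (hw.const_mul c) hH 0 0
  have hrefl : lmarginal (fun _ => volume) Λ (f (-s)) 0
      = lmarginal (fun _ => volume) Λ (f s) 0 := by
    rw [lmarginal, lmarginal, ← volume_pi, ← lintegral_neg_eq_self]
    refine lintegral_congr fun x => ?_
    have hx : updateFinset (0 : Config d) Λ (-x) = -updateFinset (0 : Config d) Λ x := by
      funext i; by_cases hi : i ∈ Λ <;> simp [updateFinset, hi]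
    simp only [hx, f, w, density, weight_eq_exp, energy_neg hF hG M, Pi.neg_apply, neg_mul_neg]
  have hmid : (fun i : Lattice d => ((0 : Config d) i + (0 : Config d) i) / 2) = 0 := by
    funext i; simp
  have hconst : lmarginal (fun _ => volume) Λ (fun x => c * w x) 0
      = c * lmarginal (fun _ => volume) Λ w 0 := by
    rw [lmarginal, lintegral_const_mul (f := fun x => w (updateFinset 0 Λ x)) _
      (hw.comp measurable_updateFinset)]; rfl
  rw [hrefl, hmid, hconst, ← sq] at hPL
  have hle : lmarginal (fun _ => volume) Λ (f s) 0 ≤ c * lmarginal (fun _ => volume) Λ w 0 :=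
    (ENNReal.pow_le_pow_left_iff two_ne_zero).1 hPL
  rw [M.lintegral_finiteVolume Λ _ (by fun_prop)]
  rw [M.lmarginal_density] at hle
  have hZ := M.partitionFn_pos Λ (fun _ => 0)
  refine (mul_le_mul_right hle _).trans_eq ?_
  rw [mul_left_comm, show (0 : Config d) = fun _ => 0 from rfl,
    ENNReal.inv_mul_cancel (by simpa using hZ) ENNReal.ofReal_ne_top, mul_one]

end Model

end LatticeGibbs

/-! ### One-dimensional covariance estimates -/

namespace LatticeGibbs

open Function Filter Topology ProbabilityTheory

/-- If `g` and `W` are Lipschitz with respect to `ψ` with constants `δ` and `κ`, and `ψ` has second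
moment at most one about one of its values, then the covariance of `g` and `W` is at most `δ κ`. -/
lemma abs_covariance_le_of_lipschitz {Ω : Type*} [MeasurableSpace Ω] (ν : Measure Ω)
    [IsProbabilityMeasure ν] {g W ψ : Ω → ℝ} (hg : Measurable g) (hW : Measurable W)
    (hψ : Measurable ψ) (m : Ω) {δ κ : ℝ} (hδ : 0 ≤ δ) (hκ : 0 ≤ κ)
    (hgδ : ∀ x, |g x - g m| ≤ δ * |ψ x - ψ m|) (hWκ : ∀ x, |W x - W m| ≤ κ * |ψ x - ψ m|)
    (hmom : ∫⁻ x, ENNReal.ofReal ((ψ x - ψ m) ^ 2) ∂ν ≤ 1) :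
    |(∫ x, g x * W x ∂ν) - (∫ x, g x ∂ν) * ∫ x, W x ∂ν| ≤ δ * κ := by
  have hint : Integrable (fun x => (ψ x - ψ m) ^ 2) ν := by
    refine ⟨((hψ.sub_const _).pow_const 2).aestronglyMeasurable, ?_⟩
    rw [hasFiniteIntegral_iff_ofReal (Eventually.of_forall fun x => sq_nonneg _)]
    exact hmom.trans_lt ENNReal.one_lt_top
  have hle1 : ∫ x, (ψ x - ψ m) ^ 2 ∂ν ≤ 1 := by
    rw [integral_eq_lintegral_of_nonneg_ae (Eventually.of_forall fun x => sq_nonneg _)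
      hint.aestronglyMeasurable]
    exact ENNReal.toReal_mono ENNReal.one_ne_top hmom
  have hL : MemLp (fun x => ψ x - ψ m) 2 ν :=
    (memLp_two_iff_integrable_sq (hψ.sub_const _).aestronglyMeasurable).2 hint
  -- each of the two functions has variance at most the square of its Lipschitz constant
  have hvar : ∀ (u : Ω → ℝ) (c : ℝ), Measurable u → 0 ≤ c →
      (∀ x, |u x - u m| ≤ c * |ψ x - ψ m|) → MemLp u 2 ν ∧ Var[u; ν] ≤ c ^ 2 := by
    intro u c hu hc huc
    have h1 : MemLp (fun x => u x - u m) 2 ν := by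
      refine (hL.const_mul c).mono (hu.sub_const _).aestronglyMeasurable
        (Eventually.of_forall fun x => ?_)
      rw [Real.norm_eq_abs, Real.norm_eq_abs, abs_mul, abs_of_nonneg hc]
      exact huc x
    have h2 : MemLp u 2 ν := by
      convert! h1.add (memLp_const (u m)) using 1
      funext x; simp
    refine ⟨h2, ?_⟩
    rw [← variance_sub_const h2.aestronglyMeasurable (u m)]
    refine (variance_le_expectation_sq h1.aestronglyMeasurable).trans ?_
    calc ∫ x, (u x - u m) ^ 2 ∂ν ≤ ∫ x, c ^ 2 * (ψ x - ψ m) ^ 2 ∂ν := by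
          refine integral_mono ((memLp_two_iff_integrable_sq h1.aestronglyMeasurable).1 h1)
            (hint.const_mul _) fun x => ?_
          have := pow_le_pow_left₀ (abs_nonneg _) (huc x) 2
          rwa [mul_pow, sq_abs, sq_abs] at this
      _ ≤ c ^ 2 := by
          rw [integral_const_mul]
          exact mul_le_of_le_one_right (sq_nonneg c) hle1
  obtain ⟨hgL, hgv⟩ := hvar g δ hg hδ hgδ
  obtain ⟨hWL, hWv⟩ := hvar W κ hW hκ hWκ
  have hcov := covariance_eq_sub hgL hWL
  simp only [Pi.mul_apply] at hcov
  rw [← hcov]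
  rcases hδ.eq_or_lt with rfl | hδ
  · have : g = fun _ => g m := funext fun x => by
      have := hgδ x; simp at this; linarith
    rw [this, covariance_const_left]; simp
  rcases hκ.eq_or_lt with rfl | hκ
  · have : W = fun _ => W m := funext fun x => by
      have := hWκ x; simp at this; linarith
    rw [this, covariance_const_right]; simp
  have hpos : 0 < δ * κ := mul_pos hδ hκ
  -- the Cauchy–Schwarz inequality, from the variances of `κ g ± δ W`
  have h1 := variance_nonneg (fun x => κ * g x - δ * W x) ν
  have h2 := variance_nonneg (fun x => κ * g x + δ * W x) ν
  rw [variance_fun_sub (hgL.const_mul κ) (hWL.const_mul δ), variance_const_mul,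
    variance_const_mul, covariance_const_mul_left, covariance_const_mul_right] at h1
  rw [variance_fun_add (hgL.const_mul κ) (hWL.const_mul δ), variance_const_mul,
    variance_const_mul, covariance_const_mul_left, covariance_const_mul_right] at h2
  have h3 : κ ^ 2 * Var[g; ν] ≤ κ ^ 2 * δ ^ 2 := mul_le_mul_of_nonneg_left hgv (sq_nonneg _)
  have h4 : δ ^ 2 * Var[W; ν] ≤ δ ^ 2 * κ ^ 2 := mul_le_mul_of_nonneg_left hWv (sq_nonneg _)
  rw [abs_le]
  constructor
  · by_contra! h
    nlinarith [mul_pos hpos (show 0 < -(δ * κ) - cov[g, W; ν] by linarith)]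
  · by_contra! h
    nlinarith [mul_pos hpos (show 0 < cov[g, W; ν] - δ * κ by linarith)]

/-- A function with derivative dominated by `√F''` is Lipschitz in the metric `ρ`. -/
lemma abs_sub_le_mul_abs_psi_sub {F h h' : ℝ → ℝ} {K : ℝ} (hF : ContDiff ℝ 2 F)
    (hh : ∀ x, HasDerivAt h (h' x) x) (hh' : Continuous h')
    (hK : ∀ x, |h' x| ≤ K * √(deriv (deriv F) x)) (x y : ℝ) :
    |h x - h y| ≤ K * |psi F x - psi F y| := by
  wlog hxy : y ≤ x generalizing x y
  · rw [abs_sub_comm (h x), abs_sub_comm (psi F x)]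
    exact this y x (le_of_not_ge hxy)
  have hc := continuous_sqrt_deriv2 hF
  have h1 : ∫ s in y..x, h' s = h x - h y :=
    intervalIntegral.integral_eq_sub_of_hasDerivAt (fun s _ => hh s)
      (hh'.intervalIntegrable _ _)
  have h2 : 0 ≤ ∫ s in y..x, √(deriv (deriv F) s) :=
    intervalIntegral.integral_nonneg hxy fun s _ => Real.sqrt_nonneg _
  rw [← h1, psi_sub hF, abs_of_nonneg h2, ← intervalIntegral.integral_const_mul]
  exact (intervalIntegral.abs_integral_le_integral_abs hxy).trans
    (intervalIntegral.integral_mono_on (μ := volume) hxy (hh'.abs.intervalIntegrable _ _)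
      ((continuous_const.mul hc).intervalIntegrable _ _) fun s _ => hK s)

/-- The mixed second difference of a pair potential dominated by the self-action. -/
lemma abs_second_difference_le {F g : ℝ → ℝ} {c : ℝ} (hF : ContDiff ℝ 2 F) (hg : ContDiff ℝ 2 g)
    (hc : ∀ x y, |deriv (deriv g) (x - y)|
      ≤ c * (√(deriv (deriv F) x) * √(deriv (deriv F) y))) (x x' y y' : ℝ) :
    |(g (x - y) - g (x - y')) - (g (x' - y) - g (x' - y'))|
      ≤ c * |psi F y - psi F y'| * |psi F x - psi F x'| := by
  have hd := differentiable_of_contDiff_two hg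
  have hd' := differentiable_deriv hg
  have hcont' := hd'.continuous
  have hcont'' := continuous_deriv_deriv hg
  refine abs_sub_le_mul_abs_psi_sub (h := fun a => g (a - y) - g (a - y'))
    (h' := fun a => deriv g (a - y) - deriv g (a - y')) hF (fun a => ?_) (by fun_prop)
    (fun a => ?_) x x'
  · exact ((hd (a - y)).hasDerivAt.comp_sub_const a y).sub
      ((hd (a - y')).hasDerivAt.comp_sub_const a y')
  · have := abs_sub_le_mul_abs_psi_sub (h := fun b => deriv g (a - b))
      (h' := fun b => -deriv (deriv g) (a - b)) (K := c * √(deriv (deriv F) a)) hF (fun b => ?_)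
      (by fun_prop) (fun b => ?_) y y'
    · linarith
    · exact (hd' (a - b)).hasDerivAt.comp_const_sub a b
    · rw [abs_neg, mul_assoc]
      exact hc a b

/-- The mean of `g` in the one-dimensional Gibbs measure with potential `V`. -/
noncomputable def gibbsMean (V g : ℝ → ℝ) : ℝ :=
  (∫ x, g x * Real.exp (-V x)) / ∫ x, Real.exp (-V x)

lemma integral_tilted_eq_gibbsMean (V g : ℝ → ℝ) :
    ∫ x, g x ∂(volume.tilted fun x => -V x) = gibbsMean V g := by
  rw [integral_tilted, gibbsMean, ← integral_div]
  refine integral_congr_ae (Eventually.of_forall fun x => ?_)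
  simp only [smul_eq_mul]
  ring

/-- Convex combinations of uniformly convex potentials, written as an interpolation from `A` to
`B`. -/
lemma UniformlyConvex.convexCombination {A B : ℝ → ℝ} {ε : ℝ} (hA : UniformlyConvex A ε)
    (hB : UniformlyConvex B ε) {θ : ℝ} (hθ : θ ∈ Set.Icc (0 : ℝ) 1) :
    (∀ x, deriv (deriv fun x => A x - θ * (A x - B x)) x
      = (1 - θ) * deriv (deriv A) x + θ * deriv (deriv B) x) ∧
    UniformlyConvex (fun x => A x - θ * (A x - B x)) ε := by
  have hdA := differentiable_of_contDiff_two hA.contDiff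
  have hdB := differentiable_of_contDiff_two hB.contDiff
  have hdA' := differentiable_deriv hA.contDiff
  have hdB' := differentiable_deriv hB.contDiff
  have e1 : deriv (fun x => A x - θ * (A x - B x))
      = fun x => (1 - θ) * deriv A x + θ * deriv B x := by
    funext x
    have := ((hdA x).hasDerivAt.sub (((hdA x).hasDerivAt.sub (hdB x).hasDerivAt).const_mul θ)).deriv
    refine Eq.trans ?_ (this.trans (by ring))
    rfl
  have e2 : ∀ x, deriv (deriv fun x => A x - θ * (A x - B x)) x
      = (1 - θ) * deriv (deriv A) x + θ * deriv (deriv B) x := by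
    intro x
    rw [e1]
    exact (((hdA' x).hasDerivAt.const_mul (1 - θ)).add ((hdB' x).hasDerivAt.const_mul θ)).deriv
  refine ⟨e2, hA.contDiff.sub (contDiff_const.mul (hA.contDiff.sub hB.contDiff)), hA.eps_pos,
    fun x => ?_⟩
  rw [e2]
  nlinarith [hA.convex x, hB.convex x, hθ.1, hθ.2]

/-- The covariance bound for a one-dimensional Gibbs measure at least as convex as `exp (-F)`. -/
lemma abs_gibbsMean_covariance_le {F V g W : ℝ → ℝ} {ε δ κ : ℝ} (hF : UniformlyConvex F ε)
    (hV : UniformlyConvex V ε) (hFV : ∀ x, deriv (deriv F) x ≤ deriv (deriv V) x)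
    (hg : Continuous g) (hW : Continuous W) (hδ : 0 ≤ δ) (hκ : 0 ≤ κ)
    (hgδ : ∀ x y, |g x - g y| ≤ δ * |psi F x - psi F y|)
    (hWκ : ∀ x y, |W x - W y| ≤ κ * |psi F x - psi F y|) :
    |gibbsMean V (fun x => g x * W x) - gibbsMean V g * gibbsMean V W| ≤ δ * κ := by
  obtain ⟨m, hm⟩ := hV.exists_deriv_eq_zero
  have hint := hV.integrable_exp_neg
  have := isProbabilityMeasure_tilted (μ := (volume : Measure ℝ)) hint
  simp_rw [← integral_tilted_eq_gibbsMean]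
  refine abs_covariance_le_of_lipschitz _ hg.measurable hW.measurable
    (continuous_psi hF.contDiff).measurable m hδ hκ (fun x => hgδ x m) (fun x => hWκ x m) ?_
  have hZ : 0 < ∫ x, Real.exp (-V x) := integral_exp_pos hint
  rw [lintegral_tilted]
  calc ∫⁻ x, ENNReal.ofReal (Real.exp (-V x) / ∫ x, Real.exp (-V x))
        * ENNReal.ofReal ((psi F x - psi F m) ^ 2)
      = ∫⁻ x, ENNReal.ofReal ((psi F x - psi F m) ^ 2 * Real.exp (-V x))
          * (ENNReal.ofReal (∫ x, Real.exp (-V x)))⁻¹ := by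
        refine lintegral_congr fun x => ?_
        rw [ENNReal.ofReal_div_of_pos hZ, ENNReal.ofReal_mul (sq_nonneg _), div_eq_mul_inv]
        ring
    _ = (∫⁻ x, ENNReal.ofReal ((psi F x - psi F m) ^ 2 * Real.exp (-V x)))
          * (ENNReal.ofReal (∫ x, Real.exp (-V x)))⁻¹ := by
        refine lintegral_mul_const _ (Continuous.measurable ?_).ennreal_ofReal
        have h1 := continuous_psi hF.contDiff
        have h2 := hV.contDiff.continuous
        fun_prop
    _ ≤ ENNReal.ofReal (∫ x, Real.exp (-V x)) * (ENNReal.ofReal (∫ x, Real.exp (-V x)))⁻¹ :=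
        mul_le_mul_left (lintegral_psi_sub_sq_le hF hV hFV hm) _
    _ = 1 := ENNReal.mul_inv_cancel (by simpa using hZ) ENNReal.ofReal_ne_top

/-- Dependence of a one-dimensional Gibbs measure on its potential: if the difference `A - B` of
two potentials is Lipschitz in the metric `ρ`, then the means of a Lipschitz function differ by at
most the product of the Lipschitz constants. The derivative of the mean along the segment from `A`
to `B` is a covariance; it is only needed in the open segment, where no growth condition on
`A - B` is required. -/
lemma abs_gibbsMean_sub_le {F A B g : ℝ → ℝ} {ε δ κ C : ℝ} (hF : UniformlyConvex F ε)
    (hA : UniformlyConvex A ε) (hB : UniformlyConvex B ε)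
    (hFA : ∀ x, deriv (deriv F) x ≤ deriv (deriv A) x)
    (hFB : ∀ x, deriv (deriv F) x ≤ deriv (deriv B) x)
    (hg : Continuous g) (hgC : ∀ x, |g x| ≤ C) (hδ : 0 ≤ δ) (hκ : 0 ≤ κ)
    (hgδ : ∀ x y, |g x - g y| ≤ δ * |psi F x - psi F y|)
    (hκ' : ∀ x y, |(A x - B x) - (A y - B y)| ≤ κ * |psi F x - psi F y|) :
    |gibbsMean B g - gibbsMean A g| ≤ δ * κ := by
  have hcA := hA.contDiff.continuous
  have hcB := hB.contDiff.continuous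
  have hC0 : 0 ≤ C := (abs_nonneg _).trans (hgC 0)
  set W : ℝ → ℝ := fun x => A x - B x
  have hW : Continuous W := hcA.sub hcB
  set V : ℝ → ℝ → ℝ := fun θ x => A x - θ * W x
  have hVc : ∀ θ, Continuous (V θ) := fun θ => hcA.sub (continuous_const.mul hW)
  have hV : ∀ θ ∈ Set.Icc (0 : ℝ) 1, UniformlyConvex (V θ) ε := fun θ hθ =>
    (hA.convexCombination hB hθ).2
  have hFV : ∀ θ ∈ Set.Icc (0 : ℝ) 1, ∀ x, deriv (deriv F) x ≤ deriv (deriv (V θ)) x := by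
    intro θ hθ x
    have h1 := (hA.convexCombination hB hθ).1 x
    change _ ≤ deriv (deriv fun x => A x - θ * (A x - B x)) x
    rw [h1]
    nlinarith [hFA x, hFB x, hθ.1, hθ.2]
  set E : ℝ → ℝ := fun x => Real.exp (-A x) + Real.exp (-B x)
  have hEint : Integrable E := hA.integrable_exp_neg.add hB.integrable_exp_neg
  have hVE : ∀ θ ∈ Set.Icc (0 : ℝ) 1, ∀ x, Real.exp (-V θ x) ≤ E x := by
    intro θ hθ x
    rcases le_total (A x) (B x) with h | h
    · have : Real.exp (-V θ x) ≤ Real.exp (-A x) := Real.exp_le_exp.2 (by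
        simp only [V, W]; nlinarith [hθ.1])
      have := Real.exp_pos (-B x)
      simp only [E]; linarith
    · have : Real.exp (-V θ x) ≤ Real.exp (-B x) := Real.exp_le_exp.2 (by
        simp only [V, W]; nlinarith [hθ.2])
      have := Real.exp_pos (-A x)
      simp only [E]; linarith
  -- for a bounded function `u`, the integrals below are continuous in `θ` on the closed interval
  -- and differentiable in the open one
  have hcont : ∀ u : ℝ → ℝ, Continuous u → ∀ K : ℝ, (∀ x, |u x| ≤ K) →
      ContinuousOn (fun θ => ∫ x, u x * Real.exp (-V θ x)) (Set.Icc 0 1) := by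
    intro u hu K hK
    refine continuousOn_of_dominated (bound := fun x => K * E x) (fun θ _ => ?_) (fun θ hθ => ?_)
      (hEint.const_mul K) (Eventually.of_forall fun x => ?_)
    · exact (hu.mul (Real.continuous_exp.comp (hVc θ).neg)).aestronglyMeasurable
    · refine Eventually.of_forall fun x => ?_
      rw [norm_mul, Real.norm_of_nonneg (Real.exp_pos _).le]
      exact mul_le_mul (hK x) (hVE θ hθ x) (Real.exp_pos _).le ((abs_nonneg _).trans (hK x))
    · simp only [V]
      fun_prop
  have hderiv : ∀ u : ℝ → ℝ, Continuous u → ∀ K : ℝ, (∀ x, |u x| ≤ K) → ∀ θ ∈ Set.Ioo (0 : ℝ) 1,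
      HasDerivAt (fun θ => ∫ x, u x * Real.exp (-V θ x))
        (∫ x, u x * W x * Real.exp (-V θ x)) θ := by
    intro u hu K hK θ hθ
    set η := min θ (1 - θ) / 2
    have hη : 0 < η := half_pos (lt_min hθ.1 (sub_pos.2 hθ.2))
    have hη1 : 2 * η ≤ θ := by simp only [η]; linarith [min_le_left θ (1 - θ)]
    have hη2 : 2 * η ≤ 1 - θ := by simp only [η]; linarith [min_le_right θ (1 - θ)]
    refine (hasDerivAt_integral_of_dominated_loc_of_deriv_le (μ := volume)
      (F := fun θ x => u x * Real.exp (-V θ x))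
      (F' := fun θ x => u x * W x * Real.exp (-V θ x)) (Metric.ball_mem_nhds θ hη)
      (bound := fun x => K * (2 / η * E x)) ?_ ?_ ?_ ?_ ?_ ?_).2
    · exact Eventually.of_forall fun θ =>
        (hu.mul (Real.continuous_exp.comp (hVc θ).neg)).aestronglyMeasurable
    · refine (hEint.const_mul K).mono'
        (hu.mul (Real.continuous_exp.comp (hVc θ).neg)).aestronglyMeasurable
        (Eventually.of_forall fun x => ?_)
      rw [norm_mul, Real.norm_of_nonneg (Real.exp_pos _).le]
      exact mul_le_mul (hK x) (hVE θ (Set.Ioo_subset_Icc_self hθ) x) (Real.exp_pos _).le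
        ((abs_nonneg _).trans (hK x))
    · exact ((hu.mul hW).mul (Real.continuous_exp.comp (hVc θ).neg)).aestronglyMeasurable
    · refine Eventually.of_forall fun x θ' hθ' => ?_
      rw [Metric.mem_ball, Real.dist_eq, abs_lt] at hθ'
      rw [norm_mul, norm_mul, Real.norm_of_nonneg (Real.exp_pos _).le, mul_assoc]
      refine mul_le_mul (hK x) ?_ (by positivity) ((abs_nonneg _).trans (hK x))
      -- `η |W| ≤ exp (η W) + exp (-η W)`, which shifts the parameter by `± η`
      have h1 : η * |W x| ≤ Real.exp (η * W x) + Real.exp (-(η * W x)) := by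
        rw [← abs_of_pos hη, ← abs_mul, abs_of_pos hη]
        have e1 := Real.add_one_le_exp (η * W x)
        have e2 := Real.add_one_le_exp (-(η * W x))
        have e3 := Real.exp_pos (η * W x)
        have e4 := Real.exp_pos (-(η * W x))
        exact abs_le.2 ⟨by linarith, by linarith⟩
      have h2 : Real.exp (η * W x) * Real.exp (-V θ' x) = Real.exp (-V (θ' + η) x) := by
        rw [← Real.exp_add]; simp only [V]; ring_nf
      have h3 : Real.exp (-(η * W x)) * Real.exp (-V θ' x) = Real.exp (-V (θ' - η) x) := by
        rw [← Real.exp_add]; simp only [V]; ring_nf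
      have h4 := hVE (θ' + η) ⟨by linarith, by linarith⟩ x
      have h5 := hVE (θ' - η) ⟨by linarith, by linarith⟩ x
      have h6 := mul_le_mul_of_nonneg_right h1 (Real.exp_pos (-V θ' x)).le
      rw [add_mul, h2, h3] at h6
      rw [div_mul_eq_mul_div, le_div_iff₀ hη, Real.norm_eq_abs]
      linarith
    · exact (hEint.const_mul _).const_mul K
    · refine Eventually.of_forall fun x θ' _ => ?_
      have h1 : HasDerivAt (fun θ => -V θ x) (W x) θ' := by
        have := (((hasDerivAt_id θ').mul_const (W x)).const_sub (A x)).neg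
        convert! this using 1
        simp
      have := (h1.exp).const_mul (u x)
      convert! this using 1
      ring
  have hone : ∀ θ, ∫ x, Real.exp (-V θ x) = ∫ x, (1 : ℝ) * Real.exp (-V θ x) := by simp
  have hZpos : ∀ θ ∈ Set.Icc (0 : ℝ) 1, 0 < ∫ x, (1 : ℝ) * Real.exp (-V θ x) := fun θ hθ => by
    rw [← hone]; exact integral_exp_pos (hV θ hθ).integrable_exp_neg
  set r : ℝ → ℝ := fun θ => (∫ x, g x * Real.exp (-V θ x)) / ∫ x, (1 : ℝ) * Real.exp (-V θ x)
  have hr : ∀ θ, r θ = gibbsMean (V θ) g := fun θ => by simp only [r, gibbsMean, hone]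
  have hrc : ContinuousOn r (Set.Icc 0 1) :=
    (hcont g hg C hgC).div (hcont (fun _ => 1) continuous_const 1 (by simp))
      fun θ hθ => (hZpos θ hθ).ne'
  set r' : ℝ → ℝ := fun θ =>
    gibbsMean (V θ) (fun x => g x * W x) - gibbsMean (V θ) g * gibbsMean (V θ) W
  have hrd : ∀ θ ∈ Set.Ioo (0 : ℝ) 1, HasDerivAt r (r' θ) θ := by
    intro θ hθ
    have hne := (hZpos θ (Set.Ioo_subset_Icc_self hθ)).ne'
    have h1 := (hderiv g hg C hgC θ hθ).fun_div
      (hderiv (fun _ => 1) continuous_const 1 (by simp) θ hθ) hne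
    convert! h1 using 1
    simp only [r', gibbsMean, hone, one_mul]
    simp only [one_mul] at hne
    field_simp
  obtain ⟨θ, hθ, hslope⟩ := exists_hasDerivAt_eq_slope r r' one_pos hrc hrd
  have e0 : V 0 = A := by funext x; simp [V]
  have e1 : V 1 = B := by funext x; simp [V, W]
  rw [sub_zero, div_one, hr, hr, e0, e1] at hslope
  rw [← hslope]
  have hθ' := Set.Ioo_subset_Icc_self hθ
  exact abs_gibbsMean_covariance_le hF (hV θ hθ') (hFV θ hθ') hg hW hδ hκ hgδ hκ'

end LatticeGibbs

/-! ### Dobrushin uniqueness -/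

namespace LatticeGibbs

open Function Filter Topology
open scoped NNReal

variable {d : ℕ}

/-- The potential seen by the spin at `i` when the other spins are frozen to `y`. The finite set `B`
has to contain the interaction range of `i`. -/
noncomputable def siteEnergy (F : ℝ → ℝ) (G : Lattice d → ℝ → ℝ) (lam : ℝ)
    (B : Finset (Lattice d)) (i : Lattice d) (y : Config d) (t : ℝ) : ℝ :=
  F t + lam * ∑ j ∈ B.erase i, G (i - j) (t - y j)

/-- The influence coefficient `λ c_k` bounding the dependence of the spin at `i` on the spin at
`i - k`. -/
noncomputable def influence (F : ℝ → ℝ) (G : Lattice d → ℝ → ℝ) (lam : ℝ) (k : Lattice d) : ℝ≥0 :=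
  if k = 0 then 0 else lam.toNNReal * (coupling F G k).toNNReal

lemma tsum_influence {F : ℝ → ℝ} {G : Lattice d → ℝ → ℝ} {lam : ℝ}
    (hc : ∀ k, k ≠ 0 → coupling F G k < ∞) :
    ∑' k, (influence F G lam k : ℝ≥0∞)
      = ENNReal.ofReal lam * ∑' k : {k : Lattice d // k ≠ 0}, coupling F G k := by
  rw [← ENNReal.tsum_mul_left]
  rw [← tsum_subtype_eq_of_support_subset (s := {k : Lattice d | k ≠ 0}) fun k hk => ?_]
  · refine tsum_congr fun k => ?_
    have hk : (k : Lattice d) ≠ 0 := k.2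
    rw [influence, if_neg hk, ENNReal.coe_mul, ENNReal.coe_toNNReal (hc k hk).ne]
    rfl
  · rintro rfl
    simp [influence] at hk

/-- Finiteness of the coupling matters here: the real value of an infinite one is `0`. -/
lemma abs_deriv2_le_coupling {F : ℝ → ℝ} {G : Lattice d → ℝ → ℝ} {ε : ℝ}
    (hF : UniformlyConvex F ε) {k : Lattice d} (hc : coupling F G k < ∞) (x y : ℝ) :
    |deriv (deriv (G k)) (x - y)| ≤ (coupling F G k).toReal
      * (√(deriv (deriv F) x) * √(deriv (deriv F) y)) := by
  have hpos : ∀ x, 0 < √(deriv (deriv F) x) := fun x =>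
    Real.sqrt_pos.2 (hF.eps_pos.trans_le (hF.convex x))
  have h1 : ENNReal.ofReal (|deriv (deriv (G k)) (x - y)|
      / (√(deriv (deriv F) x) * √(deriv (deriv F) y))) ≤ coupling F G k :=
    le_iSup_of_le x (le_iSup_of_le y le_rfl)
  rw [ENNReal.ofReal_le_iff_le_toReal hc.ne] at h1
  exact (div_le_iff₀ (mul_pos (hpos x) (hpos y))).1 h1

lemma abs_gibbsMean_sub_le_of_abs_sub_le {V u v : ℝ → ℝ} {ε C K : ℝ} (hV : UniformlyConvex V ε)
    (hu : Continuous u) (hv : Continuous v) (huC : ∀ x, |u x| ≤ C) (hvC : ∀ x, |v x| ≤ C)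
    (h : ∀ x, |u x - v x| ≤ K) : |gibbsMean V u - gibbsMean V v| ≤ K := by
  have := isProbabilityMeasure_tilted (μ := (volume : Measure ℝ)) hV.integrable_exp_neg
  rw [← integral_tilted_eq_gibbsMean, ← integral_tilted_eq_gibbsMean, ← integral_sub]
  · exact Model.abs_integral_le_of_bounded _ h
  · exact Integrable.of_bound hu.aestronglyMeasurable C (Eventually.of_forall huC)
  · exact Integrable.of_bound hv.aestronglyMeasurable C (Eventually.of_forall hvC)

lemma glue_singleton (i : Lattice d) (y : Config d) (x : ({i} : Finset (Lattice d)) → ℝ) :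
    glue {i} y x = update y i (x default) := by
  funext k
  by_cases hk : k = i
  · subst hk
    rw [glue_of_mem _ _ (Finset.mem_singleton_self k), update_self]
    rfl
  · rw [glue_of_notMem _ _ (by simpa using hk), update_of_ne hk]

lemma integral_glue_singleton (i : Lattice d) (y : Config d) (φ : Config d → ℝ) :
    ∫ x : ({i} : Finset (Lattice d)) → ℝ, φ (glue {i} y x) = ∫ t : ℝ, φ (update y i t) := by
  simp_rw [glue_singleton]
  exact (volume_preserving_funUnique ({i} : Finset (Lattice d)) ℝ).integral_comp'
    (fun t => φ (update y i t))

/-- The oscillations of `f` in the metric `ρ`: changing the spin at `k` changes `f` by at most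
`δ k` times the distance. -/
def HasOscillation (F : ℝ → ℝ) (f : Config d → ℝ) (δ : Lattice d → ℝ≥0) : Prop :=
  ∀ x k t, |f (update x k t) - f x| ≤ δ k * |psi F t - psi F (x k)|

namespace Model

variable {F : ℝ → ℝ} {G : Lattice d → ℝ → ℝ} {ε r₀ lam : ℝ}

lemma energy_update_singleton (M : Model F G ε r₀ lam) {i : Lattice d} {B : Finset (Lattice d)}
    (hB : collar r₀ {i} ⊆ B) (y : Config d) (t : ℝ) :
    energy F G lam {i} (update y i t) = siteEnergy F G lam B i y t := by
  have h1 : ∑ᶠ j ∈ (({i} : Finset (Lattice d)) : Set (Lattice d))ᶜ,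
      G (i - j) (update y i t i - update y i t j) = ∑ j ∈ B.erase i, G (i - j) (t - y j) := by
    rw [finsum_mem_eq_sum_of_inter_support_eq (t := B.erase i)]
    · refine Finset.sum_congr rfl fun j hj => ?_
      rw [update_self, update_of_ne (Finset.ne_of_mem_erase hj)]
    · ext j
      simp only [Finset.coe_singleton, Set.mem_inter_iff, Set.mem_compl_iff,
        Set.mem_singleton_iff, mem_support, Finset.coe_erase, Set.mem_sdiff, Finset.mem_coe]
      refine ⟨fun ⟨a, b⟩ => ⟨⟨?_, a⟩, b⟩, fun ⟨a, b⟩ => ⟨a.2, b⟩⟩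
      by_contra hj
      refine b (M.condB.finiteRange _ (sub_ne_zero.2 (Ne.symm a)) ?_ _)
      by_contra hle
      exact hj (hB (mem_collar_of_norm_le (Finset.mem_singleton_self i) (not_lt.1 hle)))
  rw [energy, interaction, siteEnergy, Finset.sum_singleton, Finset.sum_singleton,
    Finset.sum_singleton, h1]
  simp [add_comm]

lemma condMean_singleton (M : Model F G ε r₀ lam) {i : Lattice d} {B : Finset (Lattice d)}
    (hB : collar r₀ {i} ⊆ B) (f : Config d → ℝ) (y : Config d) :
    condMean F G lam {i} f y
      = gibbsMean (siteEnergy F G lam B i y) fun t => f (update y i t) := by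
  rw [condMean, partitionFn, integral_glue_singleton i y (weight F G lam {i}),
    integral_glue_singleton i y (fun z => f z * weight F G lam {i} z), gibbsMean, div_eq_inv_mul]
  simp only [weight_eq_exp, M.energy_update_singleton hB]

lemma siteEnergy_convex (M : Model F G ε r₀ lam) (B : Finset (Lattice d)) (i : Lattice d)
    (y : Config d) : UniformlyConvex (siteEnergy F G lam B i y) ε ∧
      ∀ t, deriv (deriv F) t ≤ deriv (deriv (siteEnergy F G lam B i y)) t := by
  have hF := M.condA.uniformlyConvex
  have hne : ∀ j ∈ B.erase i, i - j ≠ 0 := fun j hj =>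
    sub_ne_zero.2 (Finset.ne_of_mem_erase hj).symm
  have hcd : ContDiff ℝ 2 (siteEnergy F G lam B i y) := by
    refine hF.contDiff.add (contDiff_const.mul (ContDiff.sum fun j hj => ?_))
    exact (M.condB.contDiff _ (hne j hj)).comp (contDiff_id.sub contDiff_const)
  have hle : ∀ t, deriv (deriv F) t ≤ deriv (deriv (siteEnergy F G lam B i y)) t := by
    intro t
    have e1 : deriv (siteEnergy F G lam B i y)
        = fun t => deriv F t + lam * ∑ j ∈ B.erase i, deriv (G (i - j)) (t - y j) := by
      funext t
      refine HasDerivAt.deriv (((differentiable_of_contDiff_two hF.contDiff t).hasDerivAt).add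
        (HasDerivAt.const_mul _ (HasDerivAt.fun_sum fun j hj => ?_)))
      exact (differentiable_of_contDiff_two (M.condB.contDiff _ (hne j hj))
        (t - y j)).hasDerivAt.comp_sub_const t (y j)
    have e2 : deriv (deriv (siteEnergy F G lam B i y)) t = deriv (deriv F) t
        + lam * ∑ j ∈ B.erase i, deriv (deriv (G (i - j))) (t - y j) := by
      rw [e1]
      refine HasDerivAt.deriv (((differentiable_deriv hF.contDiff t).hasDerivAt).add
        (HasDerivAt.const_mul _ (HasDerivAt.fun_sum fun j hj => ?_)))
      exact (differentiable_deriv (M.condB.contDiff _ (hne j hj))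
        (t - y j)).hasDerivAt.comp_sub_const t (y j)
    rw [e2]
    have := mul_nonneg M.lam_nonneg (Finset.sum_nonneg fun j hj =>
      M.condB.convex _ (hne j hj) (t - y j))
    linarith
  exact ⟨⟨hcd, hF.eps_pos, fun t => (hF.convex t).trans (hle t)⟩, hle⟩

lemma isBddCylinder_condMean (M : Model F G ε r₀ lam) (Λ : Finset (Lattice d))
    {f : Config d → ℝ} (hf : IsBddCylinder f) : IsBddCylinder (condMean F G lam Λ f) := by
  obtain ⟨C, hC⟩ := hf.bounded
  obtain ⟨Δ, hΔ⟩ := hf.cylinder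
  refine ⟨M.continuous_condMean Λ hf.continuous hC, ⟨C, M.abs_condMean_le Λ hf.continuous hC⟩,
    Δ ∪ collar r₀ Λ, fun y y' hyy' => ?_⟩
  have hglue : ∀ (x : Λ → ℝ) k, k ∈ Δ ∪ collar r₀ Λ → glue Λ y x k = glue Λ y' x k := by
    intro x k hk
    by_cases hkΛ : k ∈ Λ
    · rw [glue_of_mem _ _ hkΛ, glue_of_mem _ _ hkΛ]
    · rw [glue_of_notMem _ _ hkΛ, glue_of_notMem _ _ hkΛ]
      exact hyy' k hk
  have h1 : ∀ x : Λ → ℝ, f (glue Λ y x) = f (glue Λ y' x) := fun x =>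
    hΔ fun k hk => hglue x k (Finset.mem_union_left _ hk)
  have h2 : ∀ x : Λ → ℝ, weight F G lam Λ (glue Λ y x) = weight F G lam Λ (glue Λ y' x) := by
    intro x
    rw [weight_eq_exp, weight_eq_exp, M.dependsOn_energy Λ fun k hk =>
      hglue x k (Finset.mem_union_right _ hk)]
  simp only [condMean, partitionFn, h1, h2]

/-- Dobrushin's estimate: averaging over the spin at `i` removes the oscillation at `i` and
distributes it over the other sites according to the influence coefficients. -/
lemma hasOscillation_condMean_singleton (M : Model F G ε r₀ lam)
    (hc : ∀ k, k ≠ 0 → coupling F G k < ∞) (i : Lattice d) {f : Config d → ℝ}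
    (hf : IsBddCylinder f) {δ : Lattice d → ℝ≥0} (hδ : HasOscillation F f δ) :
    HasOscillation F (condMean F G lam {i} f)
      fun k => if k = i then 0 else δ k + δ i * influence F G lam (i - k) := by
  intro y k t
  obtain ⟨C, hC⟩ := hf.bounded
  have hF := M.condA.uniformlyConvex
  by_cases hki : k = i
  · subst hki
    have : condMean F G lam {k} f (update y k t) = condMean F G lam {k} f y := by
      rw [M.condMean_singleton subset_rfl, M.condMean_singleton subset_rfl]
      have h1 : siteEnergy F G lam (collar r₀ {k}) k (update y k t)
          = siteEnergy F G lam (collar r₀ {k}) k y := by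
        funext s
        rw [siteEnergy, siteEnergy]
        congr 2
        exact Finset.sum_congr rfl fun j hj => by rw [update_of_ne (Finset.ne_of_mem_erase hj)]
      simp only [h1, update_idem]
    simp [this]
  have hik : i - k ≠ 0 := sub_ne_zero.2 (Ne.symm hki)
  set B := insert k (collar r₀ {i})
  have hB : collar r₀ {i} ⊆ B := Finset.subset_insert _ _
  have hkB : k ∈ B.erase i := Finset.mem_erase.2 ⟨hki, Finset.mem_insert_self _ _⟩
  set y' := update y k t
  set u : ℝ → ℝ := fun s => f (update y i s)
  set v : ℝ → ℝ := fun s => f (update y' i s)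
  have hu : Continuous u := hf.continuous.comp (continuous_const.update i continuous_id)
  have hv : Continuous v := hf.continuous.comp (continuous_const.update i continuous_id)
  obtain ⟨hA, hFA⟩ := M.siteEnergy_convex B i y
  obtain ⟨hA', hFA'⟩ := M.siteEnergy_convex B i y'
  have h1 : |gibbsMean (siteEnergy F G lam B i y') v - gibbsMean (siteEnergy F G lam B i y') u|
      ≤ δ k * |psi F t - psi F (y k)| := by
    refine abs_gibbsMean_sub_le_of_abs_sub_le hA' hv hu (fun _ => hC _) (fun _ => hC _)
      fun s => ?_
    have h2 := hδ (update y i s) k t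
    rw [update_of_ne hki, update_comm (Ne.symm hki)] at h2
    exact h2
  have hdiff : ∀ s, siteEnergy F G lam B i y s - siteEnergy F G lam B i y' s
      = lam * (G (i - k) (s - y k) - G (i - k) (s - t)) := by
    intro s
    rw [siteEnergy, siteEnergy, ← Finset.add_sum_erase _ _ hkB, ← Finset.add_sum_erase _ _ hkB]
    have : ∑ j ∈ (B.erase i).erase k, G (i - j) (s - y' j)
        = ∑ j ∈ (B.erase i).erase k, G (i - j) (s - y j) :=
      Finset.sum_congr rfl fun j hj => by
        simp only [y']; rw [update_of_ne (Finset.ne_of_mem_erase hj)]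
    rw [this]
    simp only [y', update_self]
    ring
  have h2 : |gibbsMean (siteEnergy F G lam B i y') u - gibbsMean (siteEnergy F G lam B i y) u|
      ≤ δ i * (lam * (coupling F G (i - k)).toReal * |psi F t - psi F (y k)|) := by
    refine abs_gibbsMean_sub_le hF hA hA' hFA hFA' hu (fun _ => hC _) (δ i).2
      (mul_nonneg (mul_nonneg M.lam_nonneg ENNReal.toReal_nonneg) (abs_nonneg _))
      (fun a b => ?_) (fun a b => ?_)
    · have := hδ (update y i b) i a
      rw [update_idem, update_self] at this
      exact this
    · rw [hdiff, hdiff, ← mul_sub, abs_mul, abs_of_nonneg M.lam_nonneg, mul_assoc lam,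
        mul_assoc lam]
      refine mul_le_mul_of_nonneg_left ?_ M.lam_nonneg
      rw [abs_sub_comm (psi F t)]
      exact abs_second_difference_le hF.contDiff (M.condB.contDiff _ hik)
        (abs_deriv2_le_coupling hF (hc _ hik)) a b (y k) t
  beta_reduce
  rw [M.condMean_singleton hB, M.condMean_singleton hB, if_neg hki, influence, if_neg hik]
  -- change the observable and the measure one after the other
  refine (abs_sub_le _ (gibbsMean (siteEnergy F G lam B i y') u) _).trans
    ((add_le_add h1 h2).trans_eq ?_)
  push_cast
  rw [Real.coe_toNNReal _ M.lam_nonneg]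
  ring

/-- Averaging once over each spin of a finite set `T` replaces the oscillations in `T` by a
remainder whose total is at most `q` times the total oscillation in `T`, where `q ≤ 1` bounds the
total influence of a site. -/
lemma exists_sweep (M : Model F G ε r₀ lam) (hc : ∀ k, k ≠ 0 → coupling F G k < ∞) {q : ℝ≥0∞}
    (hq : ∑' k, (influence F G lam k : ℝ≥0∞) ≤ q) (hq1 : q ≤ 1) {f : Config d → ℝ}
    (hf : IsBddCylinder f) {δ : Lattice d → ℝ≥0} (hδ : HasOscillation F f δ)
    (T : Finset (Lattice d)) :
    ∃ g : Config d → ℝ, IsBddCylinder g ∧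
      (∀ μ, IsGibbs F G lam μ → ∫ x, g x ∂μ = ∫ x, f x ∂μ) ∧
      ∃ r : Lattice d → ℝ≥0, HasOscillation F g (fun k => (if k ∈ T then 0 else δ k) + r k) ∧
        ∑' k, (r k : ℝ≥0∞) ≤ q * ∑ k ∈ T, (δ k : ℝ≥0∞) := by
  induction T using Finset.induction with
  | empty => exact ⟨f, hf, fun _ _ => rfl, 0, by simpa using hδ, by simp⟩
  | insert i T hi ih =>
    obtain ⟨g, hg, hgμ, r, hr, hsum⟩ := ih
    refine ⟨condMean F G lam {i} g, M.isBddCylinder_condMean {i} hg,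
      fun μ hμ => (hμ.dlr {i} g hg).trans (hgμ μ hμ),
      fun k => if k = i then 0 else r k + (δ i + r i) * influence F G lam (i - k), ?_, ?_⟩
    · convert! M.hasOscillation_condMean_singleton hc i hg hr using 1
      funext k
      by_cases hk : k = i
      · simp [hk]
      · simp [hk, hi, add_assoc]
    · have h1 : ∑' k, (influence F G lam (i - k) : ℝ≥0∞) ≤ q :=
        ((Equiv.subLeft i).tsum_eq fun k => (influence F G lam k : ℝ≥0∞)).trans_le hq
      have h2 : ∑' k, (r k : ℝ≥0∞) = r i + ∑' k, if k = i then 0 else (r k : ℝ≥0∞) := by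
        rw [ENNReal.tsum_eq_add_tsum_ite i]
        congr!
      calc ∑' k, ((if k = i then 0 else r k + (δ i + r i) * influence F G lam (i - k) : ℝ≥0) :
            ℝ≥0∞)
          ≤ ∑' k, ((if k = i then 0 else (r k : ℝ≥0∞))
            + (δ i + r i) * influence F G lam (i - k)) := by
            refine ENNReal.tsum_le_tsum fun k => ?_
            split_ifs with hk
            · simp
            · push_cast; exact le_rfl
        _ = (∑' k, if k = i then 0 else (r k : ℝ≥0∞))
            + (δ i + r i) * ∑' k, (influence F G lam (i - k) : ℝ≥0∞) := by
            rw [ENNReal.tsum_add, ENNReal.tsum_mul_left]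
        _ ≤ (∑' k, if k = i then 0 else (r k : ℝ≥0∞)) + (δ i * q + r i * 1) := by
            rw [add_mul]
            gcongr
            exact h1.trans hq1
        _ = ∑' k, (r k : ℝ≥0∞) + q * δ i := by rw [h2]; ring
        _ ≤ q * ∑ k ∈ insert i T, (δ k : ℝ≥0∞) := by
            rw [Finset.sum_insert hi, mul_add, add_comm]
            gcongr

lemma HasOscillation.mono {f : Config d → ℝ} {δ δ' : Lattice d → ℝ≥0}
    (h : HasOscillation F f δ) (hle : ∀ k, δ k ≤ δ' k) : HasOscillation F f δ' := fun x k t =>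
  (h x k t).trans (mul_le_mul_of_nonneg_right (by exact_mod_cast hle k) (abs_nonneg _))

/-- A cylinder function has no oscillation outside its support. -/
lemma HasOscillation.indicator {f : Config d → ℝ} {δ : Lattice d → ℝ≥0}
    (h : HasOscillation F f δ) {Δ : Finset (Lattice d)}
    (hΔ : DependsOn f (Δ : Set (Lattice d))) :
    HasOscillation F f fun k => if k ∈ Δ then δ k else 0 := by
  intro x k t
  by_cases hk : k ∈ Δ
  · simpa [hk] using h x k t
  · have : f (update x k t) = f x := hΔ fun j hj => update_of_ne (by rintro rfl; exact hk hj) _ _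
    simp [this, hk]

/-- Contraction of the total oscillation, by sweeps over the finite support of the observable. -/
lemma exists_sum_oscillation_le (M : Model F G ε r₀ lam)
    (hc : ∀ k, k ≠ 0 → coupling F G k < ∞) {q : ℝ≥0∞}
    (hq : ∑' k, (influence F G lam k : ℝ≥0∞) ≤ q) (hq1 : q ≤ 1) {f : Config d → ℝ}
    (hf : IsBddCylinder f) {δ : Lattice d → ℝ≥0} (hδ : HasOscillation F f δ) (n : ℕ) :
    ∃ g : Config d → ℝ, IsBddCylinder g ∧
      (∀ μ, IsGibbs F G lam μ → ∫ x, g x ∂μ = ∫ x, f x ∂μ) ∧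
      ∃ r : Lattice d → ℝ≥0, HasOscillation F g r ∧
        ∑' k, (r k : ℝ≥0∞) ≤ q ^ n * ∑' k, (δ k : ℝ≥0∞) := by
  induction n with
  | zero => exact ⟨f, hf, fun _ _ => rfl, δ, hδ, by simp⟩
  | succ n ih =>
    obtain ⟨g, hg, hgμ, r, hr, hsum⟩ := ih
    obtain ⟨Δ, hΔ⟩ := hg.cylinder
    obtain ⟨g', hg', hgμ', r', hr', hsum'⟩ :=
      M.exists_sweep hc hq hq1 hg (HasOscillation.indicator hr hΔ) Δ
    refine ⟨g', hg', fun μ hμ => (hgμ' μ hμ).trans (hgμ μ hμ), r', ?_, ?_⟩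
    · refine HasOscillation.mono hr' fun k => ?_
      by_cases hk : k ∈ Δ <;> simp [hk]
    · calc ∑' k, (r' k : ℝ≥0∞) ≤ q * ∑ k ∈ Δ, ((if k ∈ Δ then r k else 0 : ℝ≥0) : ℝ≥0∞) := hsum'
        _ ≤ q * ∑' k, (r k : ℝ≥0∞) := by
            gcongr
            refine le_trans (Finset.sum_le_sum fun k hk => ?_) (ENNReal.sum_le_tsum Δ)
            simp [hk]
        _ ≤ q * (q ^ n * ∑' k, (δ k : ℝ≥0∞)) := by gcongr
        _ = q ^ (n + 1) * ∑' k, (δ k : ℝ≥0∞) := by rw [pow_succ]; ring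

/-- A function of finitely many coordinates varies at most by the sum of its oscillations. -/
lemma HasOscillation.abs_sub_le {f : Config d → ℝ} {δ : Lattice d → ℝ≥0}
    (h : HasOscillation F f δ) {Δ : Finset (Lattice d)}
    (hΔ : DependsOn f (Δ : Set (Lattice d))) (x y : Config d) :
    |f x - f y| ≤ ∑ k ∈ Δ, δ k * |psi F (x k) - psi F (y k)| := by
  classical
  have key : ∀ s : Finset (Lattice d), |f (s.piecewise x y) - f y|
      ≤ ∑ k ∈ s, δ k * |psi F (x k) - psi F (y k)| := by
    intro s
    induction s using Finset.induction with
    | empty => simp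
    | insert i s hi ih =>
      rw [Finset.piecewise_insert, Finset.sum_insert hi]
      refine (_root_.abs_sub_le _ (f (s.piecewise x y)) _).trans (add_le_add ?_ ih)
      have := h (s.piecewise x y) i (x i)
      rwa [Finset.piecewise_eq_of_notMem _ _ _ hi] at this
  have hx : f x = f (Δ.piecewise x y) :=
    hΔ fun k hk => (Finset.piecewise_eq_of_mem _ _ _ hk).symm
  rw [hx]
  exact key Δ

/-- Two probability measures whose coordinates have first moments at most `D` and `D'` in the
metric `ρ` differ on a cylinder function by at most `D + D'` times the total oscillation. -/
lemma HasOscillation.enorm_integral_sub_le {μ ν : Measure (Config d)} [IsProbabilityMeasure μ]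
    [IsProbabilityMeasure ν] {D D' : ℝ≥0∞} (hF : ContDiff ℝ 2 F)
    (hμ : ∀ k, ∫⁻ x, ENNReal.ofReal |psi F (x k)| ∂μ ≤ D)
    (hν : ∀ k, ∫⁻ x, ENNReal.ofReal |psi F (x k)| ∂ν ≤ D')
    {f : Config d → ℝ} (hf : IsBddCylinder f) {δ : Lattice d → ℝ≥0} (h : HasOscillation F f δ) :
    ‖(∫ x, f x ∂μ) - ∫ x, f x ∂ν‖ₑ ≤ (∑' k, (δ k : ℝ≥0∞)) * (D + D') := by
  obtain ⟨C, hC⟩ := hf.bounded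
  obtain ⟨Δ, hΔ⟩ := hf.cylinder
  have hi : ∀ (μ : Measure (Config d)) [IsProbabilityMeasure μ], Integrable f μ := fun μ _ =>
    Integrable.of_bound hf.continuous.aestronglyMeasurable C (Eventually.of_forall hC)
  have hψ : ∀ k : Lattice d, Measurable fun x : Config d => ENNReal.ofReal |psi F (x k)| :=
    fun k => ((continuous_psi hF).comp (continuous_apply k)).abs.measurable.ennreal_ofReal
  have h1 : (∫ x, f x ∂μ) - ∫ x, f x ∂ν = ∫ x, ∫ y, (f x - f y) ∂ν ∂μ := by
    have h2 : ∀ x, ∫ y, (f x - f y) ∂ν = f x - ∫ y, f y ∂ν := fun x => by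
      rw [integral_sub (integrable_const _) (hi ν)]; simp
    simp_rw [h2]
    rw [integral_sub (hi μ) (integrable_const _)]; simp
  rw [h1]
  calc ‖∫ x, ∫ y, (f x - f y) ∂ν ∂μ‖ₑ ≤ ∫⁻ x, ∫⁻ y, ‖f x - f y‖ₑ ∂ν ∂μ :=
        (enorm_integral_le_lintegral_enorm _).trans
          (lintegral_mono fun x => enorm_integral_le_lintegral_enorm _)
    _ ≤ ∫⁻ x, ∫⁻ y, ∑ k ∈ Δ, δ k * (ENNReal.ofReal |psi F (x k)|
          + ENNReal.ofReal |psi F (y k)|) ∂ν ∂μ := by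
        refine lintegral_mono fun x => lintegral_mono fun y => ?_
        rw [Real.enorm_eq_ofReal_abs]
        have h3 : |f x - f y| ≤ ∑ k ∈ Δ, δ k * (|psi F (x k)| + |psi F (y k)|) :=
          (HasOscillation.abs_sub_le h hΔ x y).trans (Finset.sum_le_sum fun k _ =>
            mul_le_mul_of_nonneg_left (abs_sub _ _) (δ k).2)
        refine (ENNReal.ofReal_le_ofReal h3).trans_eq ?_
        rw [ENNReal.ofReal_sum_of_nonneg fun k _ => by positivity]
        refine Finset.sum_congr rfl fun k _ => ?_
        rw [ENNReal.ofReal_mul (NNReal.coe_nonneg _),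
          ENNReal.ofReal_add (abs_nonneg _) (abs_nonneg _), ENNReal.ofReal_coe_nnreal]
    _ = ∑ k ∈ Δ, δ k * ((∫⁻ x, ENNReal.ofReal |psi F (x k)| ∂μ)
          + ∫⁻ y, ENNReal.ofReal |psi F (y k)| ∂ν) := by
        have h4 : ∀ x : Config d, ∫⁻ y, ∑ k ∈ Δ, δ k * (ENNReal.ofReal |psi F (x k)|
            + ENNReal.ofReal |psi F (y k)|) ∂ν = ∑ k ∈ Δ, δ k * (ENNReal.ofReal |psi F (x k)|
            + ∫⁻ y, ENNReal.ofReal |psi F (y k)| ∂ν) := by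
          intro x
          rw [lintegral_finsetSum _ fun k _ => by exact (measurable_const.add (hψ k)).const_mul _]
          refine Finset.sum_congr rfl fun k _ => ?_
          rw [lintegral_const_mul _ (by exact measurable_const.add (hψ k)),
            lintegral_add_left measurable_const]
          simp
        simp_rw [h4]
        rw [lintegral_finsetSum _ fun k _ => by exact ((hψ k).add_const _).const_mul _]
        refine Finset.sum_congr rfl fun k _ => ?_
        rw [lintegral_const_mul _ (by exact (hψ k).add_const _), lintegral_add_left (hψ k)]
        simp
    _ ≤ ∑ k ∈ Δ, (δ k : ℝ≥0∞) * (D + D') := by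
        gcongr with k _
        · exact hμ k
        · exact hν k
    _ ≤ (∑' k, (δ k : ℝ≥0∞)) * (D + D') := by
        rw [← Finset.sum_mul]
        gcongr
        exact ENNReal.sum_le_tsum Δ

/-- The first moments in the metric `ρ` are finite for a measure with finite `m_μ`. -/
lemma lintegral_abs_psi_le (μ : Measure (Config d)) [IsProbabilityMeasure μ] (k : Lattice d) :
    ∫⁻ x, ENNReal.ofReal |psi F (x k)| ∂μ ≤ 1 + secondMoment F μ := by
  calc ∫⁻ x, ENNReal.ofReal |psi F (x k)| ∂μ
      ≤ ∫⁻ x, (1 + ENNReal.ofReal (rho F (x k) 0 ^ 2)) ∂μ := by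
        refine lintegral_mono fun x => ?_
        rw [rho_zero_right, neg_sq, ← ENNReal.ofReal_one,
          ← ENNReal.ofReal_add zero_le_one (sq_nonneg _)]
        refine ENNReal.ofReal_le_ofReal ?_
        rw [← sq_abs]
        nlinarith [sq_nonneg (|psi F (x k)| - 1)]
    _ = 1 + ∫⁻ x, ENNReal.ofReal (rho F (x k) 0 ^ 2) ∂μ := by
        rw [lintegral_add_left measurable_const]; simp
    _ ≤ 1 + secondMoment F μ := by
        gcongr
        exact le_iSup (fun k => ∫⁻ x, ENNReal.ofReal (rho F (x k) 0 ^ 2) ∂μ) k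

/-- Bounded Lipschitz cylinder functions separate probability measures: they contain the
trigonometric functions of finitely many coordinates. -/
lemma measure_ext_of_hasOscillation {ε : ℝ} (hF : UniformlyConvex F ε)
    {μ ν : Measure (Config d)} [IsProbabilityMeasure μ] [IsProbabilityMeasure ν]
    (h : ∀ (f : Config d → ℝ) (δ : Lattice d → ℝ≥0), IsBddCylinder f → HasOscillation F f δ →
      ∑' k, (δ k : ℝ≥0∞) ≠ ∞ → ∫ x, f x ∂μ = ∫ x, f x ∂ν) : μ = ν := by
  classical
  have hproj : ∀ Δ : Finset (Lattice d), μ.map Δ.restrict = ν.map Δ.restrict := by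
    intro Δ
    have hres : Measurable (Δ.restrict : Config d → (Δ → ℝ)) := by fun_prop
    have i1 : IsProbabilityMeasure (μ.map Δ.restrict) :=
      Measure.isProbabilityMeasure_map hres.aemeasurable
    have i2 : IsProbabilityMeasure (ν.map Δ.restrict) :=
      Measure.isProbabilityMeasure_map hres.aemeasurable
    refine Measure.ext_of_charFunDual (funext fun L => ?_)
    have hsε := Real.sqrt_pos.2 hF.eps_pos
    have key : ∀ φ : ℝ → ℝ, LipschitzWith 1 φ → (∀ t, |φ t| ≤ 1) →
        ∫ x, φ (L (Δ.restrict x)) ∂μ = ∫ x, φ (L (Δ.restrict x)) ∂ν := by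
      intro φ hφ hφ1
      refine h _ (fun k => if k ∈ Δ then ‖L‖₊ * (Real.toNNReal (√ε))⁻¹ else 0)
        ⟨?_, ⟨1, fun x => hφ1 _⟩, Δ, ?_⟩
        (fun x k t => ?_) ?_
      · exact hφ.continuous.comp (L.continuous.comp (by fun_prop))
      · intro x y hxy
        have : Δ.restrict x = Δ.restrict y := funext fun k => hxy k k.2
        simp only [this]
      · have h1 : |φ (L (Δ.restrict (update x k t))) - φ (L (Δ.restrict x))|
            ≤ ‖L‖ * ‖Δ.restrict (update x k t) - Δ.restrict x‖ := by
          have := hφ.dist_le_mul (L (Δ.restrict (update x k t))) (L (Δ.restrict x))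
          rw [Real.dist_eq, Real.dist_eq, NNReal.coe_one, one_mul, ← map_sub] at this
          exact this.trans (L.le_opNorm _)
        by_cases hk : k ∈ Δ
        · have h2 : ‖Δ.restrict (update x k t) - Δ.restrict x‖ ≤ |t - x k| := by
            refine (pi_norm_le_iff_of_nonneg (abs_nonneg _)).2 fun j => ?_
            by_cases hj : (j : Lattice d) = k
            · simp [Finset.restrict, ← hj]
            · simp [Finset.restrict, hj]
          have h3 := sqrt_mul_abs_sub_le hF t (x k)
          have h4 : |t - x k| ≤ (√ε)⁻¹ * |psi F t - psi F (x k)| := by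
            rw [inv_mul_eq_div, le_div_iff₀ hsε]; linarith
          simp only [hk, if_true]
          push_cast
          rw [Real.coe_toNNReal _ hsε.le, mul_assoc]
          exact h1.trans (mul_le_mul_of_nonneg_left (h2.trans h4) (norm_nonneg _))
        · have h2 : Δ.restrict (update x k t) = Δ.restrict x := funext fun j => by
            have : (j : Lattice d) ≠ k := by rintro rfl; exact hk j.2
            simp [Finset.restrict, this]
          simp [h2, hk]
      · rw [tsum_eq_sum (s := Δ) (fun k hk => by simp [hk])]
        exact ENNReal.sum_ne_top.2 fun k _ => ENNReal.coe_ne_top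
    have hcos := key Real.cos (Real.lipschitzWith_cos) Real.abs_cos_le_one
    have hsin := key Real.sin (Real.lipschitzWith_sin) Real.abs_sin_le_one
    have hsplit : ∀ (μ : Measure (Config d)) [IsProbabilityMeasure μ],
        charFunDual (μ.map Δ.restrict) L = ((∫ x, Real.cos (L (Δ.restrict x)) ∂μ : ℝ) : ℂ)
          + ((∫ x, Real.sin (L (Δ.restrict x)) ∂μ : ℝ) : ℂ) * Complex.I := by
      intro μ _
      have hc : Measurable fun x : Config d => L (Δ.restrict x) :=
        L.continuous.measurable.comp hres
      rw [charFunDual_apply, integral_map hres.aemeasurable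
        (Continuous.aestronglyMeasurable (by fun_prop)), ← integral_complex_ofReal,
        ← integral_complex_ofReal, ← integral_mul_const, ← integral_add]
      · refine integral_congr_ae (Eventually.of_forall fun x => ?_)
        simp [Complex.exp_mul_I]
      · exact (Integrable.of_bound (Real.measurable_cos.comp hc).aestronglyMeasurable 1
          (Eventually.of_forall fun x => Real.abs_cos_le_one _)).ofReal
      · exact ((Integrable.of_bound (Real.measurable_sin.comp hc).aestronglyMeasurable 1
          (Eventually.of_forall fun x => Real.abs_sin_le_one _)).ofReal).mul_const _
    rw [hsplit μ, hsplit ν, hcos, hsin]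
  have hfin : ∀ Δ : Finset (Lattice d), IsFiniteMeasure (ν.map Δ.restrict) := fun Δ =>
    inferInstance
  exact IsProjectiveLimit.unique (P := fun Δ => ν.map Δ.restrict) hproj fun Δ => rfl

/-- Dobrushin uniqueness among the Gibbs measures with finite second moments. -/
theorem eq_of_mem_temperedGibbs (M : Model F G ε r₀ lam)
    (hc : ∀ k, k ≠ 0 → coupling F G k < ∞)
    (hq : ∑' k, (influence F G lam k : ℝ≥0∞) < 1) {μ ν : Measure (Config d)}
    (hμ : μ ∈ temperedGibbs F G lam) (hν : ν ∈ temperedGibbs F G lam) : μ = ν := by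
  have hF := M.condA.uniformlyConvex
  have i1 := hμ.1.isProbabilityMeasure
  have i2 := hν.1.isProbabilityMeasure
  refine measure_ext_of_hasOscillation hF fun f δ hf hδ hfin => ?_
  set q := ∑' k, (influence F G lam k : ℝ≥0∞)
  set D := (1 + secondMoment F μ) + (1 + secondMoment F ν)
  have hD : D ≠ ∞ := by
    have h1 := hμ.2.ne
    have h2 := hν.2.ne
    simp only [D, ne_eq, ENNReal.add_eq_top, ENNReal.one_ne_top, h1, h2, or_self,
      not_false_eq_true]
  have hbound : ∀ n : ℕ, ‖(∫ x, f x ∂μ) - ∫ x, f x ∂ν‖ₑ ≤ q ^ n * ((∑' k, (δ k : ℝ≥0∞)) * D) := by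
    intro n
    obtain ⟨g, hg, hgμ, r, hr, hsum⟩ := M.exists_sum_oscillation_le hc le_rfl hq.le hf hδ n
    rw [← hgμ μ hμ.1, ← hgμ ν hν.1, ← mul_assoc]
    exact (HasOscillation.enorm_integral_sub_le hF.contDiff
      (lintegral_abs_psi_le μ)
      (lintegral_abs_psi_le ν) hg hr).trans (mul_le_mul_left hsum _)
  have hlim : Tendsto (fun n : ℕ => q ^ n * ((∑' k, (δ k : ℝ≥0∞)) * D)) atTop (𝓝 0) := by
    have := ENNReal.Tendsto.mul_const (b := (∑' k, (δ k : ℝ≥0∞)) * D)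
      (ENNReal.tendsto_pow_atTop_nhds_zero_of_lt_one hq)
      (Or.inr (ENNReal.mul_ne_top hfin hD))
    simpa using this
  have h0 := ge_of_tendsto' hlim hbound
  exact sub_eq_zero.1 (enorm_eq_zero.1 (le_antisymm h0 zero_le))

end Model

end LatticeGibbs

/-! ### Normalization of the pair potentials -/

namespace LatticeGibbs

open Function

variable {d : ℕ} {F : ℝ → ℝ} {G : Lattice d → ℝ → ℝ} {ε r₀ lam : ℝ}

/-- The pair potentials with their linear parts at the origin removed. -/
noncomputable def normalized (G : Lattice d → ℝ → ℝ) (j : Lattice d) (u : ℝ) : ℝ :=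
  G j u - deriv (G j) 0 * u

/-- The linear parts at the origin of the pair potentials. -/
noncomputable def linearPart (G : Lattice d → ℝ → ℝ) (j : Lattice d) (u : ℝ) : ℝ :=
  deriv (G j) 0 * u

lemma PairSymmetric.deriv_neg (hsymm : PairSymmetric G) {j : Lattice d} (hj : j ≠ 0) (x : ℝ) :
    deriv (G (-j)) (-x) = -deriv (G j) x := by
  have h : G j = fun x => G (-j) (-x) := funext fun x => (hsymm j hj x).symm
  rw [h, deriv_comp_neg, neg_neg]

lemma PairSymmetric.linearPart (hsymm : PairSymmetric G) : PairSymmetric (linearPart G) := by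
  intro j hj x
  have := hsymm.deriv_neg hj 0
  rw [neg_zero] at this
  rw [LatticeGibbs.linearPart, LatticeGibbs.linearPart, this, neg_mul_neg]

lemma PairSymmetric.normalized (hsymm : PairSymmetric G) : PairSymmetric (normalized G) := by
  intro j hj x
  have := hsymm.linearPart j hj x
  simp only [LatticeGibbs.linearPart] at this
  rw [LatticeGibbs.normalized, LatticeGibbs.normalized, this, hsymm j hj x]

namespace ConditionB

lemma linearPart_eq_zero (hB : ConditionB G r₀) {j : Lattice d} (hj : j ≠ 0) (h : r₀ < ‖j‖)
    (x : ℝ) : linearPart G j x = 0 := by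
  have : G j = fun _ => 0 := funext (hB.finiteRange j hj h)
  simp [linearPart, this]

lemma deriv_normalized (hB : ConditionB G r₀) {j : Lattice d} (hj : j ≠ 0) :
    deriv (normalized G j) = fun x => deriv (G j) x - deriv (G j) 0 := by
  funext x
  have h1 := (differentiable_of_contDiff_two (hB.contDiff j hj) x).hasDerivAt
  have h2 := h1.sub ((hasDerivAt_id x).const_mul (deriv (G j) 0))
  simpa using! h2.deriv

lemma deriv_deriv_normalized (hB : ConditionB G r₀) {j : Lattice d} (hj : j ≠ 0) :
    deriv (deriv (normalized G j)) = deriv (deriv (G j)) := by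
  rw [hB.deriv_normalized hj]
  funext x
  exact deriv_sub_const _

lemma normalized (hB : ConditionB G r₀) : ConditionB (normalized G) r₀ where
  contDiff j hj := (hB.contDiff j hj).sub (contDiff_const.mul contDiff_id)
  zero j hj := by simp [LatticeGibbs.normalized, hB.zero j hj]
  convex j hj x := by rw [hB.deriv_deriv_normalized hj]; exact hB.convex j hj x
  finiteRange j hj h x := by
    have := hB.linearPart_eq_zero hj h x
    rw [linearPart] at this
    rw [LatticeGibbs.normalized, this, hB.finiteRange j hj h x, sub_zero]

/-- A convex function vanishing together with its derivative at the origin is nonnegative. -/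
lemma normalized_nonneg (hB : ConditionB G r₀) {j : Lattice d} (hj : j ≠ 0) (u : ℝ) :
    0 ≤ LatticeGibbs.normalized G j u := by
  have hd := differentiable_of_contDiff_two (hB.normalized.contDiff j hj)
  have hmono : Monotone (deriv (LatticeGibbs.normalized G j)) :=
    monotone_of_deriv_nonneg (differentiable_deriv (hB.normalized.contDiff j hj))
      (hB.normalized.convex j hj)
  have h0 : deriv (LatticeGibbs.normalized G j) 0 = 0 := by rw [hB.deriv_normalized hj]; simp
  have hconv : ConvexOn ℝ Set.univ (LatticeGibbs.normalized G j) :=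
    hmono.convexOn_univ_of_deriv hd
  have h00 := hB.normalized.zero j hj
  rcases lt_trichotomy u 0 with h | rfl | h
  · have := hconv.slope_le_deriv (Set.mem_univ u) (Set.mem_univ 0) h (hd 0)
    rw [h0, slope_def_field, h00, div_le_iff₀ (by linarith)] at this
    linarith
  · exact h00.ge
  · have := hconv.deriv_le_slope (Set.mem_univ 0) (Set.mem_univ u) h (hd 0)
    rw [h0, slope_def_field, h00, le_div_iff₀ (by linarith)] at this
    linarith

lemma coupling_normalized (hB : ConditionB G r₀) {k : Lattice d} (hk : k ≠ 0) :
    coupling F (LatticeGibbs.normalized G) k = coupling F G k := by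
  rw [coupling, hB.deriv_deriv_normalized hk, coupling]

lemma coupling_lt_top (hB : ConditionB G r₀) (hC : ConditionC F G r₀) {k : Lattice d}
    (hk : k ≠ 0) : coupling F G k < ∞ := by
  rcases le_or_gt ‖k‖ r₀ with h | h
  · exact hC k hk h
  · have : G k = fun _ => 0 := funext (hB.finiteRange k hk h)
    simp [coupling, this]

end ConditionB

lemma model_normalized (hA : ConditionA F ε) (hB : ConditionB G r₀) (hsymm : PairSymmetric G)
    (hlam : 0 ≤ lam) : Model F (normalized G) ε r₀ lam :=
  ⟨hA, hB.normalized, hsymm.normalized, hlam, fun _ hj => hB.normalized_nonneg hj⟩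

lemma even_normalized (hG : ∀ j, j ≠ 0 → ∀ x, G j (-x) = G j x) (j : Lattice d) (hj : j ≠ 0)
    (x : ℝ) : normalized G j (-x) = normalized G j x := by
  have h : deriv (G j) 0 = 0 := by
    have h1 := deriv_comp_neg (G j) 0
    rw [funext (hG j hj), neg_zero] at h1
    linarith
  simp [normalized, h, hG j hj x]

/-- The linear parts of the forces exerted on one site by all others cancel. -/
lemma sum_deriv_zero_eq_zero (hsymm : PairSymmetric G)
    (hG : ∀ j, j ≠ 0 → r₀ < ‖j‖ → ∀ x, G j x = 0) {Λ B : Finset (Lattice d)}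
    (hB : collar r₀ Λ ⊆ B) {k : Lattice d} (hk : k ∈ Λ) :
    ∑ j ∈ B, (if k ≠ j then deriv (G (k - j)) 0 else 0) = 0 := by
  classical
  set g : Lattice d → ℝ := fun i => if i = 0 then 0 else deriv (G i) 0
  have h1 : ∑ j ∈ B, (if k ≠ j then deriv (G (k - j)) 0 else 0) = ∑' j, g (k - j) := by
    rw [tsum_eq_sum (s := B)]
    · refine Finset.sum_congr rfl fun j _ => ?_
      simp only [g, sub_eq_zero, ne_eq, ite_not]
    · intro j hj
      by_cases hkj : k - j = 0
      · simp [g, hkj]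
      · have hr : r₀ < ‖k - j‖ := by
          by_contra hle
          exact hj (hB (mem_collar_of_norm_le hk (not_lt.1 hle)))
        have : G (k - j) = fun _ => 0 := funext (hG _ hkj hr)
        simp [g, this]
  have h2 : ∀ i, g (-i) = -g i := by
    intro i
    by_cases hi : i = 0
    · simp [g, hi]
    · have := hsymm.deriv_neg hi 0
      rw [neg_zero] at this
      simp [g, hi, this]
  -- `g` is odd
  have h3 : ∑' i, g i = -∑' i, g i := by
    conv_lhs => rw [← (Equiv.neg (Lattice d)).tsum_eq]
    simp only [Equiv.neg_apply, h2, tsum_neg]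
  have h4 : ∑' j, g (k - j) = ∑' i, g i := (Equiv.subLeft k).tsum_eq g
  rw [h1, h4]
  linarith

/-- The interaction energy of the linear parts depends only on the spins off `Λ`. -/
lemma exists_interaction_linearPart_eq (hsymm : PairSymmetric G) (hB : ConditionB G r₀)
    (Λ : Finset (Lattice d)) (y : Config d) :
    ∃ c, ∀ x : Λ → ℝ, interaction (linearPart G) Λ (glue Λ y x) = c := by
  set B := collar r₀ Λ
  set a : Lattice d → Lattice d → ℝ := fun k j =>
    if k ≠ j ∧ (k ∈ Λ ∨ j ∈ Λ) then deriv (G (k - j)) 0 else 0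
  have ha : ∀ k j, a j k = -a k j := by
    intro k j
    by_cases h : k = j
    · simp [a, h]
    · have := hsymm.deriv_neg (sub_ne_zero.2 h) 0
      rw [neg_zero, neg_sub] at this
      simp only [a, this, ne_eq, h, Ne.symm (h : k ≠ j), not_false_eq_true, true_and,
        or_comm (a := j ∈ Λ)]
      split_ifs <;> simp
  have hsum : ∀ x : Config d, interaction (linearPart G) Λ x
      = ∑ k ∈ B, x k * ∑ j ∈ B, a k j := by
    intro x
    have h1 : ∀ k j, pairTerm (linearPart G) Λ x k j = x k * a k j + x j * a j k := by
      intro k j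
      rw [ha k j]
      simp only [pairTerm, linearPart, a]
      split_ifs <;> ring
    rw [interaction_eq_sum hsymm.linearPart (fun j hj h => hB.linearPart_eq_zero hj h)
      Finset.Subset.rfl]
    simp only [h1, Finset.sum_add_distrib]
    rw [Finset.sum_comm (f := fun k j => x j * a j k)]
    simp only [Finset.mul_sum]
    ring
  refine ⟨∑ k ∈ B \ Λ, y k * ∑ j ∈ B, a k j, fun x => ?_⟩
  rw [hsum, ← Finset.sum_sdiff (subset_collar r₀ Λ)]
  have h0 : ∑ k ∈ Λ, glue Λ y x k * ∑ j ∈ B, a k j = 0 := by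
    refine Finset.sum_eq_zero fun k hk => ?_
    have : ∑ j ∈ B, a k j = 0 := by
      simpa [a, hk] using sum_deriv_zero_eq_zero hsymm hB.finiteRange Finset.Subset.rfl hk
    rw [this, mul_zero]
  rw [h0, add_zero]
  refine Finset.sum_congr rfl fun k hk => ?_
  rw [glue, dif_neg (Finset.mem_sdiff.1 hk).2]

lemma interaction_eq_add (hsymm : PairSymmetric G) (hB : ConditionB G r₀)
    (Λ : Finset (Lattice d)) (x : Config d) :
    interaction G Λ x = interaction (normalized G) Λ x + interaction (linearPart G) Λ x := by
  rw [interaction_eq_sum hsymm hB.finiteRange Finset.Subset.rfl,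
    interaction_eq_sum hsymm.normalized hB.normalized.finiteRange Finset.Subset.rfl,
    interaction_eq_sum hsymm.linearPart (fun j hj h => hB.linearPart_eq_zero hj h)
      Finset.Subset.rfl, ← mul_add, ← Finset.sum_add_distrib]
  congr 1
  refine Finset.sum_congr rfl fun k _ => ?_
  rw [← Finset.sum_add_distrib]
  refine Finset.sum_congr rfl fun j _ => ?_
  simp only [pairTerm, normalized, linearPart]
  split_ifs <;> ring

/-- Removing the linear parts of the pair potentials changes the weights only by a factor
depending on the boundary condition, so it leaves the conditional expectations unchanged. -/
lemma condMean_normalized (hsymm : PairSymmetric G) (hB : ConditionB G r₀)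
    (Λ : Finset (Lattice d)) : condMean F (normalized G) lam Λ = condMean F G lam Λ := by
  funext f y
  obtain ⟨c, hc⟩ := exists_interaction_linearPart_eq hsymm hB Λ y
  have hw : ∀ x : Λ → ℝ, weight F G lam Λ (glue Λ y x)
      = Real.exp (-(lam * c)) * weight F (normalized G) lam Λ (glue Λ y x) := by
    intro x
    rw [weight, weight, interaction_eq_add hsymm hB, hc, ← mul_assoc, ← Real.exp_add]
    congr 2
    ring
  have he := (Real.exp_pos (-(lam * c))).ne'
  simp only [condMean, partitionFn, hw, mul_left_comm _ (Real.exp (-(lam * c))),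
    integral_const_mul]
  rw [mul_inv]
  field_simp

lemma temperedGibbs_normalized (hsymm : PairSymmetric G) (hB : ConditionB G r₀) :
    temperedGibbs F (normalized G) lam = temperedGibbs F G lam := by
  ext μ
  refine and_congr_left fun _ => ⟨fun h => ⟨h.1, fun Λ f hf => ?_⟩,
    fun h => ⟨h.1, fun Λ f hf => ?_⟩⟩
  · rw [← condMean_normalized hsymm hB]; exact h.2 Λ f hf
  · rw [condMean_normalized hsymm hB]; exact h.2 Λ f hf

/-! ### Existence, uniqueness and Gaussian moments -/

/-- A measure whose coordinates have bounded second moments about `p` in the metric `ρ` is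
tempered. -/
lemma secondMoment_lt_top (hF : ContDiff ℝ 2 F) {p : ℝ} {μ : Measure (Config d)}
    [IsProbabilityMeasure μ]
    (h : ∀ k, ∫⁻ x, ENNReal.ofReal ((psi F (x k) - psi F p) ^ 2) ∂μ ≤ 1) :
    secondMoment F μ < ∞ := by
  refine lt_of_le_of_lt (b := 2 + ENNReal.ofReal (2 * psi F p ^ 2)) (iSup_le fun k => ?_)
    (ENNReal.add_lt_top.2 ⟨ENNReal.ofNat_lt_top, ENNReal.ofReal_lt_top⟩)
  have hm : Measurable fun x : Config d => ENNReal.ofReal ((psi F (x k) - psi F p) ^ 2) := by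
    have := continuous_psi hF
    exact Measurable.ennreal_ofReal (by fun_prop)
  calc ∫⁻ x, ENNReal.ofReal (rho F (x k) 0 ^ 2) ∂μ
      ≤ ∫⁻ x, (2 * ENNReal.ofReal ((psi F (x k) - psi F p) ^ 2)
          + ENNReal.ofReal (2 * psi F p ^ 2)) ∂μ := by
        refine lintegral_mono fun x => ?_
        rw [rho_zero_right, neg_sq, ← ENNReal.ofReal_ofNat 2, ← ENNReal.ofReal_mul zero_le_two,
          ← ENNReal.ofReal_add (by positivity) (by positivity)]
        exact ENNReal.ofReal_le_ofReal (by nlinarith [sq_nonneg (psi F (x k) - 2 * psi F p)])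
    _ = 2 * ∫⁻ x, ENNReal.ofReal ((psi F (x k) - psi F p) ^ 2) ∂μ
          + ENNReal.ofReal (2 * psi F p ^ 2) := by
        rw [lintegral_add_right _ measurable_const, lintegral_const_mul _ hm]; simp
    _ ≤ 2 + ENNReal.ofReal (2 * psi F p ^ 2) := by
        gcongr
        exact mul_le_of_le_one_right zero_le (h k)

/-- The total influence of a site is smaller than one for `λ < 1 / γ_δ`. The weights `e^{δ(k,0)}`
are at least one and can be dropped. -/
lemma tsum_influence_lt_one (hc : ∀ k, k ≠ 0 → coupling F G k < ∞)
    {δ : Lattice d → Lattice d → ℝ} (hδ : IsInvariantSemimetric δ)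
    (h : ENNReal.ofReal lam < 1 / gammaConst F G δ) :
    ∑' k, (influence F G lam k : ℝ≥0∞) < 1 := by
  rw [tsum_influence hc]
  refine lt_of_le_of_lt (mul_le_mul_right (ENNReal.tsum_le_tsum fun k => ?_) _)
    (ENNReal.mul_lt_of_lt_div h)
  refine le_mul_of_one_le_left zero_le ?_
  rw [← ENNReal.ofReal_one]
  exact ENNReal.ofReal_le_ofReal (Real.one_le_exp (hδ.nonneg _ _))

/-- For even potentials there is a tempered Gibbs measure with the Gaussian moment bound. -/
lemma Model.exists_gaussian_moments (M : Model F G ε r₀ lam) (hF : ∀ x, F (-x) = F x)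
    (hG : ∀ j, j ≠ 0 → ∀ x, G j (-x) = G j x) :
    ∃ μ ∈ temperedGibbs F G lam, ∀ a : ℝ, 0 ≤ a → a < ε / 2 → ∀ k,
      ∫⁻ x, ENNReal.ofReal (Real.exp (a * x k ^ 2)) ∂μ
        ≤ ENNReal.ofReal (Real.exp (a / (ε - 2 * a))) := by
  have h0 : deriv F 0 = 0 := by
    have h1 := deriv_comp_neg F 0
    rw [funext hF, neg_zero] at h1
    linarith
  obtain ⟨μ, hμ, hm, hφ⟩ := M.exists_isGibbs h0
  have := hμ.isProbabilityMeasure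
  refine ⟨μ, ⟨hμ, secondMoment_lt_top M.condA.contDiff hm⟩, fun a ha0 ha k => ?_⟩
  refine hφ (fun u => Real.exp (a * u ^ 2)) (by fun_prop) (fun _ => (Real.exp_pos _).le) _
    ENNReal.ofReal_ne_top (fun Λ j => ?_) k
  have := M.isProbabilityMeasure_finiteVolume Λ (fun _ => (0 : ℝ))
  exact lintegral_exp_mul_sq_le _ (measurable_pi_apply j) M.condA.eps_pos
    (M.lintegral_exp_mul_finiteVolume_le hF hG Λ j) ha0 ha

end LatticeGibbs

/-- Existence of Gibbs measures with `m_μ < ∞` for every coupling `lam ≥ 0`; for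
`lam < 1 / γ_δ` (where `1 / 0 = ∞`) there is exactly one, and for even potentials it satisfies
the Gaussian moment bound. -/
theorem theorem2 {d : ℕ} (F : ℝ → ℝ) (G : LatticeGibbs.Lattice d → ℝ → ℝ) (ε r₀ lam : ℝ)
    (hA : LatticeGibbs.ConditionA F ε) (hB : LatticeGibbs.ConditionB G r₀)
    (hC : LatticeGibbs.ConditionC F G r₀) (hsymm : LatticeGibbs.PairSymmetric G)
    (hlam : 0 ≤ lam) :
    (LatticeGibbs.temperedGibbs F G lam).Nonempty ∧
    ∀ δ : LatticeGibbs.Lattice d → LatticeGibbs.Lattice d → ℝ,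
      LatticeGibbs.IsInvariantSemimetric δ →
      ENNReal.ofReal lam < 1 / LatticeGibbs.gammaConst F G δ →
      ∃ μ : Measure (LatticeGibbs.Config d),
        LatticeGibbs.temperedGibbs F G lam = {μ} ∧
        ((∀ x, F (-x) = F x) → (∀ j, j ≠ 0 → ∀ x, G j (-x) = G j x) →
          ∀ a : ℝ, 0 ≤ a → a < ε / 2 →
            ⨆ k : LatticeGibbs.Lattice d, ∫⁻ x, ENNReal.ofReal (Real.exp (a * x k ^ 2)) ∂μ
              ≤ ENNReal.ofReal (Real.exp (a / (ε - 2 * a)))) := by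
  have M := LatticeGibbs.model_normalized hA hB hsymm hlam
  have hne : (LatticeGibbs.temperedGibbs F G lam).Nonempty := by
    rw [← LatticeGibbs.temperedGibbs_normalized hsymm hB]
    obtain ⟨p, hp⟩ := hA.uniformlyConvex.exists_deriv_eq_zero
    obtain ⟨μ, hμ, hm, -⟩ := M.exists_isGibbs hp
    have := hμ.isProbabilityMeasure
    exact ⟨μ, hμ, LatticeGibbs.secondMoment_lt_top hA.contDiff hm⟩
  refine ⟨hne, fun δ hδ hγ => ?_⟩
  obtain ⟨μ, hμ⟩ := hne
  have hc : ∀ k, k ≠ 0 → LatticeGibbs.coupling F (LatticeGibbs.normalized G) k < ∞ :=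
    fun k hk => by rw [hB.coupling_normalized hk]; exact hB.coupling_lt_top hC hk
  have hγ' : LatticeGibbs.gammaConst F (LatticeGibbs.normalized G) δ
      = LatticeGibbs.gammaConst F G δ :=
    tsum_congr fun k => by rw [hB.coupling_normalized k.2]
  rw [← hγ'] at hγ
  have huniq : ∀ ν ∈ LatticeGibbs.temperedGibbs F G lam, ν = μ := by
    rw [← LatticeGibbs.temperedGibbs_normalized hsymm hB] at hμ ⊢
    exact fun ν hν =>
      M.eq_of_mem_temperedGibbs hc (LatticeGibbs.tsum_influence_lt_one hc hδ hγ) hν hμ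
  refine ⟨μ, Set.eq_singleton_iff_unique_mem.2 ⟨hμ, huniq⟩, fun hF hG a ha0 ha => ?_⟩
  obtain ⟨ν, hν, hbound⟩ := M.exists_gaussian_moments hF (LatticeGibbs.even_normalized hG)
  rw [LatticeGibbs.temperedGibbs_normalized hsymm hB] at hν
  rw [← huniq ν hν]
  exact iSup_le (hbound a ha0 ha)
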